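/- Let $d\ge 1$ and let $|\cdot|$ denote Lebesgue measure on $\mathbb{R}^d$. For $\gamma\in(0,1]$ and $a=(a_1,\dots,a_d)\in(0,\infty)^d$, a set $S\subset\mathbb{R}^d$ is called $(\gamma,a)$-thick if it is (Lebesgue) measurable and $$|S\cap(x+[0,a_1]\times\cdots\times[0,a_d])|\ \ge\ \gamma\prod_{j=1}^d a_j\qquad\text{for all }x\in\mathbb{R}^d,$$ and thick if it is $(\gamma,a)$-thick for some such $\gamma$ and $a$. For $T>0$, a measurable set $S\subset\mathbb{R}^d$, a real-valued $u_0\in L^2(\mathbb{R}^d)$ and a control $v\in L^2([0,T]\times\mathbb{R}^d)$, $v$ real-valued, consider the controlled heat equation $$\partial_t u-\Delta u=\chi_S v\ \text{ on }[0,T]\times\mathbb{R}^d,\qquad u(0,\cdot)=u_0 ,$$ where $u\in C([0,T];L^2(\mathbb{R}^d))$ is the weak solution, that is, for all $\varphi\in C_c^\infty(\mathbb{R}^d)$ and all $t\in[0,T]$, $$\langle u(t),\varphi\rangle=\langle u_0,\varphi\rangle+\int_0^t\langle u(s),\Delta\varphi\rangle\,ds+\int_0^t\langle\chi_S v(s,\cdot),\varphi\rangle\,ds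 .$$ The equation is null-controllable in time $T$ with control set $S$ if for every $u_0\in L^2(\mathbb{R}^d)$ there is a control $v\in L^2([0,T]\times\mathbb{R}^d)$ such that the solution satisfies $u(T,\cdot)=0$. The control cost is $$C_T:=\sup_{\|u_0\|_{L^2(\mathbb{R}^d)}=1}\ \inf\{\|v\|_{L^2([0,T]\times S)} : v\in L^2([0,T]\times\mathbb{R}^d)\text{ and the solution }u\text{ satisfies }u(T,\cdot)=0\}\in[0,\infty].$$ **Theorem.** (1) For every $d\ge1$, every measurable $S\subset\mathbb{R}^d$ and every $T>0$, the set $S$ is thick if and only if the heat equation on $\mathbb{R}^d$ with control set $S$ is null-controllable in time $T$. (2) There is a universal constant $K\ge 1$ such that for every $d\ge1$, $\gamma\in(0,1]$, $a\in(0,\infty)^d$, every $(\gamma,a)$-thick set $S\subset\mathbb{R}^d$ and every $T>0$, $$C_T\le C_1^{1/2}\exp\Big(\frac{C_1}{2T}\Big),\qquad C_1=\Big(\frac{K^d}{\gamma}\Big)^{K(d+\|a\|_1)},\qquad \|a\|_1=a_1+\dots+a_d .$$ -/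

import Mathlib

open MeasureTheory Set
open scoped ENNReal ContDiff

noncomputable section

namespace HeatControl

/-- Euclidean space `ℝ^d`. -/
abbrev E (d : ℕ) : Type := EuclideanSpace ℝ (Fin d)

/-- The real Hilbert space `L²(ℝ^d)` for Lebesgue measure. -/
abbrev L2 (d : ℕ) : Type := Lp ℝ 2 (volume : Measure (E d))

/-- The closed box `[0,a₁] × ⋯ × [0,a_d]`. -/
def box {d : ℕ} (a : Fin d → ℝ) : Set (E d) := {y | ∀ j, 0 ≤ y j ∧ y j ≤ a j}

/-- `S` is `(γ, a)`-thick: `γ ∈ (0,1]`, all `a_j` are positive, `S` is Lebesgue measurable, and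
every translate `x + A` of the box `A = [0,a₁] × ⋯ × [0,a_d]` meets `S` in Lebesgue measure at
least `γ a₁ ⋯ a_d`. -/
structure IsThickWith {d : ℕ} (S : Set (E d)) (γ : ℝ) (a : Fin d → ℝ) : Prop where
  gamma_pos : 0 < γ
  gamma_le_one : γ ≤ 1
  a_pos : ∀ j, 0 < a j
  measurable : NullMeasurableSet S volume
  measure_ge : ∀ x : E d,
    ENNReal.ofReal (γ * ∏ j, a j) ≤ volume (S ∩ (fun y => x + y) '' box a)

/-- `S` is thick: it is `(γ, a)`-thick for some `γ` and `a`. -/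
def IsThick {d : ℕ} (S : Set (E d)) : Prop :=
  ∃ (γ : ℝ) (a : Fin d → ℝ), IsThickWith S γ a

/-- `v ∈ L²([0,T] × ℝ^d)`, a control function. -/
def IsControl {d : ℕ} (T : ℝ) (v : ℝ × E d → ℝ) : Prop :=
  MemLp v 2 (((volume : Measure ℝ).restrict (Icc 0 T)).prod (volume : Measure (E d)))

/-- `u ∈ C([0,T]; L²(ℝ^d))` is the (weak) solution of the controlled heat equation
`∂ₜ u - Δ u = χ_S v` on `[0,T] × ℝ^d` with `u(0) = u₀`: for every test function
`φ ∈ C_c^∞(ℝ^d)` and every `t ∈ [0,T]`,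
`⟨u(t), φ⟩ = ⟨u₀, φ⟩ + ∫₀ᵗ ⟨u(s), Δφ⟩ ds + ∫₀ᵗ ⟨χ_S v(s,·), φ⟩ ds`. -/
structure IsSolution {d : ℕ} (S : Set (E d)) (T : ℝ) (u₀ : L2 d) (v : ℝ × E d → ℝ)
    (u : ℝ → L2 d) : Prop where
  continuousOn : ContinuousOn u (Icc 0 T)
  weak_eq : ∀ φ : E d → ℝ, ContDiff ℝ ∞ φ → HasCompactSupport φ → ∀ t ∈ Icc 0 T,
    ∫ x, u t x * φ x =
      (∫ x, u₀ x * φ x)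
        + (∫ s in (0 : ℝ)..t, ∫ x, u s x * Laplacian.laplacian φ x)
        + ∫ s in (0 : ℝ)..t, ∫ x, S.indicator (fun y => v (s, y)) x * φ x

/-- The control `v ∈ L²([0,T] × ℝ^d)`, acting on `S`, steers the initial datum `u₀` to zero in
time `T`. -/
def SteersToZero {d : ℕ} (S : Set (E d)) (T : ℝ) (u₀ : L2 d) (v : ℝ × E d → ℝ) : Prop :=
  IsControl T v ∧ ∃ u : ℝ → L2 d, IsSolution S T u₀ v u ∧ u T = 0

/-- The heat equation on `ℝ^d` with control set `S` is null-controllable in time `T`. -/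
def NullControllable {d : ℕ} (S : Set (E d)) (T : ℝ) : Prop :=
  ∀ u₀ : L2 d, ∃ v : ℝ × E d → ℝ, SteersToZero S T u₀ v

/-- The control cost
`C_T = sup_{‖u₀‖ = 1} inf {‖v‖_{L²([0,T] × S)} | v steers u₀ to zero in time T}`,
as an element of `[0,∞]` (so the infimum of the empty set is `∞`). -/
def controlCost {d : ℕ} (S : Set (E d)) (T : ℝ) : ℝ≥0∞ :=
  ⨆ (u₀ : L2 d) (_ : ‖u₀‖ = 1), ⨅ (v : ℝ × E d → ℝ) (_ : SteersToZero S T u₀ v),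
    eLpNorm v 2 (((volume : Measure ℝ).restrict (Icc 0 T)).prod
      ((volume : Measure (E d)).restrict S))

/-- The constant `C₁ = (K^d / γ)^{K (d + ‖a‖₁)}`, with `‖a‖₁ = a₁ + ⋯ + a_d`. -/
def costConstant (K : ℝ) {d : ℕ} (γ : ℝ) (a : Fin d → ℝ) : ℝ :=
  (K ^ d / γ) ^ (K * ((d : ℝ) + ∑ j, a j))

end HeatControl

end

/-! By duality both parts reduce to final-state observability of the free heat flow: the norm of the
flow at time `T` is at most `C` times its norm in L² of (0,T) × S. The map from controls to final
states is the adjoint of the observation operator (`inner_duhamel`), so `v` steers `u₀` to zero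
exactly when ⟨obs z, v⟩ = -⟨heat_T z, û₀⟩ for all `z`. Observability with constant `C` yields, by
Hahn–Banach and Riesz, a control of norm at most `C ‖u₀‖` (`exists_inner_eq_of_norm_le`,
`exists_steersToZero`). Conversely, weak solutions are unique (`eq_zero_of_weak`), so
null-controllability bounds these functionals one datum at a time, and Banach–Steinhaus supplies a
common constant (`observability_of_nullControllable`).

Thick sets are observable because of a Logvinenko–Sereda inequality (`logvinenko_sereda`): if the
frequencies of f lie in |ξ| ≤ λ, then ‖f‖ ≤ d₀ exp(d₁ λ) ‖f‖ on S. On a segment t ↦ x + t w with w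
in the box, f is its Taylor polynomial plus an error which Plancherel makes small in L². A
Remez-type bound, proved by Lagrange interpolation, says that a polynomial is seldom much smaller
than its value at t = 0, here f(x). Thickness makes x + t w lie in S for a fixed proportion of the
pairs (w, t) with t near 1. Averaging over these pairs and integrating in x gives the inequality.
The Lebeau–Robbiano scheme then observes low frequencies, lets the flow damp high ones, and
telescopes over the times T / 2^n with cutoffs Λ 2^n (`observability_of_spectralInequality`).

Observable sets are thick because all translates of one fixed wave packet have the same energy at
time `T`, while away from a large ball around its centre a packet has little energy; so S must meet
a box containing that ball in a uniform amount (`isThick_of_observability`). -/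

noncomputable section

open FourierTransform
open scoped Laplacian SchwartzMap

namespace HeatControl

/-! ### Remez-type estimate for polynomials via Lagrange interpolation. -/

section

/-- A set of reals of outer measure larger than `N * h` contains
`N + 1` points with consecutive gaps at least `h`. -/
theorem exists_separated_points {h : ℝ} (hh : 0 < h) (N : ℕ) (M : Set ℝ) (hM : BddBelow M)
    (hv : ENNReal.ofReal (N * h) < volume M) :
    ∃ t : ℕ → ℝ, (∀ i ≤ N, t i ∈ M) ∧ ∀ i < N, t i + h ≤ t (i + 1) := by
  induction N generalizing M with
  | zero =>
    have hne : M.Nonempty := by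
      by_contra hne
      rw [not_nonempty_iff_eq_empty] at hne
      simp [hne] at hv
    obtain ⟨x, hx⟩ := hne
    exact ⟨fun _ => x, fun _ _ => hx, fun i hi => absurd hi (Nat.not_lt_zero i)⟩
  | succ N ih =>
    have hne : M.Nonempty := by
      by_contra hne
      rw [not_nonempty_iff_eq_empty] at hne
      simp [hne] at hv
    -- The infimum of `M` need not belong to `M`, so the first point `x` is only taken within `r` of
    -- it. Discarding everything below `x + h` then costs less than `h + r` in measure, which the
    -- strict hypothesis can pay for.
    obtain ⟨r, hr0, hr⟩ : ∃ r : ℝ, 0 < r ∧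
        ENNReal.ofReal ((N + 1 : ℕ) * h + r) < volume M := by
      obtain ⟨c, hc1, hc2⟩ := ENNReal.lt_iff_exists_real_btwn.1 hv |>.imp fun _ h => h.2
      rw [ENNReal.ofReal_lt_ofReal_iff_of_nonneg (by positivity)] at hc1
      refine ⟨c - (N + 1 : ℕ) * h, by linarith, ?_⟩
      convert hc2 using 2
      ring
    obtain ⟨x, hxM, hx⟩ := exists_lt_of_csInf_lt hne (lt_add_of_pos_right (sInf M) hr0)
    have hsub : M ⊆ (Icc (sInf M) (x + h)) ∪ (M ∩ Ici (x + h)) := by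
      intro y hy
      rcases le_total (x + h) y with hy' | hy'
      · exact Or.inr ⟨hy, hy'⟩
      · exact Or.inl ⟨csInf_le hM hy, hy'⟩
    have hvol : ENNReal.ofReal (N * h) < volume (M ∩ Ici (x + h)) := by
      by_contra hcon
      rw [not_lt] at hcon
      have h1 : volume M ≤ ENNReal.ofReal (x + h - sInf M) + ENNReal.ofReal (N * h) := by
        refine (measure_mono hsub).trans ((measure_union_le _ _).trans ?_)
        rw [Real.volume_Icc]
        gcongr
      have h2 : ENNReal.ofReal (x + h - sInf M) + ENNReal.ofReal (N * h)
          ≤ ENNReal.ofReal ((N + 1 : ℕ) * h + r) := by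
        rw [← ENNReal.ofReal_add (by linarith [csInf_le hM hxM]) (by positivity)]
        apply ENNReal.ofReal_le_ofReal
        push_cast
        linarith
      exact absurd hr (not_lt.2 (h1.trans h2))
    obtain ⟨t, ht1, ht2⟩ := ih (M ∩ Ici (x + h)) (hM.mono inter_subset_left) hvol
    refine ⟨fun i => Nat.casesOn i x t, ?_, ?_⟩
    · rintro (_ | i) hi
      · exact hxM
      · exact (ht1 i (by omega)).1
    · rintro (_ | i) hi
      · exact (ht1 0 (by omega)).2
      · exact ht2 i (by omega)

theorem gap_mul_le_of_consecutive {h : ℝ} {N : ℕ} {t : ℕ → ℝ}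
    (ht : ∀ i < N, t i + h ≤ t (i + 1)) {i j : ℕ} (hij : i ≤ j) (hj : j ≤ N) :
    ((j - i : ℕ) : ℝ) * h ≤ t j - t i := by
  induction j, hij using Nat.le_induction with
  | base => simp
  | succ j hij ih =>
    have h1 := ih (by omega)
    have h2 := ht j (by omega)
    rw [Nat.succ_sub hij]
    push_cast
    linarith

theorem prod_range_erase_abs_sub (N i : ℕ) (hi : i ≤ N) :
    ∏ j ∈ (Finset.range (N + 1)).erase i, |(i : ℝ) - j| = (i.factorial : ℝ) * (N - i).factorial := by
  have hsplit : (Finset.range (N + 1)).erase i = Finset.range i ∪ Finset.Ico (i + 1) (N + 1) := by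
    ext j; simp; omega
  have hdisj : Disjoint (Finset.range i) (Finset.Ico (i + 1) (N + 1)) := by
    rw [Finset.disjoint_left]; intro j; simp; omega
  rw [hsplit, Finset.prod_union hdisj]
  congr 1
  · rw [← Finset.prod_range_reflect, ← Finset.prod_range_add_one_eq_factorial]
    push_cast
    refine Finset.prod_congr rfl fun j hj => ?_
    rw [Finset.mem_range] at hj
    have : ((i - 1 - j : ℕ) : ℝ) = i - 1 - j := by
      rw [Nat.sub_sub, Nat.cast_sub (by omega)]; push_cast; ring
    rw [this, abs_of_nonneg] <;> ring_nf
    positivity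
  · rw [Finset.prod_Ico_eq_prod_range, ← Finset.prod_range_add_one_eq_factorial]
    rw [Nat.add_sub_add_right]
    push_cast
    refine Finset.prod_congr rfl fun j hj => ?_
    rw [abs_of_nonpos] <;> ring_nf
    linarith [(Nat.cast_nonneg j : (0:ℝ) ≤ j)]

/-- The Lebesgue constant at the endpoint `0` of nodes in `[0,1]` with gaps at least `h`. -/
theorem sum_norm_lagrange_basis_eval_zero_le {h : ℝ} (hh : 0 < h) {N : ℕ} {t : ℕ → ℝ}
    (h01 : ∀ i ≤ N, t i ∈ Icc (0 : ℝ) 1) (ht : ∀ i < N, t i + h ≤ t (i + 1)) :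
    ∑ i ∈ Finset.range (N + 1),
      ‖(Lagrange.basis (Finset.range (N + 1)) (fun i => (t i : ℂ)) i).eval 0‖
      ≤ (2 / h) ^ N / N.factorial := by
  -- Since |t i - t j| ≥ |i - j| h and |t j| ≤ 1, the i-th basis polynomial at 0 is at most 1 / (h^N
  -- i! (N-i)!), a binomial coefficient over h^N N!. The binomials sum to 2^N.
  have key : ∀ i ∈ Finset.range (N + 1),
      ‖(Lagrange.basis (Finset.range (N + 1)) (fun i => (t i : ℂ)) i).eval 0‖
        ≤ (N.choose i : ℝ) * ((1 / h) ^ N / N.factorial) := by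
    intro i hi
    have hiN : i ≤ N := by simpa [Nat.lt_succ_iff] using hi
    have h1 : ‖(Lagrange.basis (Finset.range (N + 1)) (fun i => (t i : ℂ)) i).eval 0‖
        ≤ ∏ j ∈ (Finset.range (N + 1)).erase i, (1 / (|(i : ℝ) - j| * h)) := by
      rw [Lagrange.basis, Polynomial.eval_prod, norm_prod]
      refine Finset.prod_le_prod (fun _ _ => norm_nonneg _) fun j hj => ?_
      obtain ⟨hji, hj⟩ := Finset.mem_erase.1 hj
      have hjN : j ≤ N := by simpa [Nat.lt_succ_iff] using hj
      have hgap : |(i : ℝ) - j| * h ≤ |t i - t j| := by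
        rcases le_total i j with hij | hij
        · have := gap_mul_le_of_consecutive ht hij hjN
          rw [Nat.cast_sub hij] at this
          rw [abs_sub_comm, abs_of_nonneg (by simpa using hij), abs_sub_comm]
          exact this.trans (le_abs_self _)
        · have := gap_mul_le_of_consecutive ht hij hiN
          rw [Nat.cast_sub hij] at this
          rw [abs_of_nonneg (by simpa using hij)]
          exact this.trans (le_abs_self _)
      have hpos : 0 < |(i : ℝ) - j| * h := by
        have : (i : ℝ) - j ≠ 0 := by
          rw [sub_ne_zero]; exact_mod_cast Ne.symm hji
        positivity
      have hev : ‖(Lagrange.basisDivisor (t i : ℂ) (t j)).eval 0‖ = |t j| / |t i - t j| := by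
        rw [Lagrange.basisDivisor]
        simp only [Polynomial.eval_mul, Polynomial.eval_C, Polynomial.eval_sub, Polynomial.eval_X,
          zero_sub, norm_mul, norm_inv, norm_neg]
        rw [← Complex.ofReal_sub, Complex.norm_real, Complex.norm_real, Real.norm_eq_abs,
          Real.norm_eq_abs, div_eq_inv_mul]
      rw [hev]
      have htj : |t j| ≤ 1 := abs_le.2 ⟨by linarith [(h01 j hjN).1], (h01 j hjN).2⟩
      exact div_le_div₀ zero_le_one htj hpos hgap
    refine h1.trans (le_of_eq ?_)
    rw [Finset.prod_div_distrib, Finset.prod_const_one, Finset.prod_mul_distrib,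
      prod_range_erase_abs_sub N i hiN, Finset.prod_const, Finset.card_erase_of_mem hi,
      Finset.card_range, Nat.add_sub_cancel, Nat.cast_choose ℝ hiN]
    have := Nat.factorial_ne_zero N
    rw [div_pow, one_pow]
    field_simp
  refine (Finset.sum_le_sum key).trans (le_of_eq ?_)
  rw [← Finset.sum_mul, ← Nat.cast_sum, Nat.sum_range_choose]
  push_cast
  rw [div_pow, div_pow]
  ring

/-- A Remez-type sublevel set estimate on `[0,1]` at the endpoint `0`. -/
theorem volume_sublevel_polynomial_le {δ ε : ℝ} (hδ : 0 < δ) (N : ℕ) (P : Polynomial ℂ)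
    (hP : P.degree < (N + 1 : ℕ))
    (hε : ε * ((2 * (N + 1) / δ) ^ N / N.factorial) ≤ 1 / 2) :
    volume {s : ℝ | s ∈ Icc (0 : ℝ) 1 ∧ ‖P.eval (s : ℂ)‖ < ε * ‖P.eval 0‖} ≤ ENNReal.ofReal δ := by
  by_contra hcon
  rw [not_le] at hcon
  have hh : 0 < δ / (N + 1) := by positivity
  -- Gap δ/(N+1): `N` such gaps have total length below δ, so the sublevel set has room for N + 1
  -- nodes, enough to determine `P`.
  obtain ⟨t, ht1, ht2⟩ := exists_separated_points hh N _
    ⟨0, fun s hs => hs.1.1⟩ (lt_of_le_of_lt (ENNReal.ofReal_le_ofReal (by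
      rw [mul_div_assoc', div_le_iff₀ (by positivity)]; nlinarith)) hcon)
  have hinj : Set.InjOn (fun i => (t i : ℂ)) (Finset.range (N + 1) : Finset ℕ) := by
    intro i hi j hj hij
    have hi' : i ≤ N := by simpa [Nat.lt_succ_iff] using hi
    have hj' : j ≤ N := by simpa [Nat.lt_succ_iff] using hj
    have hij' : t i = t j := Complex.ofReal_injective hij
    by_contra hne
    rcases lt_or_gt_of_ne hne with h | h
    · have h3 := gap_mul_le_of_consecutive ht2 h.le hj'
      have : (1 : ℝ) ≤ ((j - i : ℕ) : ℝ) := by exact_mod_cast (by omega : 1 ≤ j - i)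
      nlinarith
    · have h3 := gap_mul_le_of_consecutive ht2 h.le hi'
      have : (1 : ℝ) ≤ ((i - j : ℕ) : ℝ) := by exact_mod_cast (by omega : 1 ≤ i - j)
      nlinarith
  have heq := Lagrange.eq_interpolate (s := Finset.range (N + 1)) (v := fun i => (t i : ℂ)) (f := P)
    hinj (by simpa using hP)
  have h0 : P.eval 0 = ∑ i ∈ Finset.range (N + 1), P.eval (t i : ℂ) *
      (Lagrange.basis (Finset.range (N + 1)) (fun i => (t i : ℂ)) i).eval 0 := by
    conv_lhs => rw [heq]
    rw [Lagrange.interpolate_apply, Polynomial.eval_finsetSum]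
    simp
  -- The strict inequality at a node forces P(0) ≠ 0, while interpolation from the nodes gives
  -- |P(0)| ≤ |P(0)| / 2.
  have hpos : 0 < ε * ‖P.eval 0‖ := (norm_nonneg _).trans_lt (ht1 0 (by omega)).2
  have hsum := sum_norm_lagrange_basis_eval_zero_le hh (fun i hi => (ht1 i hi).1) ht2
  have hP0 : ‖P.eval 0‖ ≤ ‖P.eval 0‖ / 2 := by
    calc ‖P.eval 0‖ ≤ ∑ i ∈ Finset.range (N + 1), (ε * ‖P.eval 0‖) *
          ‖(Lagrange.basis (Finset.range (N + 1)) (fun i => (t i : ℂ)) i).eval 0‖ := by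
          conv_lhs => rw [h0]
          refine norm_sum_le_of_le _ fun i hi => ?_
          rw [norm_mul]
          gcongr
          exact (ht1 i (by simpa [Nat.lt_succ_iff] using hi)).2.le
      _ ≤ (ε * ‖P.eval 0‖) * ((2 / (δ / (N + 1))) ^ N / N.factorial) := by
          rw [← Finset.mul_sum]; gcongr
      _ = (ε * ((2 * (N + 1) / δ) ^ N / N.factorial)) * ‖P.eval 0‖ := by
          rw [div_div_eq_mul_div]; ring
      _ ≤ 1 / 2 * ‖P.eval 0‖ := by gcongr
      _ = ‖P.eval 0‖ / 2 := by ring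
  have : ‖P.eval 0‖ = 0 := by linarith [norm_nonneg (P.eval 0)]
  rw [this, mul_zero] at hpos
  exact lt_irrefl _ hpos

end

/-! ### Plancherel for the Fourier integral on L¹ ∩ L². -/

section

/-- The complex Hilbert space `L²(ℝ^d; ℂ)`. -/
abbrev CL2 (d : ℕ) : Type := Lp ℂ 2 (volume : Measure (E d))

theorem eLpNorm_two_sq {α F : Type*} [MeasurableSpace α] [NormedAddCommGroup F] (μ : Measure α)
    (f : α → F) : eLpNorm f 2 μ ^ 2 = ∫⁻ x, ‖f x‖ₑ ^ 2 ∂μ := by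
  rw [eLpNorm_eq_lintegral_rpow_enorm_toReal (by norm_num) (by norm_num), ENNReal.toReal_ofNat,
    ← ENNReal.rpow_natCast, ← ENNReal.rpow_mul]
  norm_num

theorem enorm_Lp_two_sq {α F : Type*} [MeasurableSpace α] [NormedAddCommGroup F] {μ : Measure α}
    (f : Lp F 2 μ) : ‖f‖ₑ ^ 2 = ∫⁻ x, ‖f x‖ₑ ^ 2 ∂μ := by
  rw [Lp.enorm_def, eLpNorm_two_sq]

theorem memLp_two_of_lintegral_lt_top {α F : Type*} [MeasurableSpace α] [NormedAddCommGroup F]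
    {μ : Measure α} {f : α → F} (hf : AEStronglyMeasurable f μ)
    (h : ∫⁻ x, ‖f x‖ₑ ^ 2 ∂μ < ⊤) : MemLp f 2 μ := by
  refine ⟨hf, ?_⟩
  rw [← eLpNorm_two_sq] at h
  by_contra hcon
  rw [not_lt, top_le_iff] at hcon
  simp [hcon] at h

theorem MemLp.lintegral_enorm_sq_lt_top {α F : Type*} [MeasurableSpace α] [NormedAddCommGroup F]
    {μ : Measure α} {f : α → F} (hf : MemLp f 2 μ) : ∫⁻ x, ‖f x‖ₑ ^ 2 ∂μ < ⊤ := by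
  rw [← eLpNorm_two_sq]
  exact ENNReal.pow_lt_top hf.2

theorem continuous_fourierInv {d : ℕ} {f : E d → ℂ} (hf : Integrable f) : Continuous (𝓕⁻ f) :=
  VectorFourier.fourierIntegral_continuous (L := -innerₗ (E d)) Real.continuous_fourierChar
    (by simp only [LinearMap.neg_apply, innerₗ_apply_apply]; fun_prop) hf

/-- On `L¹ ∩ L²` the inverse Fourier transform on `L²` is given by the Fourier integral. -/
theorem coeFn_fourierInv_toLp {d : ℕ} {f : E d → ℂ} (hf1 : Integrable f) (hf2 : MemLp f 2 volume) :
    (𝓕⁻ (hf2.toLp f) : CL2 d) =ᵐ[volume] 𝓕⁻ f := by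
  -- Both functions are compared through their integrals against test functions: the distributional
  -- definition on one side and Fubini on the other move the inverse transform onto the test
  -- function.
  refine ae_eq_of_integral_contDiff_smul_eq ?_ (continuous_fourierInv hf1).locallyIntegrable fun g hg hgc => ?_
  · exact (Lp.memLp (𝓕⁻ (hf2.toLp f) : CL2 d)).locallyIntegrable (by norm_num)
  · have hgC : ContDiff ℝ ∞ (fun x => (g x : ℂ)) := Complex.ofRealCLM.contDiff.comp hg
    have hgcC : HasCompactSupport (fun x => (g x : ℂ)) := hgc.comp_left (g := Complex.ofReal) rfl
    set G : SchwartzMap (E d) ℂ := hgcC.toSchwartzMap hgC with hG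
    have h1 := congrArg (fun u => u G) (Lp.fourierInv_toTemperedDistribution_eq (hf2.toLp f))
    simp only [TemperedDistribution.fourierInv_apply, Lp.toTemperedDistribution_apply] at h1
    have h2 : ∫ x, (𝓕⁻ G : SchwartzMap (E d) ℂ) x • (hf2.toLp f : E d → ℂ) x
        = ∫ x, (𝓕⁻ G : SchwartzMap (E d) ℂ) x • f x := by
      refine integral_congr_ae ?_
      filter_upwards [hf2.coeFn_toLp] with x hx
      rw [hx]
    rw [h2] at h1
    have h3 : ∫ x, (𝓕⁻ G : SchwartzMap (E d) ℂ) x • f x = ∫ x, G x • 𝓕⁻ f x := by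
      rw [SchwartzMap.fourierInv_coe]
      have := VectorFourier.integral_fourierIntegral_smul_eq_flip (L := -innerₗ (E d))
        (μ := (volume : Measure (E d))) (ν := volume) (e := Real.fourierChar)
        Real.continuous_fourierChar (by
          simp only [LinearMap.neg_apply, innerₗ_apply_apply]; fun_prop) G.integrable hf1
      have hflip : (-innerₗ (E d)).flip = -innerₗ (E d) := by
        ext x y; simp [real_inner_comm]
      rw [hflip] at this
      exact this
    rw [h3] at h1
    have h4 : ∀ (u : E d → ℂ), ∫ x, g x • u x = ∫ x, G x • u x := fun u => by
      refine integral_congr_ae (Filter.Eventually.of_forall fun x => ?_)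
      simp [hG]
    rw [h4, h4]
    exact h1.symm

/-- Plancherel's theorem for the inverse Fourier integral on `L¹ ∩ L²`. -/
theorem lintegral_enorm_fourierInv_sq {d : ℕ} {f : E d → ℂ} (hf1 : Integrable f)
    (hf2 : MemLp f 2 volume) : ∫⁻ x, ‖𝓕⁻ f x‖ₑ ^ 2 = ∫⁻ ξ, ‖f ξ‖ₑ ^ 2 := by
  have h1 : ‖(𝓕⁻ (hf2.toLp f) : CL2 d)‖ₑ ^ 2 = ‖hf2.toLp f‖ₑ ^ 2 := by
    have : ‖(𝓕⁻ (hf2.toLp f) : CL2 d)‖ = ‖hf2.toLp f‖ :=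
      (Lp.fourierTransformₗᵢ (E d) ℂ).symm.norm_map _
    rw [← ofReal_norm, this, ofReal_norm]
  rw [enorm_Lp_two_sq, enorm_Lp_two_sq] at h1
  calc _ = _ := lintegral_congr_ae ((coeFn_fourierInv_toLp hf1 hf2).mono fun x hx => by
          simp only [hx])
    _ = _ := h1
    _ = _ := lintegral_congr_ae (hf2.coeFn_toLp.mono fun x hx => by simp only [hx])

end

/-! ### Geometry of boxes and thick sets. -/

section

theorem volume_box {d : ℕ} {a : Fin d → ℝ} (ha : ∀ j, 0 < a j) :
    volume (box a) = ENNReal.ofReal (∏ j, a j) := by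
  have h : box a = (WithLp.ofLp : E d → Fin d → ℝ) ⁻¹' (Icc 0 a) := by
    ext y
    simp only [box, mem_ofPred_eq, mem_preimage, mem_Icc, Pi.le_def, ← forall_and]
    rfl
  rw [h, (PiLp.volume_preserving_ofLp (Fin d)).measure_preimage
    measurableSet_Icc.nullMeasurableSet, Real.volume_Icc_pi, ENNReal.ofReal_prod_of_nonneg]
  · simp
  · exact fun j _ => (ha j).le

theorem measurableSet_box {d : ℕ} (a : Fin d → ℝ) : MeasurableSet (box a) := by
  have : box a = ⋂ j, {y : E d | 0 ≤ y j ∧ y j ≤ a j} := by ext; simp [box]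
  rw [this]
  refine MeasurableSet.iInter fun j => ?_
  have hj : Measurable fun y : E d => y j := by fun_prop
  exact (measurableSet_le measurable_const hj).inter (measurableSet_le hj measurable_const)

theorem smul_mem_box {d : ℕ} {a : Fin d → ℝ} {t : ℝ} (h0 : 0 ≤ t) (h1 : t ≤ 1) {w : E d}
    (hw : w ∈ box a) : t • w ∈ box a := fun j => by
  have := hw j
  simp only [PiLp.smul_apply, smul_eq_mul]
  exact ⟨mul_nonneg h0 this.1, (mul_le_of_le_one_left this.1 h1).trans this.2⟩

/-- The source of ‖a‖₁ in the final constant: it controls the phase, hence the Taylor degree needed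
on one box. -/
theorem abs_inner_le_of_mem_box {d : ℕ} {a : Fin d → ℝ} {w : E d} (hw : w ∈ box a) (ξ : E d) :
    |inner ℝ ξ w| ≤ ‖ξ‖ * ∑ j, a j := by
  rw [PiLp.inner_apply, Finset.mul_sum]
  refine (Finset.abs_sum_le_sum_abs _ _).trans (Finset.sum_le_sum fun j _ => ?_)
  have hj := PiLp.norm_apply_le (p := 2) ξ j
  rw [RCLike.inner_apply, conj_trivial, abs_mul, mul_comm, abs_of_nonneg (hw j).1]
  exact mul_le_mul hj (hw j).2 (hw j).1 (norm_nonneg _)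

open scoped Pointwise in
/-- A `(γ, a)`-thick set seen from the corner `x` through the slightly shrunk box `x + t A`. -/
theorem IsThickWith.le_volume_shrunk {d : ℕ} {S : Set (E d)} {γ : ℝ} {a : Fin d → ℝ}
    (h : IsThickWith S γ a) (hd : 1 ≤ d) {t : ℝ} (ht : 1 - γ / (2 * d) ≤ t)
    (ht1 : t ≤ 1) (x : E d) :
    ENNReal.ofReal (γ / 2 * ∏ j, a j) ≤ volume {w | w ∈ box a ∧ x + t • w ∈ S} := by
  have hγ := h.gamma_pos
  have hγ1 := h.gamma_le_one
  have hd' : (1 : ℝ) ≤ d := by exact_mod_cast hd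
  have hA : 0 < ∏ j, a j := Finset.prod_pos fun j _ => h.a_pos j
  have ht0 : 0 < t := by
    have : γ / (2 * d) ≤ 1 / 2 := by
      rw [div_le_div_iff₀ (by positivity) (by norm_num)]; nlinarith
    linarith
  -- Bernoulli's inequality: this is why `t` is kept within γ/(2d) of 1. Shrinking the box then
  -- loses at most half of the guaranteed mass of `S`.
  have hpow : 1 - γ / 2 ≤ t ^ d := by
    have hb := one_add_mul_le_pow (a := t - 1) (by linarith) d
    rw [add_sub_cancel] at hb
    have : d * (1 - t) ≤ γ / 2 := by
      have : d * (1 - t) ≤ d * (γ / (2 * d)) := by gcongr; linarith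
      refine this.trans (le_of_eq ?_)
      field_simp
    linarith
  set φ : E d → E d := fun w => x + t • w with hφ
  have hvol : ∀ s : Set (E d), volume (φ '' s) = ENNReal.ofReal (t ^ d) * volume s := by
    intro s
    have : φ '' s = (fun y => x + y) '' (t • s) := by
      rw [← image_smul, image_image]
    rw [this, image_add_left, measure_preimage_add, Measure.addHaar_smul,
      finrank_euclideanSpace_fin, abs_of_nonneg (by positivity)]
  have hsub : S ∩ (fun y => x + y) '' box a ⊆
      φ '' {w | w ∈ box a ∧ x + t • w ∈ S} ∪ (((fun y => x + y) '' box a) \ φ '' box a) := by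
    rintro y ⟨hyS, hy⟩
    by_cases hyt : y ∈ φ '' box a
    · obtain ⟨w, hw, rfl⟩ := hyt
      exact Or.inl ⟨w, ⟨hw, hyS⟩, rfl⟩
    · exact Or.inr ⟨hy, hyt⟩
  have hsub2 : φ '' box a ⊆ (fun y => x + y) '' box a := by
    rintro _ ⟨w, hw, rfl⟩
    exact ⟨t • w, smul_mem_box ht0.le ht1 hw, rfl⟩
  have hmeas : MeasurableSet (φ '' box a) := by
    exact ((Homeomorph.smulOfNeZero t ht0.ne').trans
      (Homeomorph.addLeft x)).toMeasurableEquiv.measurableSet_image.2 (measurableSet_box a)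
  have hbox : volume ((fun y => x + y) '' box a) = ENNReal.ofReal (∏ j, a j) := by
    rw [image_add_left, measure_preimage_add, volume_box h.a_pos]
  have hdiff : volume (((fun y => x + y) '' box a) \ φ '' box a)
      ≤ ENNReal.ofReal (γ / 2 * ∏ j, a j) := by
    rw [measure_sdiff hsub2 hmeas.nullMeasurableSet, hbox, hvol, volume_box h.a_pos,
      ← ENNReal.ofReal_mul (by positivity), ← ENNReal.ofReal_sub _ (by positivity)]
    · apply ENNReal.ofReal_le_ofReal; nlinarith
    · rw [hvol, volume_box h.a_pos]; finiteness
  have h1 := (h.measure_ge x).trans ((measure_mono hsub).trans (measure_union_le _ _))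
  have h2 : ENNReal.ofReal (γ * ∏ j, a j)
      = ENNReal.ofReal (γ / 2 * ∏ j, a j) + ENNReal.ofReal (γ / 2 * ∏ j, a j) := by
    rw [← ENNReal.ofReal_add (by positivity) (by positivity)]; congr 1; ring
  rw [h2] at h1
  have h3 := ENNReal.le_of_add_le_add_right (by finiteness) (h1.trans (add_le_add_right hdiff _))
  refine h3.trans ?_
  rw [hvol]
  exact mul_le_of_le_one_left zero_le (by
    rw [ENNReal.ofReal_le_one]; exact pow_le_one₀ ht0.le ht1)

end

/-! ### Taylor expansion of band-limited functions along segments. -/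

section

/-- The Taylor remainder of order `n` of the exponential function. -/
def expRemainder (n : ℕ) (z : ℂ) : ℂ := Complex.exp z - ∑ k ∈ Finset.range n, z ^ k / k.factorial

theorem continuous_expRemainder (n : ℕ) : Continuous (expRemainder n) := by
  unfold expRemainder; fun_prop

/-- The phase `2πi ⟨ξ, w⟩`. -/
def phase {d : ℕ} (w ξ : E d) : ℂ := ((2 * Real.pi * inner ℝ ξ w : ℝ) : ℂ) * Complex.I

theorem continuous_phase {d : ℕ} : Continuous fun p : E d × E d => phase p.1 p.2 := by
  unfold phase; fun_prop

theorem norm_phase {d : ℕ} (w ξ : E d) : ‖phase w ξ‖ = 2 * Real.pi * |inner ℝ ξ w| := by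
  rw [phase, norm_mul, Complex.norm_I, mul_one, Complex.norm_real, Real.norm_eq_abs, abs_mul,
    abs_of_pos (by positivity)]

theorem fourierInv_eq_exp_phase {d : ℕ} (f : E d → ℂ) (x : E d) :
    𝓕⁻ f x = ∫ ξ, Complex.exp (phase x ξ) * f ξ := by
  rw [Real.fourierInv_eq']; rfl

theorem phase_add_smul {d : ℕ} (x w ξ : E d) (t : ℝ) :
    phase (x + t • w) ξ = phase x ξ + t * phase w ξ := by
  simp only [phase, inner_add_right, real_inner_smul_right]
  push_cast; ring

theorem norm_exp_phase {d : ℕ} (x ξ : E d) : ‖Complex.exp (phase x ξ)‖ = 1 := by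
  rw [phase, Complex.norm_exp_ofReal_mul_I]

theorem integrable_exp_phase_mul {d : ℕ} {f : E d → ℂ} (hf : Integrable f) (x : E d) :
    Integrable fun ξ => Complex.exp (phase x ξ) * f ξ := by
  refine hf.bdd_mul (c := 1) ?_ (Filter.Eventually.of_forall fun ξ => (norm_exp_phase x ξ).le)
  exact (Complex.continuous_exp.comp
    (continuous_phase.comp (Continuous.prodMk_right x))).aestronglyMeasurable

theorem memLp_integrable_of_bandlimited {d : ℕ} {F : E d → ℂ} (hF : MemLp F 2 volume) {lam : ℝ}
    (hsupp : ∀ ξ, lam < ‖ξ‖ → F ξ = 0) : Integrable F := by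
  have h1 : IntegrableOn F (Metric.closedBall 0 lam) :=
    have : IsFiniteMeasure (volume.restrict (Metric.closedBall (0 : E d) lam)) :=
      ⟨by rw [Measure.restrict_apply_univ]; exact measure_closedBall_lt_top⟩
    (hF.restrict _).integrable one_le_two
  refine (integrableOn_iff_integrable_of_support_subset fun ξ hξ => ?_).1 h1
  by_contra hcon
  rw [Metric.mem_closedBall, dist_zero_right, not_le] at hcon
  exact hξ (hsupp ξ hcon)

variable {d : ℕ}

/-- The error of Taylor expansion along a segment in direction `w`. -/
def taylorError (F : E d → ℂ) (n : ℕ) (x w : E d) (t : ℝ) : ℂ :=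
  𝓕⁻ (fun ξ => expRemainder n (t * phase w ξ) * F ξ) x

theorem stronglyMeasurable_taylorError {F : E d → ℂ} (hF : StronglyMeasurable F) (n : ℕ) :
    StronglyMeasurable fun p : E d × E d × ℝ => taylorError F n p.1 p.2.1 p.2.2 := by
  simp only [taylorError, fourierInv_eq_exp_phase]
  refine StronglyMeasurable.integral_prod_right' (f := fun q : (E d × E d × ℝ) × E d =>
    Complex.exp (phase q.1.1 q.2) * (expRemainder n (q.1.2.2 * phase q.1.2.1 q.2) * F q.2)) ?_
  have c1 : Continuous fun q : (E d × E d × ℝ) × E d => Complex.exp (phase q.1.1 q.2) := by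
    unfold phase; fun_prop
  have c2 : Continuous fun q : (E d × E d × ℝ) × E d => (q.1.2.2 : ℂ) * phase q.1.2.1 q.2 := by
    unfold phase; fun_prop
  exact c1.stronglyMeasurable.mul
    (((continuous_expRemainder n).comp c2).stronglyMeasurable.mul
      (hF.comp_measurable measurable_snd))

/-- The Taylor polynomial of order `n` along the segment `t ↦ x + t w`. -/
def taylorPoly (F : E d → ℂ) (n : ℕ) (x w : E d) : Polynomial ℂ :=
  ∑ k ∈ Finset.range n, Polynomial.C ((∫ ξ, Complex.exp (phase x ξ) * (phase w ξ ^ k * F ξ)) /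
    k.factorial) * Polynomial.X ^ k

theorem degree_taylorPoly_lt (F : E d → ℂ) (n : ℕ) (x w : E d) :
    (taylorPoly F n x w).degree < n := by
  refine (Polynomial.degree_sum_le _ _).trans_lt ((Finset.sup_lt_iff (WithBot.bot_lt_coe n)).2
    fun k hk => (Polynomial.degree_C_mul_X_pow_le k _).trans_lt ?_)
  exact Nat.cast_lt.2 (Finset.mem_range.1 hk)

variable {F : E d → ℂ} {lam : ℝ} {a : Fin d → ℝ}

theorem norm_phase_mul_le (ha : ∀ j, 0 < a j) (hsupp : ∀ ξ, lam < ‖ξ‖ → F ξ = 0)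
    {w : E d} (hw : w ∈ box a) {ξ : E d} (hξ : F ξ ≠ 0) :
    ‖phase w ξ‖ ≤ 2 * Real.pi * (lam * ∑ j, a j) := by
  have hξ' : ‖ξ‖ ≤ lam := by
    by_contra hcon; exact hξ (hsupp ξ (not_le.1 hcon))
  rw [norm_phase]
  have := abs_inner_le_of_mem_box hw ξ
  have hA : 0 ≤ ∑ j, a j := Finset.sum_nonneg fun j _ => (ha j).le
  gcongr
  exact this.trans (by gcongr)

theorem integrable_phase_pow_mul (hF : Integrable F) (ha : ∀ j, 0 < a j)
    (hsupp : ∀ ξ, lam < ‖ξ‖ → F ξ = 0) {w : E d} (hw : w ∈ box a) (k : ℕ) :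
    Integrable fun ξ => phase w ξ ^ k * F ξ := by
  refine (hF.norm.const_mul ((2 * Real.pi * (lam * ∑ j, a j)) ^ k)).mono' ?_ ?_
  · exact (((continuous_phase.comp (Continuous.prodMk_right w)).pow k).aestronglyMeasurable).mul
      hF.aestronglyMeasurable
  · refine Filter.Eventually.of_forall fun ξ => ?_
    by_cases hξ : F ξ = 0
    · simp [hξ]
    · rw [norm_mul, norm_pow]
      gcongr
      exact norm_phase_mul_le ha hsupp hw hξ

theorem eval_zero_taylorPoly (n : ℕ) (x w : E d) :
    (taylorPoly F (n + 1) x w).eval 0 = 𝓕⁻ F x := by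
  rw [taylorPoly, Polynomial.eval_finsetSum, Finset.sum_range_succ', fourierInv_eq_exp_phase]
  simp

/-- Under the Fourier integral exp(phase) factors as exp(phase x) · exp(t · phase w), and the second
factor is replaced by its Taylor sum in `t`; bounded frequencies make every moment converge. -/
theorem fourierInv_add_smul (hF : Integrable F) (ha : ∀ j, 0 < a j)
    (hsupp : ∀ ξ, lam < ‖ξ‖ → F ξ = 0) {w : E d} (hw : w ∈ box a) (n : ℕ) (x : E d) (t : ℝ) :
    𝓕⁻ F (x + t • w) = (taylorPoly F n x w).eval (t : ℂ) + taylorError F n x w t := by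
  have hk : ∀ k, Integrable fun ξ =>
      Complex.exp (phase x ξ) * (phase w ξ ^ k * F ξ) * ((t : ℂ) ^ k / k.factorial) := fun k =>
    (integrable_exp_phase_mul (integrable_phase_pow_mul hF ha hsupp hw k) x).mul_const _
  have hP : (taylorPoly F n x w).eval (t : ℂ) = ∫ ξ, ∑ k ∈ Finset.range n,
      Complex.exp (phase x ξ) * (phase w ξ ^ k * F ξ) * ((t : ℂ) ^ k / k.factorial) := by
    rw [integral_finsetSum _ fun k _ => hk k, taylorPoly, Polynomial.eval_finsetSum]
    refine Finset.sum_congr rfl fun k _ => ?_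
    rw [integral_mul_const]
    simp only [Polynomial.eval_mul, Polynomial.eval_C, Polynomial.eval_pow, Polynomial.eval_X]
    ring
  have hsum : Integrable fun ξ => ∑ k ∈ Finset.range n,
      Complex.exp (phase x ξ) * (phase w ξ ^ k * F ξ) * ((t : ℂ) ^ k / k.factorial) :=
    integrable_finsetSum _ fun k _ => hk k
  have hE : taylorError F n x w t = ∫ ξ, (Complex.exp (phase (x + t • w) ξ) * F ξ -
      ∑ k ∈ Finset.range n,
        Complex.exp (phase x ξ) * (phase w ξ ^ k * F ξ) * ((t : ℂ) ^ k / k.factorial)) := by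
    rw [taylorError, fourierInv_eq_exp_phase]
    congr 1
    ext ξ
    rw [phase_add_smul, Complex.exp_add, expRemainder, sub_mul, mul_sub, Finset.sum_mul,
      Finset.mul_sum]
    congr 1
    · ring
    · refine Finset.sum_congr rfl fun k _ => ?_
      rw [mul_pow]; ring
  rw [hE, integral_sub (integrable_exp_phase_mul hF _) hsum, hP, fourierInv_eq_exp_phase]
  ring

/-- For fixed `w` and `t` the error is a Fourier multiplier applied to `F`, so Plancherel turns the
scalar bound on the exponential remainder, on the support of `F`, into an L² bound in `x`. No
selection of cubes with good derivative bounds is needed. -/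
theorem lintegral_taylorError_le (hF1 : Integrable F) (hF2 : MemLp F 2 volume) (ha : ∀ j, 0 < a j)
    (hlam : 0 ≤ lam) (hsupp : ∀ ξ, lam < ‖ξ‖ → F ξ = 0) {w : E d} (hw : w ∈ box a) {n : ℕ} {t : ℝ}
    (ht : t ∈ Icc (0 : ℝ) 1) (hn : 2 * Real.pi * (lam * ∑ j, a j) / (n + 1) ≤ 1 / 2) :
    ∫⁻ x, ‖taylorError F n x w t‖ₑ ^ 2 ≤
      ENNReal.ofReal (((2 * Real.pi * (lam * ∑ j, a j)) ^ n / n.factorial * 2) ^ 2)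
        * ∫⁻ ξ, ‖F ξ‖ₑ ^ 2 := by
  set b := 2 * Real.pi * (lam * ∑ j, a j) with hb
  have hA : 0 ≤ ∑ j, a j := Finset.sum_nonneg fun j _ => (ha j).le
  have hb0 : 0 ≤ b := by positivity
  set r := b ^ n / n.factorial * 2 with hr
  have hbound : ∀ ξ, ‖expRemainder n (t * phase w ξ) * F ξ‖ ≤ r * ‖F ξ‖ := by
    intro ξ
    by_cases hξ : F ξ = 0
    · simp [hξ]
    · have h1 : ‖(t : ℂ) * phase w ξ‖ ≤ b := by
        rw [norm_mul, Complex.norm_real, Real.norm_eq_abs, abs_of_nonneg ht.1]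
        exact (mul_le_of_le_one_left (norm_nonneg _) ht.2).trans (norm_phase_mul_le ha hsupp hw hξ)
      rw [norm_mul]
      gcongr
      refine (Complex.exp_bound' (le_trans ?_ hn)).trans ?_
      · push_cast; gcongr
      · rw [hr]; gcongr
  have hmeas : AEStronglyMeasurable (fun ξ => expRemainder n (t * phase w ξ) * F ξ) volume :=
    ((continuous_expRemainder n).comp (continuous_const.mul
      (continuous_phase.comp (Continuous.prodMk_right w)))).aestronglyMeasurable.mul
      hF1.aestronglyMeasurable
  have h1 : Integrable fun ξ => expRemainder n (t * phase w ξ) * F ξ :=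
    (hF1.norm.const_mul r).mono' hmeas (Filter.Eventually.of_forall hbound)
  have h2 : MemLp (fun ξ => expRemainder n (t * phase w ξ) * F ξ) 2 volume :=
    (hF2.norm.const_mul r).of_le hmeas (Filter.Eventually.of_forall fun ξ =>
      (hbound ξ).trans (le_abs_self _))
  unfold taylorError
  rw [lintegral_enorm_fourierInv_sq h1 h2, ← lintegral_const_mul' _ _ (by finiteness)]
  refine lintegral_mono fun ξ => ?_
  rw [← ofReal_norm, ← ofReal_norm, ← ENNReal.ofReal_pow (norm_nonneg _),
    ← ENNReal.ofReal_pow (norm_nonneg _), ← ENNReal.ofReal_mul (by positivity), ← mul_pow]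
  gcongr
  exact hbound ξ

end

/-! ### Averaging over segments: Logvinenko–Sereda with free parameters. -/

section

theorem enorm_sq_le_of_le_add {u p e : ℂ} {ε c : ℝ} (h : p = u - e) (hε : 0 ≤ ε) (hc : 0 ≤ c)
    (hp : ε * c ≤ ‖p‖) :
    ENNReal.ofReal (ε ^ 2) * ENNReal.ofReal c ^ 2 ≤ 2 * ‖u‖ₑ ^ 2 + 2 * ‖e‖ₑ ^ 2 := by
  rw [← ofReal_norm, ← ofReal_norm, ← ENNReal.ofReal_pow hc, ← ENNReal.ofReal_mul (by positivity),
    ← ENNReal.ofReal_pow (norm_nonneg _), ← ENNReal.ofReal_pow (norm_nonneg _),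
    ← ENNReal.ofReal_ofNat 2, ← ENNReal.ofReal_mul (by norm_num),
    ← ENNReal.ofReal_mul (by norm_num), ← ENNReal.ofReal_add (by positivity) (by positivity)]
  apply ENNReal.ofReal_le_ofReal
  have h1 : ‖p‖ ≤ ‖u‖ + ‖e‖ := h ▸ norm_sub_le u e
  have h2 : ε * c ≤ ‖u‖ + ‖e‖ := hp.trans h1
  have h3 : (ε * c) ^ 2 ≤ (‖u‖ + ‖e‖) ^ 2 := by gcongr
  nlinarith [sq_nonneg (‖u‖ - ‖e‖)]

variable {d : ℕ} {F : E d → ℂ} {lam : ℝ} {a : Fin d → ℝ} {S : Set (E d)} {γ : ℝ}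

/-- The integrand averaged over segments: the observed density at `x + t w` and the Taylor error. -/
def segmentDensity (S : Set (E d)) (F : E d → ℂ) (n : ℕ) (x w : E d) (t : ℝ) : ℝ≥0∞ :=
  2 * S.indicator (fun y => ‖𝓕⁻ F y‖ₑ ^ 2) (x + t • w) + 2 * ‖taylorError F n x w t‖ₑ ^ 2

theorem measurable_segmentDensity (hS : MeasurableSet S) (hFm : StronglyMeasurable F)
    (hF1 : Integrable F) (n : ℕ) :
    Measurable fun p : E d × E d × ℝ => segmentDensity S F n p.1 p.2.1 p.2.2 := by
  have m1 : Measurable fun p : E d × E d × ℝ => p.1 + p.2.2 • p.2.1 := by fun_prop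
  have m2 : Measurable (S.indicator fun y => ‖𝓕⁻ F y‖ₑ ^ 2) :=
    ((continuous_fourierInv hF1).measurable.enorm.pow_const 2).indicator hS
  have m3 := (stronglyMeasurable_taylorError hFm n).measurable
  exact ((m2.comp m1).const_mul 2).add ((m3.enorm.pow_const 2).const_mul 2)

/-- The pointwise inequality behind the Logvinenko–Sereda theorem. -/
theorem pointwise_le_average (hd : 1 ≤ d) (hS : MeasurableSet S) (h : IsThickWith S γ a)
    (hFm : StronglyMeasurable F) (hF1 : Integrable F)
    (hsupp : ∀ ξ, lam < ‖ξ‖ → F ξ = 0) {N : ℕ} {ε : ℝ} (hε : 0 ≤ ε)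
    (hεN : ε * ((2 * (N + 1) / (γ ^ 2 / (8 * d))) ^ N / N.factorial) ≤ 1 / 2) (x : E d) :
    ENNReal.ofReal (ε ^ 2) * ‖𝓕⁻ F x‖ₑ ^ 2 *
        (ENNReal.ofReal (γ / 2 * ∏ j, a j) * ENNReal.ofReal (γ / (2 * d))) ≤
      (∫⁻ w in box a, ∫⁻ t in Icc (1 - γ / (2 * d)) 1,
        segmentDensity S F (N + 1) x w t) +
      ENNReal.ofReal (ε ^ 2) * ‖𝓕⁻ F x‖ₑ ^ 2 *
        (ENNReal.ofReal (γ ^ 2 / (8 * d)) * ENNReal.ofReal (∏ j, a j)) := by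
  have hγ := h.gamma_pos
  have hd' : (1 : ℝ) ≤ d := by exact_mod_cast hd
  set c := ENNReal.ofReal (ε ^ 2) * ‖𝓕⁻ F x‖ₑ ^ 2 with hc
  set I := Icc (1 - γ / (2 * d)) 1 with hI
  set D : E d → Set ℝ := fun w => {s : ℝ | s ∈ Icc (0 : ℝ) 1 ∧
    ‖(taylorPoly F (N + 1) x w).eval (s : ℂ)‖ < ε * ‖(taylorPoly F (N + 1) x w).eval 0‖} with hD
  have hI0 : ∀ t ∈ I, t ∈ Icc (0 : ℝ) 1 := fun t ht => by
    refine ⟨?_, ht.2⟩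
    have : γ / (2 * d) ≤ 1 := by
      rw [div_le_one (by positivity)]; linarith [h.gamma_le_one]
    linarith [ht.1]
  obtain ⟨Φ, hΦ⟩ : ∃ Φ : E d → ℝ → ℝ≥0∞, Φ = segmentDensity S F (N + 1) x := ⟨_, rfl⟩
  rw [← hΦ]
  -- When x + t w lies in `S`, either `t` is one of the few times at which the Taylor polynomial is
  -- small, or |f(x)| is controlled by f(x + t w) and the Taylor error. The exceptional mass stays
  -- on the right as an extra term, since subtraction is unsafe in `ℝ≥0∞`.
  have hpt : ∀ w ∈ box a, ∀ t ∈ I,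
      {p : E d × ℝ | x + p.2 • p.1 ∈ S}.indicator (fun _ => c) (w, t)
        ≤ Φ w t + (D w).indicator (fun _ => c) t := by
    intro w hw t ht
    by_cases hS' : x + t • w ∈ S
    · rw [indicator_of_mem (by exact hS')]
      by_cases ht' : t ∈ D w
      · rw [indicator_of_mem ht']; exact le_add_self
      · refine le_trans ?_ le_self_add
        have hp : ε * ‖(taylorPoly F (N + 1) x w).eval 0‖ ≤
            ‖(taylorPoly F (N + 1) x w).eval (t : ℂ)‖ := by
          by_contra hcon
          exact ht' ⟨hI0 t ht, not_le.1 hcon⟩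
        rw [eval_zero_taylorPoly] at hp
        have := enorm_sq_le_of_le_add
          (eq_sub_of_add_eq (fourierInv_add_smul hF1 h.a_pos hsupp hw (N + 1) x t).symm) hε
          (norm_nonneg _) hp
        rw [ofReal_norm] at this
        rw [hΦ, segmentDensity, indicator_of_mem hS']
        exact this
    · rw [indicator_of_notMem (by exact hS')]; exact zero_le
  have hΦm : Measurable (Function.uncurry Φ) := by
    have := (measurable_segmentDensity hS hFm hF1 (N + 1)).comp
      (measurable_prodMk_left (x := x) (β := E d × ℝ))
    rw [hΦ]
    exact this
  have hSm : MeasurableSet {p : E d × ℝ | x + p.2 • p.1 ∈ S} :=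
    (by fun_prop : Measurable fun p : E d × ℝ => x + p.2 • p.1) hS
  have lower : c * (ENNReal.ofReal (γ / 2 * ∏ j, a j) * ENNReal.ofReal (γ / (2 * d))) ≤
      ∫⁻ w in box a, ∫⁻ t in I, {p : E d × ℝ | x + p.2 • p.1 ∈ S}.indicator (fun _ => c) (w, t) := by
    have hm : Measurable (Function.uncurry fun (w : E d) (t : ℝ) =>
        {p : E d × ℝ | x + p.2 • p.1 ∈ S}.indicator (fun _ => c) (w, t)) :=
      measurable_const.indicator hSm
    rw [lintegral_lintegral_swap hm.aemeasurable]
    calc c * (ENNReal.ofReal (γ / 2 * ∏ j, a j) * ENNReal.ofReal (γ / (2 * d)))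
        = ∫⁻ t in I, c * ENNReal.ofReal (γ / 2 * ∏ j, a j) := by
          -- The interval of times has length γ/(2d).
          rw [setLIntegral_const, hI, Real.volume_Icc]
          ring_nf
      _ ≤ _ := setLIntegral_mono' measurableSet_Icc fun t ht => by
          have h1 := h.le_volume_shrunk hd ht.1 ht.2 x
          have hm : MeasurableSet {w : E d | x + t • w ∈ S} :=
            (by fun_prop : Measurable fun w : E d => x + t • w) hS
          have h2 : ∀ w : E d, {p : E d × ℝ | x + p.2 • p.1 ∈ S}.indicator (fun _ => c) (w, t) =
              {w : E d | x + t • w ∈ S}.indicator (fun _ => c) w := fun w => rfl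
          simp_rw [h2]
          rw [lintegral_indicator_const hm, Measure.restrict_apply hm]
          gcongr
          refine h1.trans (measure_mono fun w hw => ⟨hw.2, hw.1⟩)
  refine lower.trans ?_
  calc _ ≤ ∫⁻ w in box a, ((∫⁻ t in I, Φ w t) + c * ENNReal.ofReal (γ ^ 2 / (8 * d))) := by
        refine setLIntegral_mono' (measurableSet_box a) fun w hw => ?_
        refine (setLIntegral_mono' measurableSet_Icc (hpt w hw)).trans ?_
        have hm : Measurable fun t => Φ w t := hΦm.comp measurable_prodMk_left
        rw [lintegral_add_left hm]
        gcongr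
        refine (lintegral_indicator_const_le _ _).trans ?_
        gcongr
        refine (Measure.restrict_apply_le _ _).trans ?_
        exact volume_sublevel_polynomial_le (by positivity) N _ (degree_taylorPoly_lt _ _ _ _) hεN
    _ = _ := by
        have hm : Measurable fun w => ∫⁻ t in I, Φ w t := hΦm.lintegral_prod_right'
        rw [lintegral_add_left hm, setLIntegral_const, volume_box h.a_pos,
          mul_assoc]

/-- Logvinenko–Sereda inequality with free parameters. -/
theorem logvinenko_sereda_aux (hd : 1 ≤ d) (hS : MeasurableSet S) (h : IsThickWith S γ a)
    (hFm : StronglyMeasurable F) (hF2 : MemLp F 2 volume) (hlam : 0 ≤ lam)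
    (hsupp : ∀ ξ, lam < ‖ξ‖ → F ξ = 0) {N : ℕ} {ε : ℝ} (hε : 0 < ε)
    (hεN : ε * ((2 * (N + 1) / (γ ^ 2 / (8 * d))) ^ N / N.factorial) ≤ 1 / 2)
    (hn : 2 * Real.pi * (lam * ∑ j, a j) / (N + 2) ≤ 1 / 2)
    (hr : ((2 * Real.pi * (lam * ∑ j, a j)) ^ (N + 1) / (N + 1).factorial * 2) ^ 2
      ≤ ε ^ 2 * γ / 16) :
    ∫⁻ ξ, ‖F ξ‖ₑ ^ 2 ≤ ENNReal.ofReal (16 / (ε ^ 2 * γ)) * ∫⁻ x in S, ‖𝓕⁻ F x‖ₑ ^ 2 := by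
  have hF1 := memLp_integrable_of_bandlimited hF2 hsupp
  have hγ := h.gamma_pos
  have hd' : (1 : ℝ) ≤ d := by exact_mod_cast hd
  have hA : 0 < ∏ j, a j := Finset.prod_pos fun j _ => h.a_pos j
  have hsq : 0 ≤ ((2 * Real.pi * (lam * ∑ j, a j)) ^ (N + 1) / (N + 1).factorial * 2) ^ 2 :=
    sq_nonneg _
  have hτ1 : γ / (2 * d) ≤ 1 := by
    rw [div_le_one (by positivity)]; linarith [h.gamma_le_one]
  set r2 := ((2 * Real.pi * (lam * ∑ j, a j)) ^ (N + 1) / (N + 1).factorial * 2) ^ 2 with hr2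
  set I := ∫⁻ ξ, ‖F ξ‖ₑ ^ 2 with hI
  set J := ∫⁻ x in S, ‖𝓕⁻ F x‖ₑ ^ 2 with hJ
  have hPl := lintegral_enorm_fourierInv_sq hF1 hF2
  have hIfin : I ≠ ⊤ := (MemLp.lintegral_enorm_sq_lt_top hF2).ne
  have hJI : J ≤ I := by rw [hI, ← hPl]; exact setLIntegral_le_lintegral _ _
  have hJfin : J ≠ ⊤ := ne_top_of_le_ne_top hIfin hJI
  obtain ⟨Φ, hΦ⟩ : ∃ Φ : E d → E d → ℝ → ℝ≥0∞, Φ = segmentDensity S F (N + 1) := ⟨_, rfl⟩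
  have hΦm : Measurable fun p : E d × E d × ℝ => Φ p.1 p.2.1 p.2.2 := by
    rw [hΦ]; exact measurable_segmentDensity hS hFm hF1 (N + 1)
  have hint : ∀ w ∈ box a, ∀ t ∈ Icc (1 - γ / (2 * d)) 1,
      ∫⁻ x, Φ x w t ≤ 2 * J + 2 * (ENNReal.ofReal r2 * I) := by
    intro w hw t ht
    have ht0 : t ∈ Icc (0 : ℝ) 1 := ⟨by linarith [ht.1], ht.2⟩
    have m1 : Measurable fun x : E d => x + t • w := by fun_prop
    have m2 : Measurable (S.indicator fun y => ‖𝓕⁻ F y‖ₑ ^ 2) :=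
      ((continuous_fourierInv hF1).measurable.enorm.pow_const 2).indicator hS
    have m4 : Measurable fun x => S.indicator (fun y => ‖𝓕⁻ F y‖ₑ ^ 2) (x + t • w) := m2.comp m1
    simp only [hΦ, segmentDensity]
    rw [lintegral_add_left (m4.const_mul 2), lintegral_const_mul _ m4,
      lintegral_const_mul' _ _ (by finiteness)]
    gcongr
    -- After integration in `x`, translation invariance removes all dependence on the shift `t • w`,
    -- leaving the observed mass `J`.
    · rw [lintegral_add_right_eq_self (μ := volume) (S.indicator fun y => ‖𝓕⁻ F y‖ₑ ^ 2) (t • w),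
        lintegral_indicator hS]
    · refine lintegral_taylorError_le hF1 hF2 h.a_pos hlam hsupp hw ht0 ?_
      push_cast
      rw [add_assoc]; norm_num; exact_mod_cast hn
  have hbig : ENNReal.ofReal (ε ^ 2) * I *
        (ENNReal.ofReal (γ / 2 * ∏ j, a j) * ENNReal.ofReal (γ / (2 * d))) ≤
      (2 * J + 2 * (ENNReal.ofReal r2 * I)) * ENNReal.ofReal (γ / (2 * d)) *
        ENNReal.ofReal (∏ j, a j) + ENNReal.ofReal (ε ^ 2) * I *
        (ENNReal.ofReal (γ ^ 2 / (8 * d)) * ENNReal.ofReal (∏ j, a j)) := by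
    have hmf : Measurable fun x => ‖𝓕⁻ F x‖ₑ ^ 2 :=
      (continuous_fourierInv hF1).measurable.enorm.pow_const 2
    have h1 := lintegral_mono (μ := (volume : Measure (E d)))
      fun x => pointwise_le_average hd hS h hFm hF1 hsupp hε.le hεN x
    rw [← hΦ] at h1
    rw [lintegral_mul_const _ (hmf.const_mul _), lintegral_const_mul _ hmf, hPl, ← hI,
      lintegral_add_right _ ((hmf.const_mul _).mul_const _), lintegral_mul_const _ (hmf.const_mul _),
      lintegral_const_mul _ hmf, hPl, ← hI] at h1
    refine h1.trans ?_
    gcongr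
    have hΦ1 : Measurable fun q : E d × E d => ∫⁻ t in Icc (1 - γ / (2 * d)) 1, Φ q.1 q.2 t :=
      Measurable.lintegral_prod_right' (f := fun p : (E d × E d) × ℝ => Φ p.1.1 p.1.2 p.2)
        (hΦm.comp (by fun_prop : Measurable fun p : (E d × E d) × ℝ => (p.1.1, p.1.2, p.2)))
    rw [lintegral_lintegral_swap hΦ1.aemeasurable]
    calc _ ≤ ∫⁻ w in box a, (2 * J + 2 * (ENNReal.ofReal r2 * I)) * ENNReal.ofReal (γ / (2 * d)) := by
          refine setLIntegral_mono' (measurableSet_box a) fun w hw => ?_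
          have hm : Measurable (Function.uncurry fun (x : E d) (t : ℝ) => Φ x w t) :=
            hΦm.comp (by fun_prop : Measurable fun p : E d × ℝ => (p.1, w, p.2))
          rw [lintegral_lintegral_swap hm.aemeasurable]
          refine (setLIntegral_mono' measurableSet_Icc (hint w hw)).trans ?_
          rw [setLIntegral_const, Real.volume_Icc, sub_sub_cancel]
      _ = _ := by rw [setLIntegral_const, volume_box h.a_pos]
  rw [← ENNReal.ofReal_toReal hIfin, ← ENNReal.ofReal_toReal hJfin] at hbig ⊢
  set i := I.toReal
  set j := J.toReal
  have hi : 0 ≤ i := ENNReal.toReal_nonneg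
  have hj : 0 ≤ j := ENNReal.toReal_nonneg
  rw [← ENNReal.ofReal_ofNat 2, ← ENNReal.ofReal_mul (by positivity),
    ← ENNReal.ofReal_mul (by positivity), ← ENNReal.ofReal_mul (by positivity),
    ← ENNReal.ofReal_mul (by positivity), ← ENNReal.ofReal_mul (by positivity),
    ← ENNReal.ofReal_mul (by positivity), ← ENNReal.ofReal_add (by positivity) (by positivity),
    ← ENNReal.ofReal_mul (by positivity), ← ENNReal.ofReal_mul (by positivity),
    ← ENNReal.ofReal_mul (by positivity), ← ENNReal.ofReal_mul (by positivity),
    ← ENNReal.ofReal_add (by positivity) (by positivity),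
    ENNReal.ofReal_le_ofReal_iff (by positivity)] at hbig
  rw [← ENNReal.ofReal_mul (by positivity)]
  apply ENNReal.ofReal_le_ofReal
  have hfac : 0 < (∏ j, a j) * (γ / (2 * d)) := by positivity
  -- The exceptional proportion γ²/(8d) is exactly half of the thick proportion (γ/2)(γ/(2d)), so
  -- moving it to the left leaves a factor γ/4.
  have h2 : ((∏ j, a j) * (γ / (2 * d))) * (ε ^ 2 * i * (γ / 4)) ≤
      ((∏ j, a j) * (γ / (2 * d))) * (2 * j + 2 * (r2 * i)) := by
    have e : γ ^ 2 / (8 * d) = γ / 4 * (γ / (2 * d)) := by field_simp; norm_num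
    rw [e] at hbig
    nlinarith [hbig]
  have h3 := le_of_mul_le_mul_left h2 hfac
  -- The Taylor error, counted twice, absorbs half of the remaining ε²γ/4, which leaves ε²γ/8
  -- against 2 J.
  have h4 : r2 * i ≤ ε ^ 2 * γ / 16 * i := by gcongr
  rw [div_mul_eq_mul_div, le_div_iff₀ (by positivity)]
  nlinarith

end

/-! ### Choice of parameters: the explicit spectral inequality. -/

section

theorem pow_self_div_factorial_le (n : ℕ) : (n : ℝ) ^ n / n.factorial ≤ 3 ^ n := by
  have h1 := Real.pow_div_factorial_le_exp (n : ℝ) (Nat.cast_nonneg n) n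
  refine h1.trans ?_
  rw [← Real.exp_one_pow]
  have := Real.exp_one_lt_three
  gcongr

/-- The base constant of the spectral inequality. -/
def lsBase (d : ℕ) (γ : ℝ) : ℝ := 48 * d / γ ^ 2

/-- The prefactor of the spectral inequality. -/
def lsFactor (d : ℕ) (γ : ℝ) : ℝ := 8 * lsBase d γ / γ

/-- The exponential rate of the spectral inequality. -/
def lsRate {d : ℕ} (γ : ℝ) (a : Fin d → ℝ) : ℝ := 400 * lsBase d γ ^ 2 * (∑ j, a j) / γ

variable {d : ℕ} {F : E d → ℂ} {lam : ℝ} {a : Fin d → ℝ} {S : Set (E d)} {γ : ℝ}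

theorem one_le_lsBase (hd : 1 ≤ d) (hγ : 0 < γ) (hγ1 : γ ≤ 1) : 1 ≤ lsBase d γ := by
  have hd' : (1 : ℝ) ≤ d := by exact_mod_cast hd
  rw [lsBase, one_le_div (by positivity)]
  have : γ ^ 2 ≤ 1 := pow_le_one₀ hγ.le hγ1
  linarith

/-- A Logvinenko–Sereda theorem for thick sets, for frequencies in a ball. -/
theorem logvinenko_sereda (hd : 1 ≤ d) (hS : MeasurableSet S) (h : IsThickWith S γ a)
    (hFm : StronglyMeasurable F) (hF2 : MemLp F 2 volume) (hlam : 0 ≤ lam)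
    (hsupp : ∀ ξ, lam < ‖ξ‖ → F ξ = 0) :
    ∫⁻ ξ, ‖F ξ‖ₑ ^ 2 ≤ ENNReal.ofReal ((lsFactor d γ * Real.exp (lsRate γ a * lam)) ^ 2) *
      ∫⁻ x in S, ‖𝓕⁻ F x‖ₑ ^ 2 := by
  have hγ := h.gamma_pos
  have hγ1 := h.gamma_le_one
  have hd' : (1 : ℝ) ≤ d := by exact_mod_cast hd
  have hA : 0 ≤ ∑ j, a j := Finset.sum_nonneg fun j _ => (h.a_pos j).le
  set q := lsBase d γ with hq
  have hq1 : 1 ≤ q := one_le_lsBase hd hγ hγ1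
  set b := 2 * Real.pi * (lam * ∑ j, a j) with hb
  have hb0 : 0 ≤ b := by positivity
  -- The degree is proportional to the phase bound `b`. The Remez loss is at most q^(N+1), so the
  -- Taylor remainder must beat q^(-(N+1)); 48 makes 3 q b / (N+1) ≤ γ/16, the 3 coming from n^n /
  -- n! ≤ 3^n.
  set N := ⌊48 * (q * b) / γ⌋₊ with hN
  have hN1 : 48 * (q * b) / γ ≤ N + 1 := (Nat.lt_floor_add_one _).le
  have hN2 : (N : ℝ) ≤ 48 * (q * b) / γ := Nat.floor_le (by positivity)
  have hε : 0 < 1 / (2 * q ^ (N + 1)) := by positivity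
  have hfac : ((N : ℝ) + 1) ^ (N + 1) / (N + 1).factorial ≤ 3 ^ (N + 1) := by
    exact_mod_cast pow_self_div_factorial_le (N + 1)
  have hΛ : (2 * (N + 1) / (γ ^ 2 / (8 * d))) ^ N / N.factorial ≤ q ^ (N + 1) := by
    have e1 : (2 * ((N : ℝ) + 1) / (γ ^ 2 / (8 * d))) = (q / 3) * (N + 1) := by
      rw [hq, lsBase]; field_simp; norm_num
    -- Multiplying numerator and denominator by N + 1 puts the quotient in the form n^n / n! with n
    -- = N + 1.
    have e2 : ((N : ℝ) + 1) ^ N / N.factorial = ((N : ℝ) + 1) ^ (N + 1) / (N + 1).factorial := by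
      rw [Nat.factorial_succ]; push_cast
      have : (N.factorial : ℝ) ≠ 0 := by positivity
      field_simp
      ring
    have hq3 : 1 ≤ q / 3 := by
      rw [hq, lsBase, le_div_iff₀ (by norm_num), le_div_iff₀ (by positivity)]
      have : γ ^ 2 ≤ 1 := pow_le_one₀ hγ.le hγ1
      linarith
    rw [e1, mul_pow, mul_div_assoc, e2]
    calc (q / 3) ^ N * (((N : ℝ) + 1) ^ (N + 1) / (N + 1).factorial)
        ≤ (q / 3) ^ (N + 1) * 3 ^ (N + 1) := by
          gcongr
          omega
      _ = q ^ (N + 1) := by rw [← mul_pow]; congr 1; ring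
  have hεN : 1 / (2 * q ^ (N + 1)) * ((2 * (N + 1) / (γ ^ 2 / (8 * d))) ^ N / N.factorial) ≤ 1 / 2 := by
    rw [div_mul_eq_mul_div, one_mul, div_le_div_iff₀ (by positivity) (by norm_num)]
    linarith
  have hbq : b ≤ q * b := le_mul_of_one_le_left hb0 hq1
  have hqb : 48 * (q * b) ≤ 48 * (q * b) / γ := by
    rw [le_div_iff₀ hγ]; exact mul_le_of_le_one_right (by positivity) hγ1
  have hn : b / (N + 2) ≤ 1 / 2 := by
    rw [div_le_div_iff₀ (by positivity) (by norm_num)]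
    linarith
  have hy : (q * b) ^ (N + 1) / (N + 1).factorial ≤ γ / 16 := by
    have e3 : 3 * (q * b) / (N + 1) ≤ γ / 16 := by
      rw [div_le_iff₀ hγ] at hN1
      rw [div_le_div_iff₀ (by positivity) (by norm_num)]
      linarith
    calc (q * b) ^ (N + 1) / (N + 1).factorial
        = (q * b) ^ (N + 1) / (N + 1) ^ (N + 1) *
          (((N : ℝ) + 1) ^ (N + 1) / (N + 1).factorial) := by
          have : (N : ℝ) + 1 ≠ 0 := by positivity
          field_simp
      _ ≤ (q * b) ^ (N + 1) / (N + 1) ^ (N + 1) * 3 ^ (N + 1) := by gcongr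
      _ = (3 * (q * b) / (N + 1)) ^ (N + 1) := by rw [div_pow, mul_pow 3]; ring
      _ ≤ (γ / 16) ^ (N + 1) := by gcongr
      _ ≤ γ / 16 := pow_le_of_le_one (by positivity) (by linarith) (by omega)
  have hr : (b ^ (N + 1) / (N + 1).factorial * 2) ^ 2
      ≤ (1 / (2 * q ^ (N + 1))) ^ 2 * γ / 16 := by
    have e4 : b ^ (N + 1) / (N + 1).factorial * 2 ≤ 1 / (2 * q ^ (N + 1)) * γ / 4 := by
      rw [mul_pow] at hy
      have e5 : b ^ (N + 1) / (N + 1).factorial * 2 * q ^ (N + 1) ≤ γ / 8 := by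
        calc _ = 2 * (q ^ (N + 1) * b ^ (N + 1) / (N + 1).factorial) := by ring
          _ ≤ _ := by linarith
      rw [← le_div_iff₀ (by positivity)] at e5
      refine e5.trans (le_of_eq ?_)
      field_simp; norm_num
    calc _ ≤ (1 / (2 * q ^ (N + 1)) * γ / 4) ^ 2 := by gcongr
      _ = (1 / (2 * q ^ (N + 1))) ^ 2 * (γ * γ) / 16 := by ring
      _ ≤ _ := by gcongr; exact mul_le_of_le_one_left hγ.le hγ1
  refine (logvinenko_sereda_aux hd hS h hFm hF2 hlam hsupp hε hεN hn hr).trans ?_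
  gcongr
  have hexp : q ^ (N + 1) ≤ q * Real.exp (lsRate γ a * lam) := by
    rw [pow_succ, mul_comm]
    gcongr
    rw [← Real.rpow_natCast, Real.rpow_def_of_pos (by linarith)]
    apply Real.exp_le_exp.2
    have hlog : Real.log q ≤ q := (Real.log_le_sub_one_of_pos (by linarith)).trans (by linarith)
    -- The crude bound log q ≤ q is what gives `lsRate` a second power of `lsBase`; 400 exceeds 96
    -- π.
    calc Real.log q * N ≤ q * (48 * (q * b) / γ) := by gcongr
      _ = 96 * Real.pi * (q ^ 2 * (∑ j, a j) / γ * lam) := by rw [hb]; ring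
      _ ≤ 400 * (q ^ 2 * (∑ j, a j) / γ * lam) := by
          gcongr
          linarith [Real.pi_lt_four]
      _ = lsRate γ a * lam := by rw [lsRate]; ring
  have hsqrt : 16 / ((1 / (2 * q ^ (N + 1))) ^ 2 * γ) ≤ (8 * q ^ (N + 1) / γ) ^ 2 := by
    have : 16 / ((1 / (2 * q ^ (N + 1))) ^ 2 * γ) = 64 * (q ^ (N + 1)) ^ 2 / γ := by
      field_simp; norm_num
    rw [this, div_pow, mul_pow, div_le_div_iff₀ hγ (by positivity)]
    have : γ ^ 2 ≤ γ := by nlinarith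
    have h64 : 0 ≤ 64 * (q ^ (N + 1)) ^ 2 := by positivity
    nlinarith
  refine hsqrt.trans ?_
  have hf : 8 * q ^ (N + 1) / γ ≤ lsFactor d γ * Real.exp (lsRate γ a * lam) := by
    rw [lsFactor, ← hq, div_mul_eq_mul_div, mul_assoc]
    gcongr
  gcongr

end

/-! ### The heat semigroup on the Fourier side and pointwise in space. -/

section

variable {d : ℕ}

theorem memLp_ofReal_mul {g : E d → ℝ} (hg : Measurable g) (hb : ∀ ξ, |g ξ| ≤ 1) {z : E d → ℂ}
    (hz : MemLp z 2 volume) : MemLp (fun ξ => (g ξ : ℂ) * z ξ) 2 volume :=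
  hz.of_le ((Complex.measurable_ofReal.comp hg).aestronglyMeasurable.mul hz.1)
    (Filter.Eventually.of_forall fun ξ => by
      rw [norm_mul, Complex.norm_real]; exact mul_le_of_le_one_left (norm_nonneg _) (hb ξ))

/-- Multiplication by a bounded measurable real function on `L²`. -/
def mulOp (g : E d → ℝ) (hg : Measurable g) (hb : ∀ ξ, |g ξ| ≤ 1) : CL2 d →L[ℂ] CL2 d :=
  LinearMap.mkContinuous
    { toFun := fun z => (memLp_ofReal_mul hg hb (Lp.memLp z)).toLp _
      map_add' := fun z y => by
        ext1
        filter_upwards [(memLp_ofReal_mul hg hb (Lp.memLp (z + y))).coeFn_toLp,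
          (memLp_ofReal_mul hg hb (Lp.memLp z)).coeFn_toLp,
          (memLp_ofReal_mul hg hb (Lp.memLp y)).coeFn_toLp,
          Lp.coeFn_add ((memLp_ofReal_mul hg hb (Lp.memLp z)).toLp _)
            ((memLp_ofReal_mul hg hb (Lp.memLp y)).toLp _),
          Lp.coeFn_add z y] with ξ h1 h2 h3 h4 h5
        rw [h1, h4, Pi.add_apply, h2, h3, h5, Pi.add_apply, mul_add]
      map_smul' := fun c z => by
        ext1
        filter_upwards [(memLp_ofReal_mul hg hb (Lp.memLp (c • z))).coeFn_toLp,
          (memLp_ofReal_mul hg hb (Lp.memLp z)).coeFn_toLp,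
          Lp.coeFn_smul c ((memLp_ofReal_mul hg hb (Lp.memLp z)).toLp _),
          Lp.coeFn_smul c z] with ξ h1 h2 h3 h4
        simp only [RingHom.id_apply]
        rw [h1, h3, Pi.smul_apply, h2, h4, Pi.smul_apply, smul_eq_mul, smul_eq_mul]
        ring }
    1 fun z => by
      rw [one_mul]
      refine Lp.norm_le_norm_of_ae_le ?_
      simp only [LinearMap.coe_mk, AddHom.coe_mk]
      filter_upwards [(memLp_ofReal_mul hg hb (Lp.memLp z)).coeFn_toLp] with ξ h1
      rw [h1, norm_mul, Complex.norm_real]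
      exact mul_le_of_le_one_left (norm_nonneg _) (hb ξ)

theorem coeFn_mulOp (g : E d → ℝ) (hg : Measurable g) (hb : ∀ ξ, |g ξ| ≤ 1) (z : CL2 d) :
    mulOp g hg hb z =ᵐ[volume] fun ξ => (g ξ : ℂ) * z ξ :=
  (memLp_ofReal_mul hg hb (Lp.memLp z)).coeFn_toLp

theorem norm_mulOp_le (g : E d → ℝ) (hg : Measurable g) (hb : ∀ ξ, |g ξ| ≤ 1) (z : CL2 d) :
    ‖mulOp g hg hb z‖ ≤ ‖z‖ := by
  refine Lp.norm_le_norm_of_ae_le ?_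
  filter_upwards [coeFn_mulOp g hg hb z] with ξ h1
  rw [h1, norm_mul, Complex.norm_real]
  exact mul_le_of_le_one_left (norm_nonneg _) (hb ξ)

/-- The Fourier symbol of `-Δ`. -/
def symb (ξ : E d) : ℝ := (2 * Real.pi * ‖ξ‖) ^ 2

theorem symb_nonneg (ξ : E d) : 0 ≤ symb ξ := sq_nonneg _

@[fun_prop]
theorem continuous_symb : Continuous (symb : E d → ℝ) := by unfold symb; fun_prop

/-- The heat semigroup on the Fourier side (the identity for negative times). -/
def heatOp (t : ℝ) : CL2 d →L[ℂ] CL2 d :=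
  mulOp (fun ξ => Real.exp (-(max t 0) * symb ξ)) (by fun_prop) fun ξ => by
    rw [Real.abs_exp, Real.exp_le_one_iff, neg_mul, neg_nonpos]
    exact mul_nonneg (le_max_right _ _) (symb_nonneg ξ)

theorem coeFn_heatOp_max (t : ℝ) (z : CL2 d) :
    heatOp t z =ᵐ[volume] fun ξ => (Real.exp (-(max t 0) * symb ξ) : ℂ) * z ξ :=
  coeFn_mulOp _ _ _ z

theorem coeFn_heatOp {t : ℝ} (ht : 0 ≤ t) (z : CL2 d) :
    heatOp t z =ᵐ[volume] fun ξ => (Real.exp (-t * symb ξ) : ℂ) * z ξ := by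
  have := coeFn_heatOp_max t z
  simpa only [max_eq_left ht] using this

theorem norm_heatOp_le (t : ℝ) (z : CL2 d) : ‖heatOp t z‖ ≤ ‖z‖ := norm_mulOp_le _ _ _ z

theorem heatOp_zero (z : CL2 d) : heatOp 0 z = z := by
  ext1
  filter_upwards [coeFn_heatOp le_rfl z] with ξ h
  rw [h]; simp

theorem heatOp_add {s t : ℝ} (hs : 0 ≤ s) (ht : 0 ≤ t) (z : CL2 d) :
    heatOp (s + t) z = heatOp s (heatOp t z) := by
  ext1
  filter_upwards [coeFn_heatOp (add_nonneg hs ht) z, coeFn_heatOp ht z,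
    coeFn_heatOp hs (heatOp t z)] with ξ h1 h2 h3
  rw [h1, h3, h2, ← mul_assoc, ← Complex.ofReal_mul, ← Real.exp_add]
  ring_nf

theorem norm_heatOp_antitone {s t : ℝ} (hs : 0 ≤ s) (hst : s ≤ t) (z : CL2 d) :
    ‖heatOp t z‖ ≤ ‖heatOp s z‖ := by
  have := heatOp_add (sub_nonneg.2 hst) hs z
  rw [sub_add_cancel] at this
  rw [this]
  exact norm_heatOp_le _ _

theorem inner_heatOp_left {t : ℝ} (ht : 0 ≤ t) (y z : CL2 d) :
    inner ℂ (heatOp t y) z = inner ℂ y (heatOp t z) := by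
  rw [L2.inner_def, L2.inner_def]
  refine integral_congr_ae ?_
  filter_upwards [coeFn_heatOp ht z, coeFn_heatOp ht y] with ξ h1 h2
  rw [h1, h2]
  simp only [RCLike.inner_apply, map_mul, Complex.conj_ofReal]
  ring

theorem continuous_heatOp (z : CL2 d) : Continuous fun t => heatOp t z := by
  rw [continuous_iff_continuousAt]
  intro s
  have hz := MemLp.lintegral_enorm_sq_lt_top (Lp.memLp z)
  have key : Filter.Tendsto (fun t => ∫⁻ ξ,
      ‖((Real.exp (-(max t 0) * symb ξ) - Real.exp (-(max s 0) * symb ξ) : ℝ) : ℂ) * z ξ‖ₑ ^ 2)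
      (nhds s) (nhds (∫⁻ _ξ : E d, 0)) := by
    -- Strong continuity by dominated convergence: the difference of two multipliers with values in
    -- [0,1] is at most 1, so |z|² dominates.
    refine tendsto_lintegral_filter_of_dominated_convergence (fun ξ => ‖z ξ‖ₑ ^ 2) ?_ ?_ hz.ne ?_
    · refine Filter.Eventually.of_forall fun t => ?_
      have : Measurable fun ξ : E d =>
          ((Real.exp (-(max t 0) * symb ξ) - Real.exp (-(max s 0) * symb ξ) : ℝ) : ℂ) := by fun_prop
      exact (this.mul (Lp.stronglyMeasurable z).measurable).enorm.pow_const 2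
    · refine Filter.Eventually.of_forall fun t => Filter.Eventually.of_forall fun ξ => ?_
      have h01 : ∀ r : ℝ, Real.exp (-(max r 0) * symb ξ) ∈ Icc (0 : ℝ) 1 := fun r => by
        refine ⟨(Real.exp_pos _).le, ?_⟩
        rw [Real.exp_le_one_iff, neg_mul, neg_nonpos]
        exact mul_nonneg (le_max_right _ _) (symb_nonneg ξ)
      gcongr
      rw [enorm_mul]
      refine mul_le_of_le_one_left zero_le ?_
      rw [← ofReal_norm, ENNReal.ofReal_le_one, Complex.norm_real, Real.norm_eq_abs, abs_le]
      constructor <;> linarith [(h01 t).1, (h01 t).2, (h01 s).1, (h01 s).2]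
    · refine Filter.Eventually.of_forall fun ξ => ?_
      have hc : Continuous fun t : ℝ => ‖((Real.exp (-(max t 0) * symb ξ) -
          Real.exp (-(max s 0) * symb ξ) : ℝ) : ℂ) * z ξ‖ₑ ^ 2 := by fun_prop
      have := hc.tendsto s
      simpa using this
  have heq : ∀ t, ‖heatOp t z - heatOp s z‖ₑ ^ 2 = ∫⁻ ξ,
      ‖((Real.exp (-(max t 0) * symb ξ) - Real.exp (-(max s 0) * symb ξ) : ℝ) : ℂ) * z ξ‖ₑ ^ 2 := by
    intro t
    rw [enorm_Lp_two_sq]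
    refine lintegral_congr_ae ?_
    filter_upwards [Lp.coeFn_sub (heatOp t z) (heatOp s z), coeFn_heatOp_max t z,
      coeFn_heatOp_max s z] with ξ h1 h2 h3
    rw [h1, Pi.sub_apply, h2, h3, Complex.ofReal_sub, sub_mul]
  simp_rw [← heq, lintegral_zero] at key
  rw [ContinuousAt, tendsto_iff_norm_sub_tendsto_zero]
  have h2 := (Real.continuous_sqrt.tendsto 0).comp
    ((ENNReal.tendsto_toReal ENNReal.zero_ne_top).comp key)
  simpa [Function.comp_def, ENNReal.toReal_pow, Real.sqrt_sq] using h2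

/-- The heat flow of a Fourier transform `z`, evaluated in physical space by the Fourier
integral. -/
def heatFlow (τ : ℝ) (z : E d → ℂ) : E d → ℂ :=
  𝓕⁻ fun ξ => (Real.exp (-τ * symb ξ) : ℂ) * z ξ

theorem integrable_exp_neg_mul_symb {τ : ℝ} (hτ : 0 < τ) :
    Integrable fun ξ : E d => Real.exp (-τ * symb ξ) := by
  have := (GaussianFourier.integrable_cexp_neg_mul_sq_norm_add (V := E d)
    (b := ((τ * (2 * Real.pi) ^ 2 : ℝ) : ℂ)) (by rw [Complex.ofReal_re]; positivity) 0 0).norm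
  refine this.congr (Filter.Eventually.of_forall fun ξ => ?_)
  simp only [zero_mul, add_zero, Complex.norm_exp]
  congr 1
  rw [symb, ← Complex.ofReal_neg, ← Complex.ofReal_pow, ← Complex.ofReal_mul, Complex.ofReal_re]
  ring

theorem memLp_exp_neg_mul_symb {τ : ℝ} (hτ : 0 < τ) :
    MemLp (fun ξ : E d => (Real.exp (-τ * symb ξ) : ℂ)) 2 volume := by
  have hm : AEStronglyMeasurable (fun ξ : E d => (Real.exp (-τ * symb ξ) : ℂ)) volume :=
    Continuous.aestronglyMeasurable (by fun_prop)
  rw [memLp_two_iff_integrable_sq_norm hm]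
  refine (integrable_exp_neg_mul_symb (d := d) (mul_pos two_pos hτ)).congr
    (Filter.Eventually.of_forall fun ξ => ?_)
  simp only [Complex.norm_real, Real.norm_eq_abs, Real.abs_exp]
  rw [← Real.exp_nat_mul]
  congr 1; push_cast; ring

theorem integrable_heat_mul {τ : ℝ} (hτ : 0 < τ) {z : E d → ℂ} (hz : MemLp z 2 volume) :
    Integrable fun ξ => (Real.exp (-τ * symb ξ) : ℂ) * z ξ :=
  (memLp_exp_neg_mul_symb hτ).integrable_mul hz

theorem memLp_heat_mul {τ : ℝ} (hτ : 0 ≤ τ) {z : E d → ℂ} (hz : MemLp z 2 volume) :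
    MemLp (fun ξ => (Real.exp (-τ * symb ξ) : ℂ) * z ξ) 2 volume := by
  refine hz.of_le (AEStronglyMeasurable.mul (Continuous.aestronglyMeasurable (by fun_prop)) hz.1)
    (Filter.Eventually.of_forall fun ξ => ?_)
  rw [norm_mul, Complex.norm_real, Real.norm_eq_abs, Real.abs_exp]
  refine mul_le_of_le_one_left (norm_nonneg _) ?_
  rw [Real.exp_le_one_iff, neg_mul, neg_nonpos]
  exact mul_nonneg hτ (symb_nonneg ξ)

theorem heatFlow_congr_ae {τ : ℝ} {z y : E d → ℂ} (h : z =ᵐ[volume] y) :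
    heatFlow τ z = heatFlow τ y := by
  ext x
  exact Real.fourierInv_congr_ae (h.mono fun ξ hξ => by simp only [hξ]) x

theorem heatFlow_add {τ : ℝ} (hτ : 0 < τ) {z y : E d → ℂ} (hz : MemLp z 2 volume)
    (hy : MemLp y 2 volume) (x : E d) :
    heatFlow τ (z + y) x = heatFlow τ z x + heatFlow τ y x := by
  simp only [heatFlow, fourierInv_eq_exp_phase]
  rw [← integral_add (integrable_exp_phase_mul (integrable_heat_mul hτ hz) x)
    (integrable_exp_phase_mul (integrable_heat_mul hτ hy) x)]
  congr 1; ext ξ; simp only [Pi.add_apply]; ring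

theorem heatFlow_smul (τ : ℝ) (c : ℂ) (z : E d → ℂ) (x : E d) :
    heatFlow τ (c • z) x = c * heatFlow τ z x := by
  simp only [heatFlow, fourierInv_eq_exp_phase]
  rw [← integral_const_mul]
  congr 1; ext ξ; simp only [Pi.smul_apply, smul_eq_mul]; ring

theorem heatFlow_heatOp {s : ℝ} (hs : 0 ≤ s) (τ : ℝ) (z : CL2 d) :
    heatFlow τ (heatOp s z) = heatFlow (τ + s) z := by
  rw [heatFlow_congr_ae (coeFn_heatOp hs z), heatFlow, heatFlow]
  congr 1; ext ξ
  rw [← mul_assoc, ← Complex.ofReal_mul, ← Real.exp_add]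
  ring_nf

theorem lintegral_heatFlow_sq {τ : ℝ} (hτ : 0 < τ) (z : CL2 d) :
    ∫⁻ x, ‖heatFlow τ z x‖ₑ ^ 2 = ‖heatOp τ z‖ₑ ^ 2 := by
  rw [heatFlow, lintegral_enorm_fourierInv_sq (integrable_heat_mul hτ (Lp.memLp z))
    (memLp_heat_mul hτ.le (Lp.memLp z)), enorm_Lp_two_sq]
  refine lintegral_congr_ae ?_
  filter_upwards [coeFn_heatOp hτ.le z] with ξ h
  rw [h]

theorem stronglyMeasurable_heatFlow (z : CL2 d) :
    StronglyMeasurable fun p : ℝ × E d => heatFlow p.1 z p.2 := by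
  simp only [heatFlow, fourierInv_eq_exp_phase]
  refine StronglyMeasurable.integral_prod_right' (f := fun q : (ℝ × E d) × E d =>
    Complex.exp (phase q.1.2 q.2) * ((Real.exp (-q.1.1 * symb q.2) : ℂ) * z q.2)) ?_
  have c1 : Continuous fun q : (ℝ × E d) × E d => Complex.exp (phase q.1.2 q.2) := by
    unfold phase; fun_prop
  have c2 : Continuous fun q : (ℝ × E d) × E d => (Real.exp (-q.1.1 * symb q.2) : ℂ) := by fun_prop
  exact c1.stronglyMeasurable.mul (c2.stronglyMeasurable.mul
      ((Lp.stronglyMeasurable z).comp_measurable measurable_snd))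

end

/-! ### The observation operator. -/

section

variable {d : ℕ} {S : Set (E d)}

/-- The measure on the space-time slab `[0,T] × ℝ^d`. -/
abbrev slab (d : ℕ) (T : ℝ) : Measure (ℝ × E d) :=
  ((volume : Measure ℝ).restrict (Icc 0 T)).prod (volume : Measure (E d))

/-- The backward heat flow ending in `z` at time `t`, observed on `[a,t) × S`. -/
def obsFun (S : Set (E d)) (a t : ℝ) (z : CL2 d) : ℝ × E d → ℂ :=
  (Ico a t ×ˢ S).indicator fun p => heatFlow (t - p.1) z p.2

theorem stronglyMeasurable_obsFun (hS : MeasurableSet S) (a t : ℝ) (z : CL2 d) :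
    StronglyMeasurable (obsFun S a t z) := by
  have h : Measurable fun p : ℝ × E d => (t - p.1, p.2) := by fun_prop
  exact ((stronglyMeasurable_heatFlow z).comp_measurable h).indicator (measurableSet_Ico.prod hS)

/-- The energy of the heat flow observed on `S`. -/
def localEnergy (S : Set (E d)) (z : CL2 d) (τ : ℝ) : ℝ≥0∞ := ∫⁻ x in S, ‖heatFlow τ z x‖ₑ ^ 2

theorem measurable_localEnergy (S : Set (E d)) (z : CL2 d) : Measurable (localEnergy S z) := by
  have h : Measurable fun p : ℝ × E d => ‖heatFlow p.1 z p.2‖ₑ ^ 2 :=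
    (stronglyMeasurable_heatFlow z).measurable.enorm.pow_const 2
  exact h.lintegral_prod_right'

theorem localEnergy_le {τ : ℝ} (hτ : 0 < τ) (z : CL2 d) :
    localEnergy S z τ ≤ ‖heatOp τ z‖ₑ ^ 2 :=
  (setLIntegral_le_lintegral _ _).trans (lintegral_heatFlow_sq hτ z).le

theorem enorm_heatOp_le (t : ℝ) (z : CL2 d) : ‖heatOp t z‖ₑ ≤ ‖z‖ₑ := by
  rw [← ofReal_norm, ← ofReal_norm]
  exact ENNReal.ofReal_le_ofReal (norm_heatOp_le t z)

theorem lintegral_obsFun_sq (hS : MeasurableSet S) (T a t : ℝ) (z : CL2 d) :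
    ∫⁻ p, ‖obsFun S a t z p‖ₑ ^ 2 ∂slab d T =
      ∫⁻ s in Icc 0 T, (Ico a t).indicator (fun s => localEnergy S z (t - s)) s := by
  rw [lintegral_prod _
    ((stronglyMeasurable_obsFun hS a t z).measurable.enorm.pow_const 2).aemeasurable]
  refine lintegral_congr fun s => ?_
  by_cases hs : s ∈ Ico a t
  · rw [indicator_of_mem hs, localEnergy, ← lintegral_indicator hS]
    refine lintegral_congr fun x => ?_
    by_cases hx : x ∈ S
    · rw [indicator_of_mem hx, obsFun, indicator_of_mem (mk_mem_prod hs hx)]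
    · rw [indicator_of_notMem hx, obsFun, indicator_of_notMem (fun h => hx h.2)]; simp
  · rw [indicator_of_notMem hs]
    have : ∀ x, obsFun S a t z (s, x) = 0 := fun x => by
      rw [obsFun, indicator_of_notMem (fun h => hs h.1)]
    simp [this]

theorem lintegral_obsFun_sq_le (hS : MeasurableSet S) (T a t : ℝ) (z : CL2 d) :
    ∫⁻ p, ‖obsFun S a t z p‖ₑ ^ 2 ∂slab d T ≤ ENNReal.ofReal (t - a) * ‖z‖ₑ ^ 2 := by
  rw [lintegral_obsFun_sq hS]
  calc _ ≤ ∫⁻ s, (Ico a t).indicator (fun s => localEnergy S z (t - s)) s :=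
        setLIntegral_le_lintegral _ _
    _ = ∫⁻ s in Ico a t, localEnergy S z (t - s) := lintegral_indicator measurableSet_Ico _
    _ ≤ ∫⁻ s in Ico a t, ‖z‖ₑ ^ 2 := setLIntegral_mono' measurableSet_Ico fun s hs => by
        refine (localEnergy_le (sub_pos.2 hs.2) z).trans ?_
        gcongr
        exact enorm_heatOp_le _ z
    _ = _ := by rw [setLIntegral_const, Real.volume_Ico, mul_comm]

theorem memLp_obsFun (hS : MeasurableSet S) (T a t : ℝ) (z : CL2 d) :
    MemLp (obsFun S a t z) 2 (slab d T) :=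
  memLp_two_of_lintegral_lt_top (stronglyMeasurable_obsFun hS a t z).aestronglyMeasurable
    ((lintegral_obsFun_sq_le hS T a t z).trans_lt (by finiteness))

theorem norm_le_of_enorm_sq_le {F : Type*} [NormedAddCommGroup F] {x : F} {c r : ℝ} (hr : 0 ≤ r)
    (h : ‖x‖ₑ ^ 2 ≤ ENNReal.ofReal c * ENNReal.ofReal r ^ 2) : ‖x‖ ≤ √c * r := by
  rcases le_total 0 c with hc | hc
  · rw [← ofReal_norm, ← ENNReal.ofReal_pow (norm_nonneg _), ← ENNReal.ofReal_pow hr,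
      ← ENNReal.ofReal_mul hc, ENNReal.ofReal_le_ofReal_iff (by positivity)] at h
    refine le_of_sq_le_sq ?_ (by positivity)
    rwa [mul_pow, Real.sq_sqrt hc]
  · rw [ENNReal.ofReal_of_nonpos hc, zero_mul] at h
    have : ‖x‖ = 0 := by simpa using h
    rw [this]; positivity

theorem obsFun_add (a t : ℝ) (z y : CL2 d) :
    obsFun S a t (z + y) = obsFun S a t z + obsFun S a t y := by
  ext p
  by_cases hp : p ∈ Ico a t ×ˢ S
  · simp only [obsFun, Pi.add_apply, indicator_of_mem hp]
    -- The half-open time interval keeps the elapsed time strictly positive; only then does the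
    -- Gaussian factor make the Fourier integral of an arbitrary L² datum converge.
    rw [heatFlow_congr_ae (Lp.coeFn_add z y),
      heatFlow_add (sub_pos.2 hp.1.2) (Lp.memLp z) (Lp.memLp y)]
  · simp only [obsFun, Pi.add_apply, indicator_of_notMem hp, add_zero]

theorem obsFun_smul (a t : ℝ) (c : ℂ) (z : CL2 d) :
    obsFun S a t (c • z) = c • obsFun S a t z := by
  ext p
  by_cases hp : p ∈ Ico a t ×ˢ S
  · simp only [obsFun, Pi.smul_apply, indicator_of_mem hp, smul_eq_mul]
    rw [heatFlow_congr_ae (Lp.coeFn_smul c z), heatFlow_smul]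
  · simp only [obsFun, Pi.smul_apply, indicator_of_notMem hp, smul_zero]

/-- The observation operator: the backward heat flow ending at time `t`, observed on
`[a,t) × S`, as an element of `L²([0,T] × ℝ^d)`. -/
def obsOp (hS : MeasurableSet S) (T a t : ℝ) : CL2 d →L[ℂ] Lp ℂ 2 (slab d T) :=
  LinearMap.mkContinuous
    { toFun := fun z => (memLp_obsFun hS T a t z).toLp _
      map_add' := fun z y => by
        rw [← MemLp.toLp_add]
        congr 1
        exact obsFun_add a t z y
      map_smul' := fun c z => by
        rw [RingHom.id_apply, ← MemLp.toLp_const_smul]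
        congr 1
        exact obsFun_smul a t c z }
    √(t - a) fun z => by
      refine norm_le_of_enorm_sq_le (norm_nonneg z) ?_
      simp only [LinearMap.coe_mk, AddHom.coe_mk]
      rw [enorm_Lp_two_sq, ofReal_norm]
      refine le_trans (le_of_eq (lintegral_congr_ae ?_)) (lintegral_obsFun_sq_le hS T a t z)
      filter_upwards [(memLp_obsFun hS T a t z).coeFn_toLp] with p hp
      rw [hp]

theorem coeFn_obsOp (hS : MeasurableSet S) (T a t : ℝ) (z : CL2 d) :
    obsOp hS T a t z =ᵐ[slab d T] obsFun S a t z :=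
  (memLp_obsFun hS T a t z).coeFn_toLp

theorem enorm_obsOp_sq (hS : MeasurableSet S) (T a t : ℝ) (z : CL2 d) :
    ‖obsOp hS T a t z‖ₑ ^ 2 = ∫⁻ p, ‖obsFun S a t z p‖ₑ ^ 2 ∂slab d T := by
  rw [enorm_Lp_two_sq]
  exact lintegral_congr_ae ((coeFn_obsOp hS T a t z).mono fun p hp => by simp only [hp])

theorem norm_obsOp_le (hS : MeasurableSet S) (T a t : ℝ) (z : CL2 d) :
    ‖obsOp hS T a t z‖ ≤ √(t - a) * ‖z‖ := by
  refine norm_le_of_enorm_sq_le (norm_nonneg z) ?_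
  rw [enorm_obsOp_sq, ofReal_norm]
  exact lintegral_obsFun_sq_le hS T a t z

/-- Semigroup law under observation: before time `b`, the backward flow from `t` is the backward
flow from `b` of the datum evolved by t - b. Its adjoint form gives the time continuity of
controlled solutions. -/
theorem obsOp_eq_add (hS : MeasurableSet S) (T : ℝ) {a b t : ℝ} (hab : a ≤ b) (hbt : b ≤ t)
    (z : CL2 d) :
    obsOp hS T a t z = obsOp hS T b t z + obsOp hS T a b (heatOp (t - b) z) := by
  ext1
  filter_upwards [coeFn_obsOp hS T a t z, coeFn_obsOp hS T b t z,
    coeFn_obsOp hS T a b (heatOp (t - b) z), Lp.coeFn_add (obsOp hS T b t z)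
      (obsOp hS T a b (heatOp (t - b) z))] with p h1 h2 h3 h4
  rw [h4, Pi.add_apply, h1, h2, h3]
  have e : heatFlow (b - p.1) (heatOp (t - b) z) p.2 = heatFlow (t - p.1) z p.2 := by
    rw [heatFlow_heatOp (sub_nonneg.2 hbt)]; congr 1; ring
  by_cases hx : p.2 ∈ S
  · by_cases h5 : p.1 < b
    · by_cases h6 : a ≤ p.1
      · rw [obsFun, obsFun, obsFun, indicator_of_mem (show p ∈ Ico a t ×ˢ S from ⟨⟨h6, h5.trans_le hbt⟩, hx⟩),
          indicator_of_notMem (fun h => (not_le.2 h5) h.1.1), indicator_of_mem (show p ∈ Ico a b ×ˢ S from ⟨⟨h6, h5⟩, hx⟩), e,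
          zero_add]
      · rw [obsFun, obsFun, obsFun, indicator_of_notMem (fun h => h6 h.1.1),
          indicator_of_notMem (fun h => (not_le.2 h5) h.1.1),
          indicator_of_notMem (fun h => h6 h.1.1), zero_add]
    · by_cases h6 : p.1 < t
      · rw [obsFun, obsFun, obsFun, indicator_of_mem (show p ∈ Ico a t ×ˢ S from ⟨⟨hab.trans (not_lt.1 h5), h6⟩, hx⟩),
          indicator_of_mem (show p ∈ Ico b t ×ˢ S from ⟨⟨not_lt.1 h5, h6⟩, hx⟩), indicator_of_notMem (fun h => h5 h.1.2),
          add_zero]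
      · rw [obsFun, obsFun, obsFun, indicator_of_notMem (fun h => h6 h.1.2),
          indicator_of_notMem (fun h => h6 h.1.2), indicator_of_notMem (fun h => h5 h.1.2),
          add_zero]
  · rw [obsFun, obsFun, obsFun, indicator_of_notMem (fun h => hx h.2),
      indicator_of_notMem (fun h => hx h.2), indicator_of_notMem (fun h => hx h.2), add_zero]

theorem enorm_obsOp_zero_sq (hS : MeasurableSet S) {T : ℝ} (z : CL2 d) :
    ‖obsOp hS T 0 T z‖ₑ ^ 2 = ∫⁻ τ in Ioc 0 T, localEnergy S z τ := by
  rw [enorm_obsOp_sq, lintegral_obsFun_sq hS, lintegral_indicator measurableSet_Ico,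
    Measure.restrict_restrict measurableSet_Ico, inter_eq_left.2 Ico_subset_Icc_self]
  have := (Measure.measurePreserving_sub_left (volume : Measure ℝ) T).setLIntegral_comp_preimage
    (measurableSet_Ioc (a := (0 : ℝ)) (b := T)) (measurable_localEnergy S z)
  rw [← this]
  congr 2
  ext s; simp only [mem_Ico, mem_preimage, mem_Ioc]; constructor <;> rintro ⟨h1, h2⟩ <;> constructor <;> linarith

end

/-! ### From the spectral inequality to observability. -/

section

variable {d : ℕ} {S : Set (E d)}

/-- A spectral inequality `‖F‖ ≤ d₀ e^{d₁ λ} ‖𝓕⁻ F‖_{L²(S)}` for `F` supported in the ball of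
radius `λ`. -/
def SpectralInequality (S : Set (E d)) (d₀ d₁ : ℝ) : Prop :=
  ∀ lam : ℝ, 0 ≤ lam → ∀ F : E d → ℂ, StronglyMeasurable F → MemLp F 2 volume →
    (∀ ξ, lam < ‖ξ‖ → F ξ = 0) → ∫⁻ ξ, ‖F ξ‖ₑ ^ 2 ≤
      ENNReal.ofReal ((d₀ * Real.exp (d₁ * lam)) ^ 2) * ∫⁻ x in S, ‖𝓕⁻ F x‖ₑ ^ 2

theorem enorm_sub_sq_le (u v : ℂ) : ‖u - v‖ₑ ^ 2 ≤ 2 * ‖u‖ₑ ^ 2 + 2 * ‖v‖ₑ ^ 2 := by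
  have := enorm_sq_le_of_le_add (u := u) (p := u - v) (e := v) (ε := 1) (c := ‖u - v‖) rfl
    zero_le_one (norm_nonneg _) (by rw [one_mul])
  simpa using this

/-- Low frequencies are observed, high frequencies are dissipated. -/
theorem enorm_heatOp_sq_le_of_spectralInequality {d₀ d₁ : ℝ} (h : SpectralInequality S d₀ d₁)
    (hd₀ : 1 ≤ d₀) (hd₁ : 0 ≤ d₁) {lam s t : ℝ} (hlam : 0 ≤ lam) (hs : 0 ≤ s) (hst : s < t)
    (z : CL2 d) :
    ‖heatOp t z‖ₑ ^ 2 ≤ ENNReal.ofReal (2 * (d₀ * Real.exp (d₁ * lam)) ^ 2) * localEnergy S z t +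
      ENNReal.ofReal (3 * (d₀ * Real.exp (d₁ * lam)) ^ 2 *
        Real.exp (-(2 * Real.pi * lam) ^ 2 * (2 * (t - s)))) * ‖heatOp s z‖ₑ ^ 2 := by
  set D := d₀ * Real.exp (d₁ * lam) with hD
  have hD1 : 1 ≤ D := one_le_mul_of_one_le_of_one_le hd₀ (Real.one_le_exp (by positivity))
  have ht : 0 < t := hs.trans_lt hst
  set B : Set (E d) := Metric.closedBall 0 lam with hB
  have hBm : MeasurableSet B := measurableSet_closedBall
  set g : E d → ℂ := fun ξ => (Real.exp (-t * symb ξ) : ℂ) * z ξ with hg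
  have hgm : StronglyMeasurable g :=
    (Continuous.stronglyMeasurable (by fun_prop)).mul (Lp.stronglyMeasurable z)
  have hg1 : Integrable g := integrable_heat_mul ht (Lp.memLp z)
  have hg2 : MemLp g 2 volume := memLp_heat_mul ht.le (Lp.memLp z)
  have hP := h lam hlam (B.indicator g) (hgm.indicator hBm) (hg2.indicator hBm) fun ξ hξ => by
    rw [indicator_of_notMem]; simpa [hB] using hξ
  set q := ∫⁻ ξ, ‖Bᶜ.indicator g ξ‖ₑ ^ 2 with hq
  have hsplit : ‖heatOp t z‖ₑ ^ 2 = (∫⁻ ξ, ‖B.indicator g ξ‖ₑ ^ 2) + q := by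
    have e : ∀ A : Set (E d), MeasurableSet A →
        ∫⁻ ξ, ‖A.indicator g ξ‖ₑ ^ 2 = ∫⁻ ξ in A, ‖g ξ‖ₑ ^ 2 := fun A hA => by
      rw [← lintegral_indicator hA]
      refine lintegral_congr fun ξ => ?_
      by_cases hξ : ξ ∈ A <;> simp [hξ]
    rw [hq, e B hBm, e _ hBm.compl, lintegral_add_compl _ hBm, enorm_Lp_two_sq]
    exact lintegral_congr_ae ((coeFn_heatOp ht.le z).mono fun ξ hξ => by simp only [hξ, hg])
  have hobs : ∫⁻ x in S, ‖𝓕⁻ (B.indicator g) x‖ₑ ^ 2 ≤ 2 * localEnergy S z t + 2 * q := by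
    have hsub : ∀ x, 𝓕⁻ (B.indicator g) x = heatFlow t z x - 𝓕⁻ (Bᶜ.indicator g) x := by
      intro x
      rw [heatFlow, fourierInv_eq_exp_phase, fourierInv_eq_exp_phase, fourierInv_eq_exp_phase,
        ← integral_sub (integrable_exp_phase_mul hg1 x)
          (integrable_exp_phase_mul (hg1.indicator hBm.compl) x)]
      congr 1; ext ξ
      by_cases hξ : ξ ∈ B <;> simp [hξ, hg]
    have hm : Measurable fun x => ‖heatFlow t z x‖ₑ ^ 2 :=
      (continuous_fourierInv hg1).measurable.enorm.pow_const 2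
    calc _ ≤ ∫⁻ x in S, (2 * ‖heatFlow t z x‖ₑ ^ 2 + 2 * ‖𝓕⁻ (Bᶜ.indicator g) x‖ₑ ^ 2) :=
          lintegral_mono fun x => by rw [hsub]; exact enorm_sub_sq_le _ _
      _ = 2 * localEnergy S z t + 2 * ∫⁻ x in S, ‖𝓕⁻ (Bᶜ.indicator g) x‖ₑ ^ 2 := by
          rw [lintegral_add_left (hm.const_mul 2), lintegral_const_mul _ hm,
            lintegral_const_mul' _ _ (by finiteness), localEnergy]
      _ ≤ _ := by
          gcongr
          rw [hq, ← lintegral_enorm_fourierInv_sq (hg1.indicator hBm.compl)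
            (hg2.indicator hBm.compl)]
          exact setLIntegral_le_lintegral _ _
  have hdecay : q ≤ ENNReal.ofReal (Real.exp (-(2 * Real.pi * lam) ^ 2 * (2 * (t - s)))) *
      ‖heatOp s z‖ₑ ^ 2 := by
    rw [hq, enorm_Lp_two_sq, ← lintegral_const_mul' _ _ (by finiteness)]
    refine lintegral_mono_ae ?_
    filter_upwards [coeFn_heatOp hs z] with ξ hξ
    by_cases hξB : ξ ∈ B
    · simp [hξB]
    · rw [indicator_of_mem (by exact hξB), hξ, hg]
      have hξ' : lam < ‖ξ‖ := by simpa [hB] using hξB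
      have hsy : (2 * Real.pi * lam) ^ 2 ≤ symb ξ := by rw [symb]; gcongr
      generalize (2 * Real.pi * lam) ^ 2 = κ at hsy ⊢
      rw [enorm_mul, enorm_mul, mul_pow, mul_pow, ← mul_assoc]
      gcongr
      rw [← ofReal_norm, ← ofReal_norm, Complex.norm_real, Complex.norm_real, Real.norm_eq_abs,
        Real.norm_eq_abs, Real.abs_exp, Real.abs_exp, ← ENNReal.ofReal_pow (Real.exp_pos _).le,
        ← ENNReal.ofReal_pow (Real.exp_pos _).le, ← ENNReal.ofReal_mul (Real.exp_pos _).le,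
        ← Real.exp_nat_mul, ← Real.exp_nat_mul, ← Real.exp_add]
      gcongr
      push_cast
      nlinarith [sub_pos.2 hst]
  have hD2 : (1 : ℝ≥0∞) ≤ ENNReal.ofReal (D ^ 2) := by
    rw [ENNReal.one_le_ofReal]; exact one_le_pow₀ hD1
  -- The high-frequency energy `q` occurs three times: once as itself, and twice when the observed
  -- low-frequency part is replaced by the observed full flow.
  calc ‖heatOp t z‖ₑ ^ 2 ≤ ENNReal.ofReal (D ^ 2) * (2 * localEnergy S z t + 2 * q) +
        ENNReal.ofReal (D ^ 2) * q := by
        rw [hsplit]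
        exact add_le_add (hP.trans (by gcongr)) (le_mul_of_one_le_left zero_le hD2)
    _ = ENNReal.ofReal (2 * D ^ 2) * localEnergy S z t + ENNReal.ofReal (3 * D ^ 2) * q := by
        rw [ENNReal.ofReal_mul (by norm_num), ENNReal.ofReal_mul (by norm_num),
          ENNReal.ofReal_ofNat, ENNReal.ofReal_ofNat]
        ring
    _ ≤ _ := by
        rw [ENNReal.ofReal_mul (p := 3 * D ^ 2) (by positivity), mul_assoc]
        gcongr

/-- Averages the instantaneous estimate over the second half of the interval: there at least τ/2 has
elapsed since `s`, so high frequencies are already damped, and the energy is still at least the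
final one. Dividing by 2 D² gives the observation coefficient 1, ready for telescoping. -/
theorem interval_observation {d₀ d₁ : ℝ} (h : SpectralInequality S d₀ d₁)
    (hd₀ : 1 ≤ d₀) (hd₁ : 0 ≤ d₁) {lam s τ : ℝ} (hlam : 0 ≤ lam) (hs : 0 ≤ s) (hτ : 0 < τ)
    (z : CL2 d) :
    ENNReal.ofReal (τ / (4 * d₀ ^ 2) * Real.exp (-(2 * d₁ * lam))) * ‖heatOp (s + τ) z‖ₑ ^ 2 ≤
      (∫⁻ t in Ioc s (s + τ), localEnergy S z t) +
        ENNReal.ofReal (3 * τ / 4 * Real.exp (-(2 * Real.pi * lam) ^ 2 * τ)) *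
          ‖heatOp s z‖ₑ ^ 2 := by
  set D := d₀ * Real.exp (d₁ * lam) with hD
  have hD0 : 0 < D := by positivity
  set e := Real.exp (-(2 * Real.pi * lam) ^ 2 * τ) with he
  have h1 : ENNReal.ofReal (τ / 2) * ‖heatOp (s + τ) z‖ₑ ^ 2 ≤
      ENNReal.ofReal (2 * D ^ 2) * (∫⁻ t in Ioc s (s + τ), localEnergy S z t) +
      ENNReal.ofReal (τ / 2) * (ENNReal.ofReal (3 * D ^ 2 * e) * ‖heatOp s z‖ₑ ^ 2) := by
    have hvol : ∀ c : ℝ≥0∞, ∫⁻ _ in Ioc (s + τ / 2) (s + τ), c = ENNReal.ofReal (τ / 2) * c := by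
      intro c
      rw [setLIntegral_const, Real.volume_Ioc, mul_comm]; congr 2; ring
    rw [← hvol, ← hvol]
    calc _ ≤ ∫⁻ t in Ioc (s + τ / 2) (s + τ), (ENNReal.ofReal (2 * D ^ 2) * localEnergy S z t +
          ENNReal.ofReal (3 * D ^ 2 * e) * ‖heatOp s z‖ₑ ^ 2) := by
          refine setLIntegral_mono' measurableSet_Ioc fun t ht => ?_
          have hst : s < t := by linarith [ht.1]
          calc ‖heatOp (s + τ) z‖ₑ ^ 2 ≤ ‖heatOp t z‖ₑ ^ 2 := by
                gcongr
                rw [← ofReal_norm, ← ofReal_norm]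
                exact ENNReal.ofReal_le_ofReal (norm_heatOp_antitone (by linarith) ht.2 z)
            _ ≤ _ := enorm_heatOp_sq_le_of_spectralInequality h hd₀ hd₁ hlam hs hst z
            _ ≤ _ := by
                have : Real.exp (-(2 * Real.pi * lam) ^ 2 * (2 * (t - s))) ≤ e :=
                  Real.exp_le_exp.2 (by nlinarith [sq_nonneg (2 * Real.pi * lam), ht.1])
                gcongr
      _ ≤ _ := by
          rw [lintegral_add_left ((measurable_localEnergy S z).const_mul _),
            lintegral_const_mul _ (measurable_localEnergy S z)]
          gcongr
          linarith
  have h2 := mul_le_mul_right h1 (ENNReal.ofReal (1 / (2 * D ^ 2)))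
  rw [mul_add, ← mul_assoc, ← mul_assoc, ← mul_assoc, ← mul_assoc,
    ← ENNReal.ofReal_mul (by positivity), ← ENNReal.ofReal_mul (by positivity),
    ← ENNReal.ofReal_mul (by positivity)] at h2
  have e1 : 1 / (2 * D ^ 2) * (τ / 2) = τ / (4 * d₀ ^ 2) * Real.exp (-(2 * d₁ * lam)) := by
    rw [Real.exp_neg, hD, mul_pow, ← Real.exp_nat_mul]
    push_cast
    rw [show 2 * (d₁ * lam) = 2 * d₁ * lam by ring]
    field_simp
    norm_num
  have e2 : 1 / (2 * D ^ 2) * (2 * D ^ 2) = 1 := by field_simp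
  have e3 : 1 / (2 * D ^ 2) * (τ / 2) * (3 * D ^ 2 * e) = 3 * τ / 4 * e := by
    field_simp; ring
  rw [e3, e1, e2, ENNReal.ofReal_one, one_mul] at h2
  exact h2

/-- The weight of the dyadic time `T / 2 ^ n` in the telescoping argument. -/
def dyadicWeight (d₀ d₁ T Λ : ℝ) (n : ℕ) : ℝ :=
  T / 2 ^ (n + 1) / (4 * d₀ ^ 2) * Real.exp (-(2 * d₁ * (Λ * 2 ^ n)))

/-- The matching condition of the telescoping sum: the error of step `n` fits the weight of step n +
1. Damping at cutoff Λ 2^n over time T / 2^(n+1) has exponent of order 2^n, like the spectral cost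
at the next cutoff, so a single condition on Λ serves all `n`. -/
theorem tail_le_dyadicWeight {d₀ d₁ T Λ : ℝ} (hd₀ : 1 ≤ d₀) (hT : 0 < T)
    (hΛ' : Real.log (6 * d₀ ^ 2) ≤ 2 * Real.pi ^ 2 * Λ ^ 2 * T - 4 * d₁ * Λ) (n : ℕ) :
    3 * (T / 2 ^ (n + 1)) / 4 * Real.exp (-(2 * Real.pi * (Λ * 2 ^ n)) ^ 2 * (T / 2 ^ (n + 1))) ≤
      dyadicWeight d₀ d₁ T Λ (n + 1) := by
  have hd : (1 : ℝ) ≤ d₀ ^ 2 := one_le_pow₀ hd₀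
  have hL : 0 ≤ Real.log (6 * d₀ ^ 2) := Real.log_nonneg (by linarith)
  have h2n : (1 : ℝ) ≤ 2 ^ n := one_le_pow₀ (by norm_num)
  have hexp : 6 * d₀ ^ 2 * Real.exp (-(2 * Real.pi * (Λ * 2 ^ n)) ^ 2 * (T / 2 ^ (n + 1))) ≤
      Real.exp (-(2 * d₁ * (Λ * 2 ^ (n + 1)))) := by
    rw [← Real.exp_log (show 0 < 6 * d₀ ^ 2 by linarith), ← Real.exp_add]
    refine Real.exp_le_exp.2 ?_
    have e1 : -(2 * Real.pi * (Λ * 2 ^ n)) ^ 2 * (T / 2 ^ (n + 1)) =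
        -(2 ^ n * (2 * Real.pi ^ 2 * Λ ^ 2 * T)) := by
      rw [pow_succ]; field_simp; ring
    have e2 : 2 * d₁ * (Λ * 2 ^ (n + 1)) = 2 ^ n * (4 * d₁ * Λ) := by rw [pow_succ]; ring
    rw [e1, e2]
    nlinarith
  have : 3 * (T / 2 ^ (n + 1)) / 4 *
      Real.exp (-(2 * Real.pi * (Λ * 2 ^ n)) ^ 2 * (T / 2 ^ (n + 1))) =
      T / 2 ^ (n + 1 + 1) / (4 * d₀ ^ 2) * (6 * d₀ ^ 2 *
        Real.exp (-(2 * Real.pi * (Λ * 2 ^ n)) ^ 2 * (T / 2 ^ (n + 1)))) := by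
    generalize Real.exp _ = e
    rw [pow_succ (2 : ℝ) (n + 1)]; field_simp; ring
  rw [this, dyadicWeight]
  gcongr

theorem dyadic_observation {d₀ d₁ T Λ : ℝ} (h : SpectralInequality S d₀ d₁)
    (hd₀ : 1 ≤ d₀) (hd₁ : 0 ≤ d₁) (hT : 0 < T) (hΛ : 0 ≤ Λ)
    (hΛ' : Real.log (6 * d₀ ^ 2) ≤ 2 * Real.pi ^ 2 * Λ ^ 2 * T - 4 * d₁ * Λ) (z : CL2 d) (n : ℕ) :
    ENNReal.ofReal (dyadicWeight d₀ d₁ T Λ 0) * ‖heatOp T z‖ₑ ^ 2 ≤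
      (∫⁻ t in Ioc (T / 2 ^ n) T, localEnergy S z t) +
        ENNReal.ofReal (dyadicWeight d₀ d₁ T Λ n) * ‖heatOp (T / 2 ^ n) z‖ₑ ^ 2 := by
  induction n with
  | zero => simp
  | succ n ih =>
    have hτ : 0 < T / 2 ^ (n + 1) := by positivity
    have hsum : T / 2 ^ (n + 1) + T / 2 ^ (n + 1) = T / 2 ^ n := by
      rw [pow_succ]; field_simp; norm_num
    have key := interval_observation h hd₀ hd₁ (lam := Λ * 2 ^ n) (by positivity) hτ.le hτ z
    rw [hsum] at key
    have hle : T / 2 ^ n ≤ T := div_le_self hT.le (one_le_pow₀ (by norm_num))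
    rw [← Ioc_union_Ioc_eq_Ioc (show T / 2 ^ (n + 1) ≤ T / 2 ^ n by linarith) hle,
      lintegral_union measurableSet_Ioc (Set.disjoint_left.2 fun t h1 h2 => h2.1.not_ge h1.2)]
    calc _ ≤ _ := ih
      _ ≤ (∫⁻ t in Ioc (T / 2 ^ n) T, localEnergy S z t) +
          ((∫⁻ t in Ioc (T / 2 ^ (n + 1)) (T / 2 ^ n), localEnergy S z t) +
          ENNReal.ofReal (dyadicWeight d₀ d₁ T Λ (n + 1)) * ‖heatOp (T / 2 ^ (n + 1)) z‖ₑ ^ 2) := by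
        refine add_le_add_right (key.trans ?_) _
        gcongr
        exact tail_le_dyadicWeight hd₀ hT hΛ' n
      _ = _ := by ring

/-- The leftover term vanishes as n → ∞, because the weights are at most T / 2^n and the flow is a
contraction. -/
theorem observability_of_dyadicWeight {d₀ d₁ T Λ : ℝ} (h : SpectralInequality S d₀ d₁)
    (hd₀ : 1 ≤ d₀) (hd₁ : 0 ≤ d₁) (hT : 0 < T) (hΛ : 0 ≤ Λ)
    (hΛ' : Real.log (6 * d₀ ^ 2) ≤ 2 * Real.pi ^ 2 * Λ ^ 2 * T - 4 * d₁ * Λ) (z : CL2 d) :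
    ENNReal.ofReal (dyadicWeight d₀ d₁ T Λ 0) * ‖heatOp T z‖ₑ ^ 2 ≤
      ∫⁻ t in Ioc 0 T, localEnergy S z t := by
  have hlim : Filter.Tendsto (fun n : ℕ => (∫⁻ t in Ioc 0 T, localEnergy S z t) +
      ENNReal.ofReal (T * (1 / 2) ^ n) * ‖z‖ₑ ^ 2) Filter.atTop
      (nhds ((∫⁻ t in Ioc 0 T, localEnergy S z t) + ENNReal.ofReal (T * 0) * ‖z‖ₑ ^ 2)) := by
    refine tendsto_const_nhds.add (ENNReal.Tendsto.mul_const ?_ (Or.inr (by finiteness)))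
    exact ENNReal.tendsto_ofReal ((tendsto_pow_atTop_nhds_zero_of_lt_one (by norm_num)
      (by norm_num)).const_mul T)
  rw [mul_zero, ENNReal.ofReal_zero, zero_mul, add_zero] at hlim
  refine ge_of_tendsto' hlim fun n => (dyadic_observation h hd₀ hd₁ hT hΛ hΛ' z n).trans ?_
  have hn : 0 ≤ T / 2 ^ n := by positivity
  have hw : dyadicWeight d₀ d₁ T Λ n ≤ T * (1 / 2) ^ n := by
    rw [dyadicWeight]
    calc _ ≤ T / 2 ^ (n + 1) / 1 * 1 := by
          gcongr
          · nlinarith [one_le_pow₀ (n := 2) hd₀]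
          · exact Real.exp_le_one_iff.2 (neg_nonpos.2 (by positivity))
      _ ≤ _ := by
          rw [pow_succ, one_div, inv_pow]
          have : (0 : ℝ) < 2 ^ n := by positivity
          field_simp; norm_num
  have hz : ‖heatOp (T / 2 ^ n) z‖ₑ ≤ ‖z‖ₑ := by
    exact enorm_heatOp_le _ z
  have hsub : Ioc (T / 2 ^ n) T ⊆ Ioc 0 T := Ioc_subset_Ioc_left hn
  gcongr

/-- The final-state observability estimate with explicit constant. -/
theorem observability_of_spectralInequality {d₀ d₁ T : ℝ} (h : SpectralInequality S d₀ d₁)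
    (hd₀ : 1 ≤ d₀) (hd₁ : 0 ≤ d₁) (hT : 0 < T) (z : CL2 d) :
    ‖heatOp T z‖ₑ ^ 2 ≤ ENNReal.ofReal (48 * d₀ ^ 4 * Real.exp ((3 * d₁ ^ 2 + 1) / T)) *
      ∫⁻ t in Ioc 0 T, localEnergy S z t := by
  have hd : (1 : ℝ) ≤ d₀ ^ 2 := one_le_pow₀ hd₀
  set L := Real.log (6 * d₀ ^ 2) with hL
  have hL0 : 0 ≤ L := Real.log_nonneg (by linarith)
  obtain ⟨q, hq0, hq⟩ : ∃ q : ℝ, 0 ≤ q ∧ q ^ 2 * T = L :=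
    ⟨√(L / T), Real.sqrt_nonneg _, by rw [Real.sq_sqrt (by positivity)]; field_simp⟩
  -- The part d₁/T gives d₁ Λ ≤ Λ² T and the part `q` gives L ≤ Λ² T; five copies of Λ² T fit below
  -- 2π² Λ² T.
  set Λ := d₁ / T + q with hΛ
  have hdT : 0 ≤ d₁ / T := by positivity
  have hΛ0 : 0 ≤ Λ := by positivity
  have hdT' : d₁ = d₁ / T * T := by field_simp
  have hΛ' : L ≤ 2 * Real.pi ^ 2 * Λ ^ 2 * T - 4 * d₁ * Λ := by
    have hpi : 8 ≤ Real.pi ^ 2 := by nlinarith [Real.pi_gt_three]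
    have h1 : d₁ * Λ ≤ Λ ^ 2 * T := by
      have : d₁ ≤ Λ * T := by rw [hΛ, add_mul, ← hdT']; nlinarith
      nlinarith
    have h2 : L ≤ Λ ^ 2 * T := by
      rw [← hq]
      gcongr
      linarith
    have h3 : 0 ≤ Λ ^ 2 * T := by positivity
    nlinarith
  have hw := observability_of_dyadicWeight h hd₀ hd₁ hT hΛ0 hΛ' z
  have hwpos : 0 < dyadicWeight d₀ d₁ T Λ 0 := by rw [dyadicWeight]; positivity
  have hinv : 1 ≤ 48 * d₀ ^ 4 * Real.exp ((3 * d₁ ^ 2 + 1) / T) * dyadicWeight d₀ d₁ T Λ 0 := by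
    have hexp : Real.exp (2 * d₁ * Λ) * (1 / T) ≤
        6 * d₀ ^ 2 * Real.exp ((3 * d₁ ^ 2 + 1) / T) := by
      -- The factor 1/T of the weight is hidden in the exponential, whence the +1 in the exponent.
      have h1 : 1 / T ≤ Real.exp (1 / T) := by linarith [Real.add_one_le_exp (1 / T)]
      have h2 : 2 * d₁ * Λ ≤ L + 3 * d₁ ^ 2 / T := by
        have e : 2 * d₁ * Λ = 2 * (d₁ ^ 2 / T) + 2 * d₁ * q := by rw [hΛ]; ring
        have e2 : 2 * d₁ * q ≤ d₁ ^ 2 / T + q ^ 2 * T := by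
          have : d₁ ^ 2 / T + q ^ 2 * T - 2 * d₁ * q = (d₁ / T - q) ^ 2 * T := by
            field_simp; ring
          have : 0 ≤ (d₁ / T - q) ^ 2 * T := by positivity
          linarith
        rw [e, ← hq, mul_div_assoc]; linarith
      calc _ ≤ Real.exp (L + 3 * d₁ ^ 2 / T) * Real.exp (1 / T) := by gcongr
        _ = _ := by
          rw [Real.exp_add, hL, Real.exp_log (by linarith), mul_assoc, ← Real.exp_add, add_div]
    have e : dyadicWeight d₀ d₁ T Λ 0 = 1 / (8 * d₀ ^ 2 * (Real.exp (2 * d₁ * Λ) * (1 / T))) := by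
      rw [dyadicWeight, Real.exp_neg]
      have := Real.exp_pos (2 * d₁ * Λ)
      rw [pow_zero, mul_one]; field_simp; norm_num
    rw [e, mul_one_div, one_le_div (by positivity)]
    calc _ ≤ 8 * d₀ ^ 2 * (6 * d₀ ^ 2 * Real.exp ((3 * d₁ ^ 2 + 1) / T)) := by gcongr
      _ = _ := by ring
  calc ‖heatOp T z‖ₑ ^ 2 ≤ ENNReal.ofReal (48 * d₀ ^ 4 * Real.exp ((3 * d₁ ^ 2 + 1) / T) *
        dyadicWeight d₀ d₁ T Λ 0) * ‖heatOp T z‖ₑ ^ 2 :=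
        le_mul_of_one_le_left zero_le (ENNReal.one_le_ofReal.2 hinv)
    _ ≤ _ := by
        rw [ENNReal.ofReal_mul (by positivity), mul_assoc]
        gcongr

end

/-! ### The heat equation tested against Schwartz functions. -/

section

variable {d : ℕ} {S : Set (E d)}

theorem fourier_laplacian_apply (f : 𝓢(E d, ℂ)) (ξ : E d) :
    𝓕 (Δ f) ξ = -(symb ξ : ℂ) * 𝓕 f ξ := by
  have hg : (fun x : E d => ‖x‖ ^ 2).HasTemperateGrowth := by fun_prop
  rw [SchwartzMap.laplacian_eq_fourierMultiplierCLM, FourierTransform.fourier_smul,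
    SchwartzMap.fourierMultiplierCLM_apply, FourierTransform.fourier_fourierInv_eq]
  rw [_root_.smul_apply, SchwartzMap.smulLeftCLM_apply_apply (by exact hg)]
  simp only [symb, Complex.real_smul]
  push_cast
  ring

theorem continuous_exp_neg_mul_symb_prod :
    Continuous fun p : ℝ × E d => Real.exp (-p.1 * symb p.2) := by fun_prop

/-- The evolution of an integral against the heat multiplier. -/
theorem integral_exp_neg_mul_symb {h : E d → ℂ} (h0 : Integrable h)
    (h1 : Integrable fun ξ => -(symb ξ : ℂ) * h ξ) {τ : ℝ} (hτ : 0 ≤ τ) :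
    ∫ ξ, (Real.exp (-τ * symb ξ) : ℂ) * h ξ =
      (∫ ξ, h ξ) + ∫ r in (0 : ℝ)..τ, ∫ ξ, (Real.exp (-r * symb ξ) : ℂ) * (-(symb ξ : ℂ) * h ξ) := by
  have hint : Integrable (Function.uncurry fun (r : ℝ) (ξ : E d) =>
      (Real.exp (-r * symb ξ) : ℂ) * (-(symb ξ : ℂ) * h ξ))
      (((volume : Measure ℝ).restrict (uIoc 0 τ)).prod volume) := by
    have hsnd : Integrable (fun p : ℝ × E d => -(symb p.2 : ℂ) * h p.2)
        (((volume : Measure ℝ).restrict (uIoc 0 τ)).prod volume) :=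
      have : IsFiniteMeasure ((volume : Measure ℝ).restrict (uIoc 0 τ)) :=
        ⟨by rw [uIoc_of_le hτ]; simp⟩
      h1.comp_snd _
    refine hsnd.mono (AEStronglyMeasurable.mul (Continuous.aestronglyMeasurable ?_) hsnd.1) ?_
    · exact Complex.continuous_ofReal.comp continuous_exp_neg_mul_symb_prod
    · have hae : ∀ᵐ p ∂(((volume : Measure ℝ).restrict (uIoc 0 τ)).prod (volume : Measure (E d))),
          p.1 ∈ uIoc 0 τ :=
        Measure.quasiMeasurePreserving_fst.ae (ae_restrict_mem measurableSet_uIoc)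
      filter_upwards [hae] with p hp
      rw [uIoc_of_le hτ] at hp
      simp only [Function.uncurry]
      rw [norm_mul, Complex.norm_real, Real.norm_eq_abs, Real.abs_exp]
      refine mul_le_of_le_one_left (norm_nonneg _) (Real.exp_le_one_iff.2 ?_)
      nlinarith [hp.1, symb_nonneg p.2]
  -- With the time integral inside, the claim is the fundamental theorem of calculus for exp(-r symb
  -- ξ) at each frequency.
  rw [intervalIntegral_integral_swap hint]
  have hinner : ∀ ξ : E d, ∫ r in (0 : ℝ)..τ, (Real.exp (-r * symb ξ) : ℂ) * (-(symb ξ : ℂ) * h ξ) =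
      (Real.exp (-τ * symb ξ) : ℂ) * h ξ - h ξ := by
    intro ξ
    have hd : ∀ r ∈ uIcc 0 τ, HasDerivAt (fun r : ℝ => (Real.exp (-r * symb ξ) : ℂ) * h ξ)
        ((Real.exp (-r * symb ξ) : ℂ) * (-(symb ξ : ℂ) * h ξ)) r := by
      intro r _
      have e : HasDerivAt (fun r : ℝ => Real.exp (-r * symb ξ))
          (Real.exp (-r * symb ξ) * (-1 * symb ξ)) r :=
        (((hasDerivAt_id r).neg).mul_const (symb ξ)).exp
      refine (e.ofReal_comp.mul_const (h ξ)).congr_deriv ?_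
      push_cast; ring
    rw [intervalIntegral.integral_eq_sub_of_hasDerivAt hd
      (Continuous.intervalIntegrable (by fun_prop) _ _)]
    simp
  simp_rw [hinner]
  have hexp : Integrable fun ξ => (Real.exp (-τ * symb ξ) : ℂ) * h ξ := by
    refine h0.mono (AEStronglyMeasurable.mul (Continuous.aestronglyMeasurable (by fun_prop)) h0.1)
      (Filter.Eventually.of_forall fun ξ => ?_)
    rw [norm_mul, Complex.norm_real, Real.norm_eq_abs, Real.abs_exp]
    refine mul_le_of_le_one_left (norm_nonneg _) (Real.exp_le_one_iff.2 ?_)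
    nlinarith [symb_nonneg ξ]
  rw [integral_sub hexp h0]
  ring

theorem heatFlow_fourier_schwartz (f : 𝓢(E d, ℂ)) {τ : ℝ} (hτ : 0 ≤ τ) (x : E d) :
    heatFlow τ (𝓕 f : 𝓢(E d, ℂ)) x = f x + ∫ r in (0 : ℝ)..τ, heatFlow r (𝓕 (Δ f) : 𝓢(E d, ℂ)) x := by
  have hinv : f x = ∫ ξ, Complex.exp (phase x ξ) * 𝓕 f ξ := by
    rw [← fourierInv_eq_exp_phase, ← SchwartzMap.fourierInv_coe,
      FourierTransform.fourierInv_fourier_eq]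
  have h0 := integrable_exp_phase_mul (𝓕 f).integrable x
  have h1 := integrable_exp_phase_mul (𝓕 (Δ f)).integrable x
  have hcomm : (fun ξ => Complex.exp (phase x ξ) * 𝓕 (Δ f) ξ) =
      fun ξ => -(symb ξ : ℂ) * (Complex.exp (phase x ξ) * 𝓕 f ξ) := by
    ext ξ; rw [fourier_laplacian_apply]; ring
  rw [hcomm] at h1
  have key := integral_exp_neg_mul_symb h0 h1 hτ
  rw [← hinv] at key
  rw [heatFlow, fourierInv_eq_exp_phase]
  convert key using 3
  · ring
  · ext r
    rw [heatFlow, fourierInv_eq_exp_phase]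
    congr 1; ext ξ
    rw [fourier_laplacian_apply]; ring

/-- The Fourier transform of a Schwartz function as an `L²` function. -/
def hat (f : 𝓢(E d, ℂ)) : CL2 d := (𝓕 f).toLp 2 volume

theorem coeFn_hat (f : 𝓢(E d, ℂ)) : hat f =ᵐ[volume] (𝓕 f : 𝓢(E d, ℂ)) := (𝓕 f).coeFn_toLp 2 volume

theorem inner_heatOp_hat (f : 𝓢(E d, ℂ)) (y : CL2 d) {t : ℝ} (ht : 0 ≤ t) :
    inner ℂ (heatOp t (hat f)) y =
      inner ℂ (hat f) y + ∫ s in (0 : ℝ)..t, inner ℂ (heatOp s (hat (Δ f))) y := by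
  have hint : ∀ g : 𝓢(E d, ℂ), Integrable fun ξ => y ξ * starRingEnd ℂ (𝓕 g ξ) := fun g =>
    (Lp.memLp y).integrable_mul ((𝓕 g).memLp 2 volume).star
  have hpair : ∀ (g : 𝓢(E d, ℂ)) {s : ℝ}, 0 ≤ s → inner ℂ (heatOp s (hat g)) y =
      ∫ ξ, (Real.exp (-s * symb ξ) : ℂ) * (y ξ * starRingEnd ℂ (𝓕 g ξ)) := by
    intro g s hs
    rw [L2.inner_def]
    refine integral_congr_ae ?_
    filter_upwards [coeFn_heatOp hs (hat g), coeFn_hat g] with ξ h1 h2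
    rw [h1, h2, RCLike.inner_apply, map_mul, Complex.conj_ofReal]
    ring
  have hcomm : (fun ξ => y ξ * starRingEnd ℂ (𝓕 (Δ f) ξ)) =
      fun ξ => -(symb ξ : ℂ) * (y ξ * starRingEnd ℂ (𝓕 f ξ)) := by
    ext ξ
    rw [fourier_laplacian_apply, map_mul, map_neg, Complex.conj_ofReal]; ring
  have h1 := hint (Δ f)
  rw [hcomm] at h1
  have key := integral_exp_neg_mul_symb (hint f) h1 ht
  rw [hpair f ht, key]
  congr 1
  · have := hpair f le_rfl
    rw [heatOp_zero] at this
    rw [this]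
    congr 1; ext ξ; simp
  · refine intervalIntegral.integral_congr fun s hs => ?_
    rw [uIcc_of_le ht] at hs
    rw [hpair (Δ f) hs.1]
    congr 1; ext ξ
    rw [congrFun hcomm ξ]

end

/-! ### Controlled solutions as adjoints of the observation. -/

section

variable {d : ℕ} {S : Set (E d)}

/-- At a fixed space-time point (σ, x) with x ∈ S and σ ≥ 0, the observation starts only when `s`
passes σ, so the integral in `s` is the integrated heat equation from σ to `t`; its boundary term `f
x` produces the source term of the weak formulation. -/
theorem obsFun_fourier_schwartz (f : 𝓢(E d, ℂ)) {t : ℝ} (ht : 0 ≤ t) (p : ℝ × E d)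
    (y : ℂ) :
    ∫ s in (0 : ℝ)..t, y * starRingEnd ℂ (obsFun S 0 s (hat (Δ f)) p) =
      y * starRingEnd ℂ (obsFun S 0 t (hat f) p) -
        y * starRingEnd ℂ ((Ico 0 t ×ˢ S).indicator (fun q => f q.2) p) := by
  have hcongr : ∀ (g : 𝓢(E d, ℂ)) (s : ℝ), obsFun S 0 s (hat g) p =
      (Ico 0 s ×ˢ S).indicator (fun q => heatFlow (s - q.1) (𝓕 g : 𝓢(E d, ℂ)) q.2) p := fun g s => by
    rw [obsFun]; congr 1; ext q; rw [heatFlow_congr_ae (coeFn_hat g)]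
  simp_rw [hcongr]
  obtain ⟨σ, x⟩ := p
  by_cases hx : x ∈ S ∧ 0 ≤ σ
  swap
  · have : ∀ s : ℝ, (σ, x) ∉ Ico 0 s ×ˢ S := fun s h => hx ⟨h.2, h.1.1⟩
    simp [indicator_of_notMem (this _)]
  by_cases hσ : σ < t
  swap
  · have : ∀ s ≤ t, (σ, x) ∉ Ico 0 s ×ˢ S := fun s hs h => hσ (h.1.2.trans_le hs)
    rw [indicator_of_notMem (this t le_rfl), indicator_of_notMem (this t le_rfl)]
    rw [intervalIntegral.integral_congr (g := fun _ => 0) fun s hs => ?_]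
    · simp
    · rw [uIcc_of_le ht] at hs
      simp [indicator_of_notMem (this s hs.2)]
  have hmem : (σ, x) ∈ Ico 0 t ×ˢ S := ⟨⟨hx.2, hσ⟩, hx.1⟩
  rw [indicator_of_mem hmem, indicator_of_mem hmem]
  simp only
  rw [heatFlow_fourier_schwartz f (sub_nonneg.2 hσ.le) x, map_add, mul_add, add_sub_cancel_left]
  have hzero : (fun s => y * starRingEnd ℂ ((Ico 0 s ×ˢ S).indicator
      (fun q => heatFlow (s - q.1) (𝓕 (Δ f) : 𝓢(E d, ℂ)) q.2) (σ, x))) =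
      (Ioi σ).indicator fun s => y * starRingEnd ℂ (heatFlow (s - σ) (𝓕 (Δ f) : 𝓢(E d, ℂ)) x) := by
    ext s
    by_cases hs : σ < s
    · rw [indicator_of_mem (show (σ, x) ∈ Ico 0 s ×ˢ S from ⟨⟨hx.2, hs⟩, hx.1⟩),
        indicator_of_mem (show s ∈ Ioi σ from hs)]
    · rw [indicator_of_notMem fun h => hs h.1.2, indicator_of_notMem (show s ∉ Ioi σ from hs)]
      simp
  have hinter : Ioi σ ∩ Ioc 0 t = Ioc σ t := by
    ext s; constructor
    · rintro ⟨h1, h2⟩; exact ⟨h1, h2.2⟩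
    · rintro ⟨h1, h2⟩; exact ⟨h1, hx.2.trans_lt h1, h2⟩
  rw [hzero, intervalIntegral.integral_of_le ht, integral_indicator measurableSet_Ioi,
    Measure.restrict_restrict measurableSet_Ioi, hinter, ← intervalIntegral.integral_of_le hσ.le,
    intervalIntegral.integral_const_mul, intervalIntegral.integral_comp_sub_right
      (fun r => starRingEnd ℂ (heatFlow r (𝓕 (Δ f) : 𝓢(E d, ℂ)) x)), sub_self]
  congr 1
  rw [intervalIntegral.integral_of_le (sub_nonneg.2 hσ.le),
    intervalIntegral.integral_of_le (sub_nonneg.2 hσ.le), integral_conj]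

theorem integrable_obsFun_mul (hS : MeasurableSet S) {T t : ℝ} (ht : 0 ≤ t) (z : CL2 d)
    (v : Lp ℂ 2 (slab d T)) :
    Integrable (Function.uncurry fun (s : ℝ) (p : ℝ × E d) =>
      v p * starRingEnd ℂ (obsFun S 0 s z p))
      (((volume : Measure ℝ).restrict (uIoc 0 t)).prod (slab d T)) := by
  have : IsFiniteMeasure ((volume : Measure ℝ).restrict (uIoc 0 t)) :=
    ⟨by rw [uIoc_of_le ht]; simp⟩
  have hv : MemLp (fun q : ℝ × ℝ × E d => v q.2) 2
      (((volume : Measure ℝ).restrict (uIoc 0 t)).prod (slab d T)) := (Lp.memLp v).comp_snd _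
  have hm : StronglyMeasurable fun q : ℝ × ℝ × E d => obsFun S 0 q.1 z q.2 := by
    have e : (fun q : ℝ × ℝ × E d => obsFun S 0 q.1 z q.2) =
        {q : ℝ × ℝ × E d | 0 ≤ q.2.1 ∧ q.2.1 < q.1 ∧ q.2.2 ∈ S}.indicator
          fun q => heatFlow (q.1 - q.2.1) z q.2.2 := by
      ext q
      by_cases hq : 0 ≤ q.2.1 ∧ q.2.1 < q.1 ∧ q.2.2 ∈ S
      · rw [indicator_of_mem (by exact hq), obsFun, indicator_of_mem]
        exact ⟨⟨hq.1, hq.2.1⟩, hq.2.2⟩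
      · rw [indicator_of_notMem (by exact hq), obsFun, indicator_of_notMem]
        exact fun h => hq ⟨h.1.1, h.1.2, h.2⟩
    rw [e]
    have hc : Measurable fun q : ℝ × ℝ × E d => (q.1 - q.2.1, q.2.2) := by fun_prop
    refine ((stronglyMeasurable_heatFlow z).comp_measurable hc).indicator ?_
    have hσ : Measurable fun q : ℝ × ℝ × E d => q.2.1 := by fun_prop
    have hx : Measurable fun q : ℝ × ℝ × E d => q.2.2 := by fun_prop
    exact (measurableSet_le measurable_const hσ).inter
      ((measurableSet_lt hσ measurable_fst).inter (hx hS))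
  have ho : MemLp (fun q : ℝ × ℝ × E d => obsFun S 0 q.1 z q.2) 2
      (((volume : Measure ℝ).restrict (uIoc 0 t)).prod (slab d T)) := by
    refine memLp_two_of_lintegral_lt_top hm.aestronglyMeasurable ?_
    rw [lintegral_prod _ (hm.measurable.enorm.pow_const 2).aemeasurable]
    calc _ ≤ ∫⁻ s in uIoc 0 t, ENNReal.ofReal t * ‖z‖ₑ ^ 2 := by
          refine setLIntegral_mono' measurableSet_uIoc fun s hs => ?_
          rw [uIoc_of_le ht] at hs
          refine (lintegral_obsFun_sq_le hS T 0 s z).trans ?_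
          gcongr
          rw [sub_zero]; exact hs.2
      _ < ⊤ := by
          rw [setLIntegral_const, uIoc_of_le ht, Real.volume_Ioc]
          finiteness
  exact hv.integrable_mul ho.star

theorem inner_obsOp (hS : MeasurableSet S) (T a t : ℝ) (z : CL2 d) (v : Lp ℂ 2 (slab d T)) :
    inner ℂ (obsOp hS T a t z) v = ∫ p, v p * starRingEnd ℂ (obsFun S a t z p) ∂slab d T := by
  rw [L2.inner_def]
  refine integral_congr_ae ((coeFn_obsOp hS T a t z).mono fun p hp => ?_)
  simp only [hp, RCLike.inner_apply]

theorem inner_obsOp_hat (hS : MeasurableSet S) {T t : ℝ} (ht : 0 ≤ t) (f : 𝓢(E d, ℂ))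
    (v : Lp ℂ 2 (slab d T)) :
    inner ℂ (obsOp hS T 0 t (hat f)) v =
      (∫ s in (0 : ℝ)..t, inner ℂ (obsOp hS T 0 s (hat (Δ f))) v) +
      ∫ p, v p * starRingEnd ℂ ((Ico 0 t ×ˢ S).indicator (fun q => f q.2) p) ∂slab d T := by
  simp_rw [inner_obsOp]
  rw [intervalIntegral_integral_swap (integrable_obsFun_mul hS ht (hat (Δ f)) v)]
  simp_rw [obsFun_fourier_schwartz f ht]
  have h1 : Integrable (fun p => v p * starRingEnd ℂ (obsFun S 0 t (hat f) p)) (slab d T) :=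
    (Lp.memLp v).integrable_mul (memLp_obsFun hS T 0 t (hat f)).star
  have h2 : MemLp (fun p : ℝ × E d => (Ico 0 t ×ˢ S).indicator (fun q => f q.2) p) 2 (slab d T) :=
    MemLp.indicator (measurableSet_Ico.prod hS) ((f.memLp 2 volume).comp_snd _)
  have h3 : Integrable (fun p => v p * starRingEnd ℂ ((Ico 0 t ×ˢ S).indicator
      (fun q => f q.2) p)) (slab d T) := (Lp.memLp v).integrable_mul h2.star
  rw [integral_sub h1 h3, sub_add_cancel]

/-- The solution operator of the controlled heat equation on the Fourier side, for zero initial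
data. -/
def duhamel (hS : MeasurableSet S) (T t : ℝ) (v : Lp ℂ 2 (slab d T)) : CL2 d :=
  ContinuousLinearMap.adjoint (obsOp hS T 0 t) v

theorem inner_duhamel (hS : MeasurableSet S) (T t : ℝ) (v : Lp ℂ 2 (slab d T)) (z : CL2 d) :
    inner ℂ z (duhamel hS T t v) = inner ℂ (obsOp hS T 0 t z) v :=
  ContinuousLinearMap.adjoint_inner_right _ _ _

theorem norm_duhamel_sub_le (hS : MeasurableSet S) (T : ℝ) {s t : ℝ} (hs : 0 ≤ s) (hst : s ≤ t)
    (v : Lp ℂ 2 (slab d T)) :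
    ‖duhamel hS T t v - heatOp (t - s) (duhamel hS T s v)‖ ≤ √(t - s) * ‖v‖ := by
  have e : duhamel hS T t v - heatOp (t - s) (duhamel hS T s v) =
      ContinuousLinearMap.adjoint (obsOp hS T s t) v := by
    refine ext_inner_left ℂ fun z => ?_
    rw [inner_sub_right, inner_duhamel, ← inner_heatOp_left (sub_nonneg.2 hst), inner_duhamel,
      ContinuousLinearMap.adjoint_inner_right, obsOp_eq_add hS T hs hst, inner_add_left,
      add_sub_cancel_right]
  rw [e]
  refine (ContinuousLinearMap.le_opNorm _ _).trans ?_
  gcongr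
  rw [LinearIsometryEquiv.norm_map]
  exact ContinuousLinearMap.opNorm_le_bound _ (Real.sqrt_nonneg _) fun z => norm_obsOp_le hS T s t z

theorem continuousOn_duhamel (hS : MeasurableSet S) (T : ℝ) (v : Lp ℂ 2 (slab d T)) :
    ContinuousOn (fun t => duhamel hS T t v) (Ici 0) := by
  intro t₀ ht₀
  refine continuousWithinAt_of_locally_uniform_approx_of_continuousWithinAt ht₀ fun u hu => ?_
  obtain ⟨ε, hε, hu⟩ := Metric.mem_uniformity_dist.1 hu
  obtain ⟨δ, hδ, hδε⟩ : ∃ δ : ℝ, 0 < δ ∧ √(2 * δ) * ‖v‖ < ε := by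
    have hc : ContinuousAt (fun δ : ℝ => √(2 * δ) * ‖v‖) 0 := by fun_prop
    have := hc.eventually_lt (continuousAt_const (y := ε)) (by simpa using hε)
    obtain ⟨δ, h1, h2⟩ :=
      ((this.filter_mono nhdsWithin_le_nhds).and (self_mem_nhdsWithin (s := Ioi (0 : ℝ)))).exists
    exact ⟨δ, h2, h1⟩
  -- Near `t₀`, the solution differs by at most √(2δ) ‖v‖ from the free evolution started at `s`,
  -- which is continuous in time.
  set s := max 0 (t₀ - δ) with hs
  refine ⟨Ici 0 ∩ Ioo (t₀ - δ) (t₀ + δ), Filter.inter_mem self_mem_nhdsWithin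
    (nhdsWithin_le_nhds (Ioo_mem_nhds (by linarith) (by linarith))),
    fun t => heatOp (t - s) (duhamel hS T s v), ?_, fun t ht => hu ?_⟩
  · exact ((continuous_heatOp _).comp (continuous_id.sub continuous_const)).continuousWithinAt
  · have hst : s ≤ t := max_le ht.1 ht.2.1.le
    rw [dist_eq_norm]
    refine (norm_duhamel_sub_le hS T (le_max_left _ _) hst v).trans_lt (lt_of_le_of_lt ?_ hδε)
    gcongr
    linarith [le_max_right 0 (t₀ - δ), ht.2.2]

/-- The solution of the controlled heat equation on the Fourier side. -/
def mildSolution (hS : MeasurableSet S) (T : ℝ) (y : CL2 d) (v : Lp ℂ 2 (slab d T)) (t : ℝ) :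
    CL2 d := heatOp t y + duhamel hS T t v

theorem continuousOn_mildSolution (hS : MeasurableSet S) (T : ℝ) (y : CL2 d)
    (v : Lp ℂ 2 (slab d T)) : ContinuousOn (mildSolution hS T y v) (Ici 0) :=
  (continuous_heatOp y).continuousOn.add (continuousOn_duhamel hS T v)

theorem inner_mildSolution (hS : MeasurableSet S) (T : ℝ) (y : CL2 d) (v : Lp ℂ 2 (slab d T))
    {t : ℝ} (ht : 0 ≤ t) (z : CL2 d) :
    inner ℂ z (mildSolution hS T y v t) =
      inner ℂ (heatOp t z) y + inner ℂ (obsOp hS T 0 t z) v := by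
  rw [mildSolution, inner_add_right, inner_duhamel, inner_heatOp_left ht]

/-- The weak formulation, tested against Schwartz functions. -/
theorem inner_hat_mildSolution (hS : MeasurableSet S) (T : ℝ) (y : CL2 d)
    (v : Lp ℂ 2 (slab d T)) {t : ℝ} (ht : 0 ≤ t) (f : 𝓢(E d, ℂ)) :
    inner ℂ (hat f) (mildSolution hS T y v t) = inner ℂ (hat f) y +
      (∫ s in (0 : ℝ)..t, inner ℂ (hat (Δ f)) (mildSolution hS T y v s)) +
      ∫ p, v p * starRingEnd ℂ ((Ico 0 t ×ˢ S).indicator (fun q => f q.2) p) ∂slab d T := by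
  have hsum : ∫ s in (0 : ℝ)..t, inner ℂ (hat (Δ f)) (mildSolution hS T y v s) =
      (∫ s in (0 : ℝ)..t, inner ℂ (heatOp s (hat (Δ f))) y) +
      ∫ s in (0 : ℝ)..t, inner ℂ (obsOp hS T 0 s (hat (Δ f))) v := by
    rw [← intervalIntegral.integral_add]
    · refine intervalIntegral.integral_congr fun s hs => ?_
      rw [uIcc_of_le ht] at hs
      exact inner_mildSolution hS T y v hs.1 _
    · exact Continuous.intervalIntegrable ((continuous_heatOp _).inner continuous_const) _ _
    · simp_rw [← inner_duhamel]
      refine ContinuousOn.intervalIntegrable (continuousOn_const.inner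
        ((continuousOn_duhamel hS T v).mono fun s hs => ?_))
      rw [uIcc_of_le ht] at hs
      exact hs.1
  rw [inner_mildSolution hS T y v ht, inner_heatOp_hat f y ht, inner_obsOp_hat hS ht, hsum]
  ring

end

/-! ### Back to physical space: weak solutions and real parts. -/

section

variable {d : ℕ} {S : Set (E d)}

/-- A real test function as a complex Schwartz function. -/
def testFun {φ : E d → ℝ} (hφ : ContDiff ℝ ∞ φ) (hc : HasCompactSupport φ) : 𝓢(E d, ℂ) :=
  (show HasCompactSupport (Complex.ofRealCLM ∘ φ) from hc.comp_left rfl).toSchwartzMap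
    (Complex.ofRealCLM.contDiff.comp hφ)

theorem testFun_apply {φ : E d → ℝ} (hφ : ContDiff ℝ ∞ φ) (hc : HasCompactSupport φ) (x : E d) :
    testFun hφ hc x = φ x := rfl

theorem laplacian_testFun_apply {φ : E d → ℝ} (hφ : ContDiff ℝ ∞ φ) (hc : HasCompactSupport φ)
    (x : E d) : (Δ (testFun hφ hc) : 𝓢(E d, ℂ)) x = (((Δ φ) x : ℝ) : ℂ) := by
  rw [SchwartzMap.laplacian_apply]
  exact ContDiffAt.laplacian_CLM_comp_left (l := Complex.ofRealCLM)
    ((hφ.of_le (WithTop.coe_le_coe.2 le_top)).contDiffAt)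

theorem inner_hat (f : 𝓢(E d, ℂ)) (g : CL2 d) :
    inner ℂ (hat f) g = ∫ x, (𝓕⁻ g : CL2 d) x * starRingEnd ℂ (f x) := by
  have h1 : hat f = 𝓕 (f.toLp 2 volume) := (SchwartzMap.toLp_fourier_eq f).symm
  have h2 : g = 𝓕 (𝓕⁻ g : CL2 d) := (FourierTransform.fourier_fourierInv_eq g).symm
  conv_lhs => rw [h1, h2]
  rw [Lp.inner_fourier_eq, L2.inner_def]
  refine integral_congr_ae ((f.coeFn_toLp 2 volume).mono fun x hx => ?_)
  simp only [hx, RCLike.inner_apply]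

theorem inner_hat_testFun {φ : E d → ℝ} (hφ : ContDiff ℝ ∞ φ) (hc : HasCompactSupport φ)
    (g : CL2 d) : inner ℂ (hat (testFun hφ hc)) g = ∫ x, (𝓕⁻ g : CL2 d) x * (φ x : ℂ) := by
  rw [inner_hat]
  simp_rw [testFun_apply, Complex.conj_ofReal]

theorem inner_hat_laplacian_testFun {φ : E d → ℝ} (hφ : ContDiff ℝ ∞ φ)
    (hc : HasCompactSupport φ) (g : CL2 d) :
    inner ℂ (hat (Δ (testFun hφ hc))) g = ∫ x, (𝓕⁻ g : CL2 d) x * ((Δ φ) x : ℂ) := by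
  rw [inner_hat]
  simp_rw [laplacian_testFun_apply, Complex.conj_ofReal]

theorem memLp_testFun {φ : E d → ℝ} (hφ : ContDiff ℝ ∞ φ) (hc : HasCompactSupport φ) :
    MemLp φ 2 volume := hφ.continuous.memLp_of_hasCompactSupport hc

theorem memLp_laplacian {φ : E d → ℝ} (hφ : ContDiff ℝ ∞ φ) (hc : HasCompactSupport φ) :
    MemLp (Δ φ) 2 volume := by
  have h : MemLp (fun x => (((Δ φ) x : ℝ) : ℂ)) 2 volume := by
    simp_rw [← laplacian_testFun_apply hφ hc]
    exact (Δ (testFun hφ hc) : 𝓢(E d, ℂ)).memLp 2 volume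
  exact h.re

variable {F : Type*} [NormedAddCommGroup F] [NormedSpace ℝ F]

theorem integrable_indicator_smul (hS : MeasurableSet S) {T : ℝ} (t : ℝ)
    {φ : E d → ℝ} (hφ : MemLp φ 2 volume) {v : ℝ × E d → F} (hv : MemLp v 2 (slab d T)) :
    Integrable (fun p => (Ico 0 t ×ˢ S).indicator (fun q => φ q.2) p • v p) (slab d T) := by
  have h2 : MemLp (fun p : ℝ × E d => (Ico 0 t ×ˢ S).indicator (fun q => φ q.2) p) 2 (slab d T) :=
    MemLp.indicator (measurableSet_Ico.prod hS) (hφ.comp_snd _)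
  exact memLp_one_iff_integrable.1 (hv.smul h2)

theorem integral_indicator_smul (hS : MeasurableSet S) {T t : ℝ} (ht : t ∈ Icc 0 T)
    {φ : E d → ℝ} (hφ : MemLp φ 2 volume) {v : ℝ × E d → F} (hv : MemLp v 2 (slab d T)) :
    ∫ p, (Ico 0 t ×ˢ S).indicator (fun q => φ q.2) p • v p ∂slab d T =
      ∫ s in (0 : ℝ)..t, ∫ x, φ x • S.indicator (fun y => v (s, y)) x := by
  rw [integral_prod _ (integrable_indicator_smul hS t hφ hv)]
  have e : ∀ s : ℝ, ∫ x, (Ico 0 t ×ˢ S).indicator (fun q : ℝ × E d => φ q.2) (s, x) • v (s, x) =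
      (Ico 0 t).indicator (fun s => ∫ x, φ x • S.indicator (fun y => v (s, y)) x) s := by
    intro s
    by_cases hs : s ∈ Ico 0 t
    · rw [indicator_of_mem hs]
      congr 1; ext x
      by_cases hx : x ∈ S
      · rw [indicator_of_mem (show (s, x) ∈ Ico 0 t ×ˢ S from ⟨hs, hx⟩), indicator_of_mem hx]
      · rw [indicator_of_notMem (show (s, x) ∉ Ico 0 t ×ˢ S from fun h => hx h.2), indicator_of_notMem hx]; simp
    · rw [indicator_of_notMem hs]
      have h0 : ∀ x : E d, (s, x) ∉ Ico 0 t ×ˢ S := fun x h => hs h.1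
      simp_rw [indicator_of_notMem (h0 _), zero_smul, integral_zero]
  simp_rw [e]
  rw [integral_indicator measurableSet_Ico, Measure.restrict_restrict measurableSet_Ico,
    inter_eq_left.2 ((Ico_subset_Icc_self).trans (Icc_subset_Icc_right ht.2)),
    intervalIntegral.integral_of_le ht.1, restrict_Ico_eq_restrict_Ioc]

/-- The weak formulation in physical space, for complex solutions. -/
theorem mildSolution_weak (hS : MeasurableSet S) {T : ℝ} (y : CL2 d)
    (v : Lp ℂ 2 (slab d T)) {t : ℝ} (ht : t ∈ Icc 0 T) {φ : E d → ℝ} (hφ : ContDiff ℝ ∞ φ)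
    (hc : HasCompactSupport φ) :
    ∫ x, (𝓕⁻ (mildSolution hS T y v t) : CL2 d) x * (φ x : ℂ) =
      (∫ x, (𝓕⁻ y : CL2 d) x * (φ x : ℂ)) +
      (∫ s in (0 : ℝ)..t, ∫ x, (𝓕⁻ (mildSolution hS T y v s) : CL2 d) x * ((Δ φ) x : ℂ)) +
      ∫ p, (Ico 0 t ×ˢ S).indicator (fun q => φ q.2) p • v p ∂slab d T := by
  simp_rw [← inner_hat_testFun hφ hc, ← inner_hat_laplacian_testFun hφ hc]
  rw [inner_hat_mildSolution hS T y v ht.1]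
  congr 1
  refine integral_congr_ae (Filter.Eventually.of_forall fun p => ?_)
  by_cases hp : p ∈ Ico 0 t ×ˢ S
  · simp [hp, testFun_apply, mul_comm]
  · simp [hp]

/-- The real part on `L²`. -/
def reL2 : CL2 d →L[ℝ] L2 d := Complex.reCLM.compLpL 2 volume

theorem coeFn_reL2 (g : CL2 d) : reL2 g =ᵐ[volume] fun x => (g x).re :=
  ContinuousLinearMap.coeFn_compLpL _ _

/-- The embedding of real into complex `L²`. -/
def ofRealL2 : L2 d →L[ℝ] CL2 d := Complex.ofRealCLM.compLpL 2 volume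

theorem coeFn_ofRealL2 (g : L2 d) : ofRealL2 g =ᵐ[volume] fun x => (g x : ℂ) :=
  ContinuousLinearMap.coeFn_compLpL _ _

theorem integral_reL2_mul (g : CL2 d) {φ : E d → ℝ} (hφ : MemLp φ 2 volume) :
    ∫ x, reL2 g x * φ x = (∫ x, g x * (φ x : ℂ)).re := by
  have hint : Integrable fun x => g x * (φ x : ℂ) := (Lp.memLp g).integrable_mul hφ.ofReal
  rw [← Complex.reCLM_apply, ← ContinuousLinearMap.integral_comp_comm _ hint]
  refine integral_congr_ae ((coeFn_reL2 g).mono fun x hx => ?_)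
  simp [hx]

theorem integral_ofRealL2_mul (g : L2 d) (φ : E d → ℝ) :
    ∫ x, ofRealL2 g x * (φ x : ℂ) = ((∫ x, g x * φ x : ℝ) : ℂ) := by
  rw [← integral_complex_ofReal]
  refine integral_congr_ae ((coeFn_ofRealL2 g).mono fun x hx => ?_)
  simp [hx]

/-- The real part of the mild solution solves the controlled heat equation. -/
theorem isSolution_reL2_mildSolution (hS : MeasurableSet S) {T : ℝ} (u₀ : L2 d)
    (v : Lp ℂ 2 (slab d T)) :
    IsSolution S T u₀ (fun p => (v p).re)
      fun t => reL2 (𝓕⁻ (mildSolution hS T (𝓕 (ofRealL2 u₀)) v t) : CL2 d) := by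
  set w := mildSolution hS T (𝓕 (ofRealL2 u₀)) v with hw
  have hwc : ContinuousOn w (Icc 0 T) :=
    (continuousOn_mildSolution hS T _ v).mono Icc_subset_Ici_self
  refine ⟨?_, fun φ hφ hc t ht => ?_⟩
  · exact reL2.continuous.comp_continuousOn
      ((Lp.fourierTransformₗᵢ (E d) ℂ).symm.continuous.comp_continuousOn hwc)
  · have key := congrArg Complex.re (mildSolution_weak hS (𝓕 (ofRealL2 u₀)) v ht hφ hc)
    rw [← hw, Complex.add_re, Complex.add_re, FourierTransform.fourierInv_fourier_eq,
      integral_ofRealL2_mul, Complex.ofReal_re, ← integral_reL2_mul _ (memLp_testFun hφ hc)] at key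
    rw [key]
    congr 2
    · simp_rw [integral_reL2_mul _ (memLp_laplacian hφ hc),
        ← inner_hat_laplacian_testFun hφ hc, ← Complex.reCLM_apply]
      refine (ContinuousLinearMap.intervalIntegral_comp_comm _ ?_).symm
      refine ContinuousOn.intervalIntegrable (continuousOn_const.inner (hwc.mono ?_))
      rw [uIcc_of_le ht.1]
      exact Icc_subset_Icc_right ht.2
    · have hvr : MemLp (fun p => (v p).re) 2 (slab d T) := (Lp.memLp v).re
      have h := integral_indicator_smul hS ht (memLp_testFun hφ hc) hvr
      simp_rw [smul_eq_mul, mul_comm (φ _)] at h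
      rw [← h, ← Complex.reCLM_apply, ← ContinuousLinearMap.integral_comp_comm _
        (integrable_indicator_smul hS t (memLp_testFun hφ hc) (Lp.memLp v))]
      simp

end

/-! ### Observability gives controls: the duality argument. -/

section

variable {d : ℕ} {S : Set (E d)}

/-- A functional dominated by `c ‖B z‖` factors through `B` with a representer of norm at most
`c`. -/
theorem exists_inner_eq_of_norm_le {H K : Type*} [NormedAddCommGroup H] [NormedSpace ℂ H]
    [NormedAddCommGroup K] [InnerProductSpace ℂ K] [CompleteSpace K] (B : H →ₗ[ℂ] K)
    (ℓ : H →ₗ[ℂ] ℂ) {c : ℝ} (hc : 0 ≤ c) (h : ∀ z, ‖ℓ z‖ ≤ c * ‖B z‖) :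
    ∃ v : K, ‖v‖ ≤ c ∧ ∀ z, inner ℂ v (B z) = ℓ z := by
  have hker : LinearMap.ker B ≤ LinearMap.ker ℓ := fun z hz => by
    have := h z
    rw [LinearMap.mem_ker.1 hz, norm_zero, mul_zero] at this
    exact norm_le_zero_iff.1 this
  set g : LinearMap.range B →ₗ[ℂ] ℂ :=
    ((LinearMap.ker B).liftQ ℓ hker).comp B.quotKerEquivRange.symm.toLinearMap with hg
  have hgB : ∀ z, g ⟨B z, z, rfl⟩ = ℓ z := by
    intro z
    have : B.quotKerEquivRange.symm ⟨B z, z, rfl⟩ = (LinearMap.ker B).mkQ z := by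
      rw [LinearEquiv.symm_apply_eq]; rfl
    rw [hg, LinearMap.comp_apply, LinearEquiv.coe_coe, this]
    simp
  have hbound : ∀ k, ‖g k‖ ≤ c * ‖k‖ := by
    rintro ⟨_, z, rfl⟩
    rw [hgB]; exact h z
  -- The range of `B` need not be closed; Hahn–Banach extends the functional to all of `K` without
  -- increasing its norm, so Riesz applies.
  obtain ⟨G, hG, hGn⟩ := exists_extension_norm_eq (LinearMap.range B) (g.mkContinuous c hbound)
  refine ⟨(InnerProductSpace.toDual ℂ K).symm G, ?_, fun z => ?_⟩
  · rw [LinearIsometryEquiv.norm_map, hGn]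
    exact LinearMap.mkContinuous_norm_le _ hc _
  · rw [InnerProductSpace.toDual_symm_apply, hG ⟨B z, z, rfl⟩, LinearMap.mkContinuous_apply, hgB]

theorem norm_ofRealL2 (u : L2 d) : ‖ofRealL2 u‖ = ‖u‖ :=
  le_antisymm
    (Lp.norm_le_norm_of_ae_le ((coeFn_ofRealL2 u).mono fun x hx => by rw [hx]; simp))
    (Lp.norm_le_norm_of_ae_le ((coeFn_ofRealL2 u).mono fun x hx => by rw [hx]; simp))

/-- Observability implies the existence of a steering control with norm control. -/
theorem exists_steersToZero (hS : MeasurableSet S) {T C : ℝ} (hT : 0 < T) (hC : 0 ≤ C)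
    (h : ∀ z, ‖heatOp T z‖ ≤ C * ‖obsOp hS T 0 T z‖) (u₀ : L2 d) :
    ∃ v, SteersToZero S T u₀ v ∧ eLpNorm v 2 (slab d T) ≤ ENNReal.ofReal (C * ‖u₀‖) := by
  set y : CL2 d := 𝓕 (ofRealL2 u₀) with hy
  have hyn : ‖y‖ = ‖u₀‖ := by rw [hy, Lp.norm_fourier_eq, norm_ofRealL2]
  obtain ⟨v, hv, hvz⟩ := exists_inner_eq_of_norm_le (obsOp hS T 0 T).toLinearMap
    -- The sign makes the controlled part cancel the free evolution of `y` at time `T`.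
    (-((innerSL ℂ y).comp (heatOp T)).toLinearMap) (c := C * ‖u₀‖) (by positivity) fun z => by
      simp only [LinearMap.neg_apply, norm_neg, ContinuousLinearMap.coe_coe,
        ContinuousLinearMap.comp_apply, innerSL_apply_apply]
      calc _ ≤ ‖y‖ * ‖heatOp T z‖ := norm_inner_le_norm _ _
        _ ≤ ‖y‖ * (C * ‖obsOp hS T 0 T z‖) := by gcongr; exact h z
        _ = _ := by rw [hyn]; ring
  have hzero : mildSolution hS T y v T = 0 := by
    refine ext_inner_left ℂ fun z => ?_
    have := congrArg (starRingEnd ℂ) (hvz z)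
    simp only [LinearMap.neg_apply, ContinuousLinearMap.coe_coe, ContinuousLinearMap.comp_apply,
      innerSL_apply_apply, map_neg, inner_conj_symm] at this
    rw [inner_mildSolution hS T y v hT.le, this, add_neg_cancel, inner_zero_right]
  refine ⟨fun p => (v p).re, ⟨(Lp.memLp v).re, _, isSolution_reL2_mildSolution hS u₀ v, ?_⟩, ?_⟩
  · rw [← hy, hzero]
    have : (𝓕⁻ (0 : CL2 d) : CL2 d) = 0 := map_zero (Lp.fourierTransformₗᵢ (E d) ℂ).symm
    rw [this, map_zero]
  · calc _ ≤ eLpNorm v 2 (slab d T) := eLpNorm_mono fun p => by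
          rw [Real.norm_eq_abs]; exact Complex.abs_re_le_norm _
      _ = ENNReal.ofReal ‖v‖ := by rw [Lp.norm_def, ENNReal.ofReal_toReal (Lp.eLpNorm_ne_top v)]
      _ ≤ _ := ENNReal.ofReal_le_ofReal hv

theorem norm_heatOp_le_of_spectralInequality (hS : MeasurableSet S) {d₀ d₁ T : ℝ}
    (h : SpectralInequality S d₀ d₁) (hd₀ : 1 ≤ d₀) (hd₁ : 0 ≤ d₁) (hT : 0 < T) (z : CL2 d) :
    ‖heatOp T z‖ ≤ √(48 * d₀ ^ 4 * Real.exp ((3 * d₁ ^ 2 + 1) / T)) * ‖obsOp hS T 0 T z‖ := by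
  refine norm_le_of_enorm_sq_le (norm_nonneg _) ?_
  rw [ofReal_norm, enorm_obsOp_zero_sq]
  exact observability_of_spectralInequality h hd₀ hd₁ hT z

theorem controlCost_le (hS : MeasurableSet S) {T C : ℝ} (hT : 0 < T) (hC : 0 ≤ C)
    (h : ∀ z, ‖heatOp T z‖ ≤ C * ‖obsOp hS T 0 T z‖) : controlCost S T ≤ ENNReal.ofReal C := by
  refine iSup₂_le fun u₀ hu₀ => ?_
  obtain ⟨v, hv, hvn⟩ := exists_steersToZero hS hT hC h u₀
  refine (iInf₂_le v hv).trans (le_trans ?_ (hvn.trans_eq (by rw [hu₀, mul_one])))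
  exact eLpNorm_mono_measure _ (Measure.prod_mono le_rfl Measure.restrict_le_self)

end

/-! ### Uniqueness of weak solutions. -/

section

variable {d : ℕ} {S : Set (E d)}

theorem fourier_eq_exp_phase (f : E d → ℂ) (ξ : E d) :
    𝓕 f ξ = ∫ x, Complex.exp (-phase ξ x) * f x := by
  rw [Real.fourier_eq']
  congr 1; ext x
  rw [phase, smul_eq_mul]
  congr 2
  push_cast; ring

theorem fourier_testFun_translate {φ : E d → ℝ} (hφ : ContDiff ℝ ∞ φ) (hc : HasCompactSupport φ)
    (y ξ : E d) (hφy : ContDiff ℝ ∞ fun x => φ (x - y)) (hcy : HasCompactSupport fun x => φ (x - y)) :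
    (𝓕 (testFun hφy hcy) : 𝓢(E d, ℂ)) ξ =
      Complex.exp (-phase y ξ) * (𝓕 (testFun hφ hc) : 𝓢(E d, ℂ)) ξ := by
  rw [SchwartzMap.fourier_coe, SchwartzMap.fourier_coe, fourier_eq_exp_phase, fourier_eq_exp_phase,
    ← integral_const_mul,
    ← integral_sub_right_eq_self (fun x => Complex.exp (-phase y ξ) *
      (Complex.exp (-phase ξ x) * testFun hφ hc x)) y]
  congr 1; ext x
  rw [testFun_apply, testFun_apply, ← mul_assoc, ← Complex.exp_add]
  congr 2
  simp only [phase, inner_sub_left, real_inner_comm]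
  push_cast; ring

theorem exists_testFun_fourier_ne_zero (d : ℕ) {r : ℝ} (hr : 0 < r) :
    ∃ (φ : E d → ℝ) (hφ : ContDiff ℝ ∞ φ) (hc : HasCompactSupport φ),
      ∀ ξ : E d, ‖ξ‖ < r → (𝓕 (testFun hφ hc) : 𝓢(E d, ℂ)) ξ ≠ 0 := by
  -- For a bump of integral 1 supported within ρ of 0, the transform differs from 1 by at most
  -- 2πρ‖ξ‖, which is less than 1 for ‖ξ‖ < r.
  set ρ : ℝ := 1 / (2 * Real.pi * r) with hρ
  have hρ0 : 0 < ρ := by positivity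
  let b : ContDiffBump (0 : E d) := ⟨ρ / 2, ρ, by positivity, by linarith⟩
  refine ⟨b.normed volume, b.contDiff_normed, b.hasCompactSupport_normed, fun ξ hξ h0 => ?_⟩
  have hint : Integrable (fun x => (b.normed volume x : ℂ)) := b.integrable_normed.ofReal
  have h1 : ∫ x, (b.normed volume x : ℂ) = 1 := by
    rw [integral_complex_ofReal, b.integral_normed, Complex.ofReal_one]
  rw [SchwartzMap.fourier_coe, fourier_eq_exp_phase] at h0
  have hint' : Integrable fun x => Complex.exp (-phase ξ x) * (b.normed volume x : ℂ) := by
    have hph : Continuous fun x => Complex.exp (-phase ξ x) := by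
      have := (continuous_phase (d := d)).comp (Continuous.prodMk_right ξ)
      exact Complex.continuous_exp.comp this.neg
    refine hint.mono (hph.aestronglyMeasurable.mul hint.1) (Filter.Eventually.of_forall fun x => ?_)
    rw [norm_mul, show -phase ξ x = ((-(2 * Real.pi * inner ℝ x ξ) : ℝ) : ℂ) * Complex.I by
      rw [phase]; push_cast; ring, Complex.norm_exp_ofReal_mul_I, one_mul]
  have hdiff : ∫ x, (Complex.exp (-phase ξ x) * (b.normed volume x : ℂ) -
      (b.normed volume x : ℂ)) = -1 := by
    rw [integral_sub hint' hint, h1]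
    simp only [testFun_apply] at h0
    rw [h0, zero_sub]
  have hbound : ‖∫ x, (Complex.exp (-phase ξ x) * (b.normed volume x : ℂ) -
      (b.normed volume x : ℂ))‖ ≤ ∫ x, (2 * Real.pi * ρ * ‖ξ‖) * b.normed volume x := by
    refine norm_integral_le_of_norm_le (b.integrable_normed.const_mul _)
      (Filter.Eventually.of_forall fun x => ?_)
    rw [← sub_one_mul, norm_mul, Complex.norm_real, Real.norm_eq_abs,
      abs_of_nonneg (b.nonneg_normed x)]
    rcases eq_or_ne (b.normed volume x) 0 with hx | hx
    · simp [hx]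
    have hx' : ‖x‖ < ρ := by
      have : x ∈ Function.support (b.normed volume) := hx
      rw [b.support_normed_eq] at this
      simpa [b] using this
    refine mul_le_mul_of_nonneg_right ?_ (b.nonneg_normed x)
    have e : -phase ξ x = Complex.I * ((-(2 * Real.pi * inner ℝ x ξ) : ℝ) : ℂ) := by
      rw [phase]; push_cast; ring
    rw [e]
    refine Real.norm_exp_I_mul_ofReal_sub_one_le.trans ?_
    rw [Real.norm_eq_abs, abs_neg, abs_mul, abs_of_pos (by positivity : 0 < 2 * Real.pi),
      mul_assoc _ ρ]
    refine mul_le_mul_of_nonneg_left ((abs_real_inner_le_norm x ξ).trans ?_) (by positivity)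
    gcongr
  rw [hdiff, integral_const_mul, b.integral_normed, norm_neg, norm_one, mul_one, hρ] at hbound
  have : 2 * Real.pi * (1 / (2 * Real.pi * r)) * ‖ξ‖ = ‖ξ‖ / r := by field_simp
  rw [this, le_div_iff₀ hr] at hbound
  linarith

/-- The distributional identity `Δ h = g` in `L²`, on the Fourier side. -/
theorem ae_eq_of_forall_inner_hat {g h : CL2 d}
    (H : ∀ (φ : E d → ℝ) (hφ : ContDiff ℝ ∞ φ) (hc : HasCompactSupport φ),
      inner ℂ (hat (testFun hφ hc)) g = inner ℂ (hat (Δ (testFun hφ hc))) h) :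
    ∀ᵐ ξ, g ξ = -(symb ξ : ℂ) * h ξ := by
  have hint : ∀ (f : 𝓢(E d, ℂ)) (k : CL2 d),
      Integrable fun ξ => k ξ * starRingEnd ℂ ((𝓕 f : 𝓢(E d, ℂ)) ξ) := fun f k =>
    (Lp.memLp k).integrable_mul ((𝓕 f : 𝓢(E d, ℂ)).memLp 2 volume).star
  have hmem : ∀ (f : 𝓢(E d, ℂ)) (k : CL2 d),
      MemLp (fun ξ => k ξ * starRingEnd ℂ ((𝓕 f : 𝓢(E d, ℂ)) ξ)) 2 volume := fun f k =>
    MemLp.mul (p := 2) (q := ⊤) (r := 2) ((𝓕 f : 𝓢(E d, ℂ)).memLp ⊤ volume).star (Lp.memLp k)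
  have hpair : ∀ (f : 𝓢(E d, ℂ)) (k : CL2 d), inner ℂ (hat f) k =
      ∫ ξ, k ξ * starRingEnd ℂ ((𝓕 f : 𝓢(E d, ℂ)) ξ) := fun f k => by
    rw [L2.inner_def]
    refine integral_congr_ae ((coeFn_hat f).mono fun ξ hξ => ?_)
    simp only [hξ, RCLike.inner_apply]
  have key : ∀ (φ : E d → ℝ) (hφ : ContDiff ℝ ∞ φ) (hc : HasCompactSupport φ), ∀ᵐ ξ : E d,
      g ξ * starRingEnd ℂ ((𝓕 (testFun hφ hc) : 𝓢(E d, ℂ)) ξ) -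
        h ξ * starRingEnd ℂ ((𝓕 (Δ (testFun hφ hc)) : 𝓢(E d, ℂ)) ξ) = 0 := by
    intro φ hφ hc
    set G : E d → ℂ := fun ξ => g ξ * starRingEnd ℂ ((𝓕 (testFun hφ hc) : 𝓢(E d, ℂ)) ξ) -
        h ξ * starRingEnd ℂ ((𝓕 (Δ (testFun hφ hc)) : 𝓢(E d, ℂ)) ξ) with hG
    have hG1 : Integrable G := (hint _ _).sub (hint _ _)
    have hG2 : MemLp G 2 volume := (hmem _ _).sub (hmem _ _)
    -- Translating the test function by `y` multiplies its transform by a character, so the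
    -- hypothesis over all translates says that the inverse transform of `G` vanishes everywhere;
    -- Plancherel then gives G = 0.
    have hzero : ∀ y, 𝓕⁻ G y = 0 := by
      intro y
      have hφy : ContDiff ℝ ∞ fun x => φ (x - y) := hφ.comp (contDiff_id.sub contDiff_const)
      have hcy : HasCompactSupport fun x => φ (x - y) := by
        have := hc.comp_homeomorph (Homeomorph.subRight y)
        exact this
      have := H _ hφy hcy
      rw [hpair, hpair, ← sub_eq_zero, ← integral_sub (hint _ _) (hint _ _)] at this
      rw [fourierInv_eq_exp_phase, ← this]
      congr 1; ext ξ
      have hconj : starRingEnd ℂ (Complex.exp (-phase y ξ)) = Complex.exp (phase y ξ) := by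
        rw [← Complex.exp_conj, phase, map_neg, map_mul, Complex.conj_ofReal, Complex.conj_I,
          mul_neg, neg_neg]
      simp only [hG, fourier_laplacian_apply, fourier_testFun_translate hφ hc y ξ hφy hcy, map_mul,
        hconj]
      ring
    have h0 := lintegral_enorm_fourierInv_sq hG1 hG2
    simp only [hzero, enorm_zero] at h0
    rw [zero_pow two_ne_zero, lintegral_zero, eq_comm,
      lintegral_eq_zero_iff' (hG1.1.enorm.pow_const 2)] at h0
    filter_upwards [h0] with ξ hξ
    simpa using hξ
  -- A countable family whose transforms are nonzero on exhausting balls allows division at almost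
  -- every frequency.
  choose φ hφ hc hne using fun n : ℕ => exists_testFun_fourier_ne_zero d (r := n + 1) (by positivity)
  have hall := ae_all_iff.2 fun n => key (φ n) (hφ n) (hc n)
  filter_upwards [hall] with ξ hξ
  obtain ⟨n, hn⟩ := exists_nat_gt ‖ξ‖
  have hne' := hne n ξ (by linarith)
  have := hξ n
  rw [fourier_laplacian_apply, map_mul, map_neg, Complex.conj_ofReal] at this
  have hne'' : starRingEnd ℂ ((𝓕 (testFun (hφ n) (hc n)) : 𝓢(E d, ℂ)) ξ) ≠ 0 := by
    simpa using hne'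
  refine mul_right_cancel₀ hne'' ?_
  linear_combination this

/-- Energy estimate: a continuous primitive solving the heat equation vanishes. -/
theorem eq_zero_of_ae_eq_neg_symb_mul {T : ℝ} {q : ℝ → CL2 d} (hq : Continuous q)
    (h : ∀ t ∈ Icc 0 T, ∀ᵐ ξ, q t ξ = -(symb ξ : ℂ) * (∫ s in (0 : ℝ)..t, q s : CL2 d) ξ) :
    ∀ t ∈ Icc 0 T, q t = 0 := by
  -- The energy method is run on the primitive because `q` need not be differentiable in L², whereas
  -- W' = q, and the hypothesis makes Re ⟨W, q⟩ = -∫ symb |W|² nonpositive.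
  set W : ℝ → CL2 d := fun t => ∫ s in (0 : ℝ)..t, q s with hW
  have hd : ∀ t, HasDerivAt W (q t) t := fun t =>
    (hq.integral_hasStrictDerivAt 0 t).hasDerivAt
  have hN : ∀ t, HasDerivAt (fun t => RCLike.re (inner ℂ (W t) (W t)))
      (RCLike.re (inner ℂ (W t) (q t) + inner ℂ (q t) (W t))) t := fun t => by
    have := ((hd t).inner ℂ (hd t))
    exact (Complex.reCLM.hasFDerivAt.comp_hasDerivAt t this)
  have hanti : AntitoneOn (fun t => RCLike.re (inner ℂ (W t) (W t))) (Icc 0 T) := by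
    refine antitoneOn_of_deriv_nonpos (convex_Icc 0 T)
      (fun t _ => (hN t).continuousAt.continuousWithinAt)
      (fun t _ => (hN t).differentiableAt.differentiableWithinAt) fun t ht => ?_
    rw [interior_Icc] at ht
    rw [(hN t).deriv, map_add, inner_re_symm (𝕜 := ℂ) (q t) (W t)]
    have : RCLike.re (inner ℂ (W t) (q t)) ≤ 0 := by
      rw [L2.inner_def]
      change Complex.re _ ≤ 0
      have e : ∫ ξ, inner ℂ (W t ξ) (q t ξ) = ((∫ ξ, -(symb ξ) * ‖W t ξ‖ ^ 2 : ℝ) : ℂ) := by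
        rw [← integral_complex_ofReal]
        refine integral_congr_ae ((h t (Ioo_subset_Icc_self ht)).mono fun ξ hξ => ?_)
        simp only [hξ, RCLike.inner_apply]
        rw [mul_assoc, Complex.mul_conj, Complex.normSq_eq_norm_sq]
        push_cast; ring
      rw [e, Complex.ofReal_re]
      exact integral_nonpos fun ξ => by
        have := symb_nonneg ξ
        simp only [neg_mul, Pi.zero_apply, Left.neg_nonpos_iff]; positivity
    linarith
  intro t ht
  have hle := hanti (left_mem_Icc.2 (ht.1.trans ht.2)) ht ht.1
  have hW0 : W 0 = 0 := intervalIntegral.integral_same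
  simp only [hW0, inner_zero_left, map_zero] at hle
  have hWt : W t = 0 := by
    rw [inner_self_eq_norm_sq] at hle
    exact norm_eq_zero.1 (pow_eq_zero_iff two_ne_zero |>.1 (le_antisymm hle (sq_nonneg _)))
  have := h t ht
  change ∀ᵐ ξ, q t ξ = -(symb ξ : ℂ) * (W t) ξ at this
  rw [hWt] at this
  ext1
  filter_upwards [this, Lp.coeFn_zero ℂ 2 (volume : Measure (E d))] with ξ h1 h2
  rw [h1, h2]; simp

/-- Weak `L²` solutions of the heat equation with zero data vanish. -/
theorem eq_zero_of_weak {T : ℝ} (hT : 0 ≤ T) {w : ℝ → CL2 d} (hw : ContinuousOn w (Icc 0 T))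
    (h : ∀ (φ : E d → ℝ), ContDiff ℝ ∞ φ → HasCompactSupport φ → ∀ t ∈ Icc 0 T,
      ∫ x, w t x * (φ x : ℂ) = ∫ s in (0 : ℝ)..t, ∫ x, w s x * ((Δ φ) x : ℂ)) :
    ∀ t ∈ Icc 0 T, w t = 0 := by
  set q : ℝ → CL2 d := IccExtend hT ((Icc 0 T).domRestrict fun t => (𝓕 (w t) : CL2 d)) with hq
  have hqc : Continuous q := Continuous.Icc_extend' (continuousOn_iff_continuous_domRestrict.1
    ((Lp.fourierTransformₗᵢ (E d) ℂ).continuous.comp_continuousOn hw))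
  have hqt : ∀ t ∈ Icc 0 T, q t = 𝓕 (w t) := fun t ht => IccExtend_of_mem hT _ ht
  have hqi : ∀ t ∈ Icc 0 T, (𝓕⁻ (q t) : CL2 d) = w t := fun t ht => by
    rw [hqt t ht, FourierTransform.fourierInv_fourier_eq]
  have hz := eq_zero_of_ae_eq_neg_symb_mul (T := T) hqc fun t ht =>
    ae_eq_of_forall_inner_hat fun φ hφ hc => by
      have h1 := h φ hφ hc t ht
      have h2 : ∫ s in (0 : ℝ)..t, ∫ x, w s x * ((Δ φ) x : ℂ) =
          ∫ s in (0 : ℝ)..t, inner ℂ (hat (Δ (testFun hφ hc))) (q s) := by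
        refine intervalIntegral.integral_congr fun s hs => ?_
        rw [uIcc_of_le ht.1] at hs
        rw [inner_hat_laplacian_testFun hφ hc, hqi s ⟨hs.1, hs.2.trans ht.2⟩]
      rw [h2, ← hqi t ht, ← inner_hat_testFun hφ hc] at h1
      rw [h1]
      exact (innerSL ℂ (hat (Δ (testFun hφ hc)))).intervalIntegral_comp_comm
        (hqc.intervalIntegrable _ _)
  intro t ht
  rw [← hqi t ht, hz t ht]
  exact map_zero (Lp.fourierTransformₗᵢ (E d) ℂ).symm

end

/-! ### Null-controllability gives observability. -/

section

variable {d : ℕ} {S : Set (E d)}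

/-- A real weak solution is the mild solution. -/
theorem IsSolution.fourier_ofRealL2_eq (hS : MeasurableSet S) {T : ℝ} (hT : 0 ≤ T) {u₀ : L2 d}
    {v : ℝ × E d → ℝ} (hv : IsControl T v) {u : ℝ → L2 d} (hu : IsSolution S T u₀ v u) :
    ∀ t ∈ Icc 0 T, (𝓕 (ofRealL2 (u t)) : CL2 d) = mildSolution hS T (𝓕 (ofRealL2 u₀))
      ((MemLp.ofReal (K := ℂ) hv).toLp _) t := by
  set V : Lp ℂ 2 (slab d T) := (MemLp.ofReal (K := ℂ) hv).toLp _ with hV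
  set m := mildSolution hS T (𝓕 (ofRealL2 u₀)) V with hm
  have hmc : ContinuousOn m (Icc 0 T) :=
    (continuousOn_mildSolution hS T _ V).mono Icc_subset_Ici_self
  set q : ℝ → CL2 d := fun t => 𝓕 (ofRealL2 (u t)) with hq
  have hqc : ContinuousOn q (Icc 0 T) := (Lp.fourierTransformₗᵢ (E d) ℂ).continuous.comp_continuousOn
    (ofRealL2.continuous.comp_continuousOn hu.continuousOn)
  have hqi : ∀ t, (𝓕⁻ (q t) : CL2 d) = ofRealL2 (u t) := fun t =>
    FourierTransform.fourierInv_fourier_eq _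
  have hsub : ∀ t, q t - m t = 𝓕 (𝓕⁻ (q t - m t) : CL2 d) := fun t =>
    (FourierTransform.fourier_fourierInv_eq _).symm
  have hw : ContinuousOn (fun t => (𝓕⁻ (q t - m t) : CL2 d)) (Icc 0 T) :=
    (Lp.fourierTransformₗᵢ (E d) ℂ).symm.continuous.comp_continuousOn (hqc.sub hmc)
  have key := eq_zero_of_weak hT hw fun φ hφ hc t ht => by
    simp_rw [← inner_hat_testFun hφ hc, ← inner_hat_laplacian_testFun hφ hc, inner_sub_right]
    have hIcc : uIcc 0 t ⊆ Icc 0 T := by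
      rw [uIcc_of_le ht.1]; exact Icc_subset_Icc_right ht.2
    rw [intervalIntegral.integral_sub
      (continuousOn_const.inner (hqc.mono hIcc)).intervalIntegrable
      (continuousOn_const.inner (hmc.mono hIcc)).intervalIntegrable]
    have h1 := mildSolution_weak hS (𝓕 (ofRealL2 u₀)) V ht hφ hc
    simp_rw [← inner_hat_testFun hφ hc, ← inner_hat_laplacian_testFun hφ hc] at h1
    have h2 := congrArg (fun r : ℝ => (r : ℂ)) (hu.weak_eq φ hφ hc t ht)
    simp only [Complex.ofReal_add, ← intervalIntegral.integral_ofReal,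
      ← integral_ofRealL2_mul] at h2
    have h3 := integral_indicator_smul hS ht (memLp_testFun hφ hc) hv
    simp_rw [smul_eq_mul, mul_comm (φ _)] at h3
    have h4 : ∫ p, (Ico 0 t ×ˢ S).indicator (fun q => φ q.2) p • V p ∂slab d T =
        ((∫ s in (0 : ℝ)..t, ∫ x, S.indicator (fun y => v (s, y)) x * φ x : ℝ) : ℂ) := by
      rw [← h3, ← integral_complex_ofReal]
      refine integral_congr_ae ((MemLp.ofReal (K := ℂ) hv).coeFn_toLp.mono fun p hp => ?_)
      simp only [hV, hp, Complex.real_smul]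
      push_cast; rfl
    simp_rw [← hqi, ← inner_hat_testFun hφ hc] at h2
    have h0 : inner ℂ (hat (testFun hφ hc)) (𝓕 (ofRealL2 u₀)) =
        ∫ x, ofRealL2 u₀ x * (φ x : ℂ) := by
      rw [inner_hat_testFun hφ hc, FourierTransform.fourierInv_fourier_eq]
    simp_rw [← inner_hat_laplacian_testFun hφ hc] at h2
    rw [← h0, intervalIntegral.integral_ofReal] at h2
    rw [h4, ← hm] at h1
    linear_combination h2 - h1
  intro t ht
  have := hsub t
  rw [key t ht] at this
  rw [← sub_eq_zero]
  exact this.trans (map_zero (Lp.fourierTransformₗᵢ (E d) ℂ))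

theorem eq_ofRealL2_add (U : CL2 d) :
    ∃ a b : L2 d, U = ofRealL2 a + Complex.I • ofRealL2 b := by
  refine ⟨reL2 U, reL2 (-Complex.I • U), ?_⟩
  ext1
  filter_upwards [Lp.coeFn_add (ofRealL2 (reL2 U)) (Complex.I • ofRealL2 (reL2 (-Complex.I • U))),
    Lp.coeFn_smul Complex.I (ofRealL2 (reL2 (-Complex.I • U))), coeFn_ofRealL2 (reL2 U),
    coeFn_ofRealL2 (reL2 (-Complex.I • U)), coeFn_reL2 U, coeFn_reL2 (-Complex.I • U),
    Lp.coeFn_smul (-Complex.I) U] with x h1 h2 h3 h4 h5 h6 h7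
  rw [h1, Pi.add_apply, h2, Pi.smul_apply, h3, h4, h5, h6, h7]
  apply Complex.ext <;> simp

/-- By uniqueness the controlled solution is the mild one; testing its vanishing at time `T` with
`z` gives the bound with the norm of the control as constant. Complex data are handled through their
real and imaginary parts. -/
theorem exists_norm_inner_le_of_nullControllable (hS : MeasurableSet S) {T : ℝ} (hT : 0 < T)
    (h : NullControllable S T) (y : CL2 d) :
    ∃ C, 0 ≤ C ∧ ∀ z, ‖inner ℂ (heatOp T z) y‖ ≤ C * ‖obsOp hS T 0 T z‖ := by
  have hreal : ∀ u₀ : L2 d, ∃ C, 0 ≤ C ∧ ∀ z,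
      ‖inner ℂ (heatOp T z) (𝓕 (ofRealL2 u₀) : CL2 d)‖ ≤ C * ‖obsOp hS T 0 T z‖ := by
    intro u₀
    obtain ⟨v, hv, u, hu, huT⟩ := h u₀
    have hm := hu.fourier_ofRealL2_eq hS hT.le hv T (right_mem_Icc.2 hT.le)
    set V : Lp ℂ 2 (slab d T) := (MemLp.ofReal (K := ℂ) hv).toLp _
    refine ⟨‖V‖, norm_nonneg _, fun z => ?_⟩
    have h0 := inner_mildSolution hS T (𝓕 (ofRealL2 u₀)) V hT.le z
    rw [← hm, huT, map_zero] at h0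
    have hz : (𝓕 (0 : CL2 d) : CL2 d) = 0 := map_zero (Lp.fourierTransformₗᵢ (E d) ℂ)
    rw [hz, inner_zero_right, eq_comm, add_eq_zero_iff_eq_neg] at h0
    rw [h0, norm_neg, mul_comm]
    exact norm_inner_le_norm _ _
  obtain ⟨a, b, hab⟩ := eq_ofRealL2_add (𝓕⁻ y : CL2 d)
  obtain ⟨Ca, hCa, ha⟩ := hreal a
  obtain ⟨Cb, hCb, hb⟩ := hreal b
  have hy : y = 𝓕 (ofRealL2 a) + Complex.I • (𝓕 (ofRealL2 b) : CL2 d) := by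
    have := congrArg (fun q : CL2 d => (𝓕 q : CL2 d)) hab
    simp only [FourierTransform.fourier_fourierInv_eq] at this
    rw [this]
    change Lp.fourierTransformₗᵢ (E d) ℂ _ = _
    rw [map_add, map_smul]
    rfl
  refine ⟨Ca + Cb, add_nonneg hCa hCb, fun z => ?_⟩
  rw [hy, inner_add_right, inner_smul_right, add_mul]
  refine (norm_add_le _ _).trans (add_le_add (ha z) ?_)
  rw [norm_mul, Complex.norm_I, one_mul]
  exact hb z

/-- Null-controllability implies observability. -/
theorem observability_of_nullControllable (hS : MeasurableSet S) {T : ℝ} (hT : 0 < T)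
    (h : NullControllable S T) :
    ∃ C, ∀ z, ‖heatOp T z‖ ≤ C * ‖obsOp hS T 0 T z‖ := by
  -- The family is indexed by all `z`. If the observation of `z` is zero, the inverse norm is 0 and
  -- the bound says nothing; that case is settled below by pairing the flow at time `T` with itself.
  obtain ⟨C, hC⟩ := banach_steinhaus
    (g := fun z : CL2 d => ((‖obsOp hS T 0 T z‖⁻¹ : ℝ) : ℂ) • innerSL ℂ (heatOp T z)) fun y => by
      obtain ⟨C, hC0, hC⟩ := exists_norm_inner_le_of_nullControllable hS hT h y
      refine ⟨C, fun z => ?_⟩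
      rw [_root_.smul_apply, innerSL_apply_apply, norm_smul, Complex.norm_real,
        norm_inv, norm_norm]
      rcases (norm_nonneg (obsOp hS T 0 T z)).eq_or_lt with h0 | h0
      · rw [← h0]; simpa using hC0
      · rw [inv_mul_le_iff₀ h0, mul_comm]; exact hC z
  refine ⟨C, fun z => ?_⟩
  rcases (norm_nonneg (obsOp hS T 0 T z)).eq_or_lt with h0 | h0
  · obtain ⟨D, -, hD⟩ := exists_norm_inner_le_of_nullControllable hS hT h (heatOp T z)
    have := hD z
    rw [← h0, mul_zero, inner_self_eq_norm_sq_to_K] at this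
    rw [← h0, mul_zero]
    have h1 : ‖heatOp T z‖ ^ 2 ≤ 0 := by simpa using this
    nlinarith [norm_nonneg (heatOp T z)]
  · have := hC z
    rw [norm_smul, Complex.norm_real, norm_inv, norm_norm, innerSL_apply_norm,
      inv_mul_le_iff₀ h0, mul_comm] at this
    exact this

end

/-! ### Observability gives thickness: travelling test packets. -/

section

variable {d : ℕ} {S : Set (E d)}

/-- The indicator of the unit ball, modulated to frequency-side position `y`. -/
def packet (y : E d) : E d → ℂ := fun ξ =>
  Complex.exp (-phase y ξ) * (Metric.closedBall (0 : E d) 1).indicator 1 ξ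

theorem norm_exp_neg_phase (y ξ : E d) : ‖Complex.exp (-phase y ξ)‖ = 1 := by
  rw [show -phase y ξ = ((-(2 * Real.pi * inner ℝ ξ y) : ℝ) : ℂ) * Complex.I by
      rw [phase]; push_cast; ring, Complex.norm_exp_ofReal_mul_I]

theorem norm_packet (y ξ : E d) :
    ‖packet y ξ‖ = (Metric.closedBall (0 : E d) 1).indicator 1 ξ := by
  rw [packet, norm_mul, norm_exp_neg_phase, one_mul, norm_indicator_eq_indicator_norm]
  congr 1; ext; simp

theorem measurable_packet (y : E d) : Measurable (packet y) := by
  have hc : Continuous fun ξ => Complex.exp (-phase y ξ) :=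
    Complex.continuous_exp.comp ((continuous_phase (d := d)).comp (Continuous.prodMk_right y)).neg
  exact hc.measurable.mul (measurable_one.indicator measurableSet_closedBall)

theorem memLp_packet (y : E d) (p : ℝ≥0∞) : MemLp (packet y) p volume := by
  have h : MemLp ((Metric.closedBall (0 : E d) 1).indicator (1 : E d → ℝ)) p volume :=
    memLp_indicator_const p measurableSet_closedBall 1 (Or.inr measure_closedBall_lt_top.ne)
  refine h.of_le (measurable_packet y).aestronglyMeasurable (Filter.Eventually.of_forall fun ξ => ?_)
  rw [norm_packet]
  exact le_abs_self _

/-- Modulation in frequency is translation in space, so all packets evolve as translates of a single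
profile. -/
theorem heatFlow_packet (τ : ℝ) (y x : E d) :
    heatFlow τ (packet y) x = heatFlow τ (packet 0) (x - y) := by
  rw [heatFlow, heatFlow, fourierInv_eq_exp_phase, fourierInv_eq_exp_phase]
  congr 1; ext ξ
  have e : Complex.exp (phase (x - y) ξ) = Complex.exp (phase x ξ) * Complex.exp (-phase y ξ) := by
    rw [← Complex.exp_add, phase, phase, phase, inner_sub_right]
    congr 1; push_cast; ring
  have e0 : Complex.exp (-phase (0 : E d) ξ) = 1 := by simp [phase]
  rw [packet, packet, e, e0]; ring

theorem enorm_heatFlow_packet_le {τ : ℝ} (hτ : 0 ≤ τ) (x : E d) :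
    ‖heatFlow τ (packet 0) x‖ₑ ≤ volume (Metric.closedBall (0 : E d) 1) := by
  rw [heatFlow, fourierInv_eq_exp_phase]
  refine (enorm_integral_le_lintegral_enorm _).trans ?_
  rw [← lintegral_indicator_one measurableSet_closedBall]
  refine lintegral_mono fun ξ => ?_
  rw [enorm_mul, enorm_mul, ← ofReal_norm, norm_exp_phase, ENNReal.ofReal_one, one_mul]
  have h1 : ‖(Real.exp (-τ * symb ξ) : ℂ)‖ₑ ≤ 1 := by
    rw [← ofReal_norm, Complex.norm_real, Real.norm_eq_abs, Real.abs_exp, ENNReal.ofReal_le_one,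
      Real.exp_le_one_iff]
    nlinarith [symb_nonneg ξ]
  refine (mul_le_of_le_one_left zero_le h1).trans ?_
  rw [← ofReal_norm, norm_packet]
  by_cases hξ : ξ ∈ Metric.closedBall (0 : E d) 1 <;> simp [hξ]

/-- The `L²` class of a packet. -/
def packetL2 (y : E d) : CL2 d := (memLp_packet y 2).toLp _

theorem heatFlow_packetL2 (τ : ℝ) (y : E d) :
    heatFlow τ (packetL2 y) = heatFlow τ (packet y) :=
  heatFlow_congr_ae (memLp_packet y 2).coeFn_toLp

theorem enorm_heatOp_packetL2 {τ : ℝ} (hτ : 0 < τ) (y : E d) :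
    ‖heatOp τ (packetL2 y)‖ₑ ^ 2 = ‖heatOp τ (packetL2 (0 : E d))‖ₑ ^ 2 := by
  rw [← lintegral_heatFlow_sq hτ, ← lintegral_heatFlow_sq hτ]
  simp_rw [heatFlow_packetL2, heatFlow_packet τ y]
  exact lintegral_sub_right_eq_self (fun x => ‖heatFlow τ (packet 0) x‖ₑ ^ 2) y

theorem heatOp_packetL2_ne_zero {τ : ℝ} (hτ : 0 ≤ τ) : heatOp τ (packetL2 (0 : E d)) ≠ 0 := by
  intro h
  have h1 := coeFn_heatOp hτ (packetL2 (0 : E d))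
  rw [h] at h1
  have hae : ∀ᵐ ξ : E d, ξ ∉ Metric.closedBall (0 : E d) 1 := by
    filter_upwards [h1, Lp.coeFn_zero ℂ 2 (volume : Measure (E d)),
      (memLp_packet (0 : E d) 2).coeFn_toLp] with ξ h2 h3 h4 hξ
    rw [h3, packetL2, h4, Pi.zero_apply, eq_comm, mul_eq_zero, Complex.ofReal_eq_zero] at h2
    have h5 : packet 0 ξ = 0 := h2.resolve_left (Real.exp_pos _).ne'
    have h6 := norm_packet 0 ξ
    rw [h5, indicator_of_mem hξ] at h6
    simp at h6
  have hz : volume (Metric.closedBall (0 : E d) 1) = 0 := by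
    rw [measure_eq_zero_iff_ae_notMem]; exact hae
  exact (Metric.measure_closedBall_pos volume (0 : E d) one_pos).ne' hz

/-- The energy of the packet far away from its centre. -/
def packetTail (d : ℕ) (T R : ℝ) : ℝ≥0∞ :=
  ∫⁻ τ in Ioc 0 T, ∫⁻ x in (Metric.closedBall (0 : E d) R)ᶜ, ‖heatFlow τ (packet 0) x‖ₑ ^ 2

theorem measurable_enorm_heatFlow_packet (d : ℕ) :
    Measurable fun p : ℝ × E d => ‖heatFlow p.1 (packet 0) p.2‖ₑ ^ 2 := by
  have := (stronglyMeasurable_heatFlow (packetL2 (0 : E d))).measurable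
  simp_rw [heatFlow_packetL2] at this
  exact this.enorm.pow_const 2

theorem tendsto_packetTail (d : ℕ) (T : ℝ) :
    Filter.Tendsto (fun n : ℕ => packetTail d T n) Filter.atTop (nhds 0) := by
  set μ : Measure (ℝ × E d) := ((volume : Measure ℝ).restrict (Ioc 0 T)).prod volume
  set F : ℝ × E d → ℝ≥0∞ := fun p => ‖heatFlow p.1 (packet 0) p.2‖ₑ ^ 2 with hF
  have hFm : Measurable F := measurable_enorm_heatFlow_packet d
  set A : ℕ → Set (ℝ × E d) := fun n => Prod.snd ⁻¹' (Metric.closedBall (0 : E d) n)ᶜ with hA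
  have hAm : ∀ n, MeasurableSet (A n) := fun n =>
    measurable_snd measurableSet_closedBall.compl
  have htail : ∀ n : ℕ, packetTail d T n = ∫⁻ p, (A n).indicator F p ∂μ := by
    intro n
    rw [lintegral_prod _ (hFm.indicator (hAm n)).aemeasurable, packetTail]
    refine lintegral_congr fun τ => ?_
    rw [← lintegral_indicator measurableSet_closedBall.compl]
    rfl
  simp_rw [htail]
  have hfin : ∫⁻ p, F p ∂μ ≠ ⊤ := by
    rw [lintegral_prod _ hFm.aemeasurable]
    have : ∫⁻ τ in Ioc 0 T, ∫⁻ x, F (τ, x) ≤ ∫⁻ _ in Ioc 0 T, ‖packetL2 (0 : E d)‖ₑ ^ 2 := by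
      refine setLIntegral_mono' measurableSet_Ioc fun τ hτ => ?_
      have := lintegral_heatFlow_sq hτ.1 (packetL2 (0 : E d))
      simp_rw [heatFlow_packetL2] at this
      rw [hF, this]
      gcongr
      exact enorm_heatOp_le _ _
    refine (this.trans_lt ?_).ne
    rw [setLIntegral_const, Real.volume_Ioc]
    finiteness
  have := tendsto_lintegral_of_dominated_convergence (μ := μ) (F := fun n => (A n).indicator F)
    (f := fun _ => 0) F (fun n => hFm.indicator (hAm n))
    (fun n => Filter.Eventually.of_forall fun p => indicator_le_self' (fun _ _ => zero_le) p) hfin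
    (Filter.Eventually.of_forall fun p => by
      obtain ⟨N, hN⟩ := exists_nat_ge ‖p.2‖
      refine tendsto_const_nhds.congr' ?_
      filter_upwards [Filter.eventually_ge_atTop N] with n hn
      rw [indicator_of_notMem]
      have : (N : ℝ) ≤ n := by exact_mod_cast hn
      simp only [hA, mem_preimage, mem_compl_iff, not_not, mem_closedBall_zero_iff]
      linarith)
  simpa using this

/-- Inside `B` the flow is bounded by the volume of the frequency ball, so the energy there is
controlled by the measure of S ∩ B; outside `B` only the tail of the profile remains. -/
theorem localEnergy_packetL2_le {B : Set (E d)} (hB : MeasurableSet B)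
    {y : E d} {R : ℝ} (hBR : Metric.closedBall y R ⊆ B) {τ : ℝ} (hτ : 0 ≤ τ) :
    localEnergy S (packetL2 y) τ ≤ volume (Metric.closedBall (0 : E d) 1) ^ 2 * volume (S ∩ B) +
      ∫⁻ x in (Metric.closedBall (0 : E d) R)ᶜ, ‖heatFlow τ (packet 0) x‖ₑ ^ 2 := by
  rw [localEnergy]
  simp_rw [heatFlow_packetL2, heatFlow_packet τ y]
  rw [← lintegral_inter_add_sdiff _ S hB]
  refine add_le_add ?_ ?_
  · calc _ ≤ ∫⁻ _ in S ∩ B, volume (Metric.closedBall (0 : E d) 1) ^ 2 :=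
          lintegral_mono fun x => by gcongr; exact enorm_heatFlow_packet_le hτ _
      _ = _ := setLIntegral_const _ _
  · calc _ ≤ ∫⁻ x in (fun x => x - y) ⁻¹' (Metric.closedBall (0 : E d) R)ᶜ,
          ‖heatFlow τ (packet 0) (x - y)‖ₑ ^ 2 := by
          refine lintegral_mono_set fun x hx hx' => hx.2 (hBR ?_)
          rw [mem_closedBall_zero_iff, ← dist_eq_norm] at hx'
          exact hx'
      _ = _ := (measurePreserving_sub_right volume y).setLIntegral_comp_preimage
          measurableSet_closedBall.compl
          ((measurable_enorm_heatFlow_packet d).comp (measurable_const.prodMk measurable_id))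

/-- Observability implies thickness. -/
theorem isThick_of_observability (hS : MeasurableSet S) {T C : ℝ} (hT : 0 < T)
    (h : ∀ z, ‖heatOp T z‖ ≤ C * ‖obsOp hS T 0 T z‖) : IsThick S := by
  set κ : ℝ≥0∞ := ‖heatOp T (packetL2 (0 : E d))‖ₑ ^ 2 with hκ
  have hκ0 : κ ≠ 0 := by
    rw [hκ]; exact pow_ne_zero 2 (by simpa using heatOp_packetL2_ne_zero hT.le)
  have hκt : κ ≠ ⊤ := by rw [hκ]; finiteness
  set A := volume (Metric.closedBall (0 : E d) 1) with hA
  have hAt : A ≠ ⊤ := measure_closedBall_lt_top.ne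
  set M : ℝ≥0∞ := ENNReal.ofReal C ^ 2 with hM
  have hMt : M ≠ ⊤ := by rw [hM]; finiteness
  -- The radius is chosen so that the tail accounts for less than half of the final energy κ,
  -- uniformly in the position of the packet.
  obtain ⟨n, hn0, hn⟩ : ∃ n : ℕ, 0 < n ∧ M * packetTail d T n < κ / 2 := by
    have h1 := ENNReal.Tendsto.const_mul (tendsto_packetTail d T) (Or.inr hMt)
    rw [mul_zero] at h1
    have h2 := h1.eventually_lt_const (ENNReal.half_pos hκ0)
    exact ((Filter.eventually_gt_atTop 0).and h2).exists
  have hbound : ∀ x : E d, κ / 2 ≤ M * ENNReal.ofReal T * A ^ 2 *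
      volume (S ∩ (fun y => x + y) '' box fun _ => 2 * (n : ℝ)) := by
    intro x
    set B := (fun y => x + y) '' box (d := d) fun _ => 2 * (n : ℝ) with hB
    -- The centre of the box of side 2n with corner `x`, so that the ball of radius `n` fits inside.
    set y : E d := x + WithLp.toLp 2 fun _ => (n : ℝ) with hy
    have hBm : MeasurableSet B :=
      (MeasurableEquiv.addLeft x).measurableSet_image.2 (measurableSet_box _)
    have hBR : Metric.closedBall y n ⊆ B := by
      intro p hp
      refine ⟨p - x, fun j => ?_, by simp⟩
      have h1 := (PiLp.norm_apply_le (p - y) j).trans (mem_closedBall_iff_norm.1 hp)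
      rw [Real.norm_eq_abs, abs_le] at h1
      simp only [hy, PiLp.sub_apply, PiLp.add_apply] at h1 ⊢
      constructor <;> linarith [h1.1, h1.2]
    have h1 : κ ≤ M * (ENNReal.ofReal T * (A ^ 2 * volume (S ∩ B)) + packetTail d T n) := by
      calc κ = ‖heatOp T (packetL2 y)‖ₑ ^ 2 := (enorm_heatOp_packetL2 hT y).symm
        _ ≤ (ENNReal.ofReal C * ‖obsOp hS T 0 T (packetL2 y)‖ₑ) ^ 2 := by
            gcongr
            rw [← ofReal_norm, ← ofReal_norm, ← ENNReal.ofReal_mul' (norm_nonneg _)]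
            exact ENNReal.ofReal_le_ofReal (h _)
        _ = M * ∫⁻ τ in Ioc 0 T, localEnergy S (packetL2 y) τ := by
            rw [mul_pow, enorm_obsOp_zero_sq]
        _ ≤ M * ∫⁻ τ in Ioc 0 T, (A ^ 2 * volume (S ∩ B) +
              ∫⁻ x in (Metric.closedBall (0 : E d) n)ᶜ, ‖heatFlow τ (packet 0) x‖ₑ ^ 2) := by
            gcongr M * ?_
            exact setLIntegral_mono' measurableSet_Ioc fun τ hτ =>
              localEnergy_packetL2_le hBm hBR hτ.1.le
        _ = _ := by
            rw [lintegral_add_left measurable_const, setLIntegral_const, Real.volume_Ioc, sub_zero,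
              packetTail, mul_comm (ENNReal.ofReal T)]
    rw [mul_add] at h1
    have h2 : κ ≤ M * (ENNReal.ofReal T * (A ^ 2 * volume (S ∩ B))) + κ / 2 :=
      h1.trans (by gcongr)
    have h3 := tsub_le_iff_right.2 h2
    rw [ENNReal.sub_half hκt] at h3
    refine h3.trans_eq (by ring)
  set D : ℝ≥0∞ := M * ENNReal.ofReal T * A ^ 2 with hD
  have hDt : D ≠ ⊤ := by rw [hD]; finiteness
  -- The +1 avoids dividing by `D`, not yet known to be nonzero.
  set δ : ℝ := (κ / 2 / (D + 1)).toReal with hδ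
  have hδt : κ / 2 / (D + 1) ≠ ⊤ := ENNReal.div_ne_top (by finiteness) (by simp)
  have hδ0 : 0 < δ := ENNReal.toReal_pos
    (ENNReal.div_ne_zero.2 ⟨(ENNReal.half_pos hκ0).ne', by finiteness⟩) hδt
  have hn' : (0 : ℝ) < n := by exact_mod_cast hn0
  have hP : 0 < (2 * (n : ℝ)) ^ d := by positivity
  refine ⟨min 1 (δ / (2 * (n : ℝ)) ^ d), fun _ => 2 * (n : ℝ), lt_min one_pos (by positivity),
    min_le_left _ _, fun _ => by positivity, hS.nullMeasurableSet, fun x => ?_⟩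
  calc _ ≤ ENNReal.ofReal δ := by
        refine ENNReal.ofReal_le_ofReal ?_
        rw [Finset.prod_const, Finset.card_univ, Fintype.card_fin]
        calc _ ≤ δ / (2 * (n : ℝ)) ^ d * (2 * (n : ℝ)) ^ d := by
              gcongr; exact min_le_right _ _
          _ = δ := by field_simp
    _ = κ / 2 / (D + 1) := ENNReal.ofReal_toReal hδt
    _ ≤ _ := by
        refine ENNReal.div_le_of_le_mul ((hbound x).trans ?_)
        rw [mul_comm]
        gcongr
        exact le_self_add

end

/-! ### Null-set invariance and the explicit control cost. -/

section

variable {d : ℕ} {S S' : Set (E d)}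

theorem IsThickWith.congr {γ : ℝ} {a : Fin d → ℝ} (h : IsThickWith S γ a)
    (hSS' : S =ᵐ[volume] S') : IsThickWith S' γ a :=
  ⟨h.gamma_pos, h.gamma_le_one, h.a_pos, h.measurable.congr hSS', fun x =>
    (h.measure_ge x).trans_eq (measure_congr (hSS'.inter (ae_eq_refl _)))⟩

theorem IsSolution.congr {T : ℝ} {u₀ : L2 d} {v : ℝ × E d → ℝ} {u : ℝ → L2 d}
    (h : IsSolution S T u₀ v u) (hSS' : S =ᵐ[volume] S') : IsSolution S' T u₀ v u := by
  refine ⟨h.continuousOn, fun φ hφ hc t ht => ?_⟩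
  rw [h.weak_eq φ hφ hc t ht]
  congr 2
  ext s
  refine integral_congr_ae ?_
  filter_upwards [indicator_ae_eq_of_ae_eq_set (f := fun y => v (s, y)) hSS'] with x hx
  rw [hx]

theorem steersToZero_congr (hSS' : S =ᵐ[volume] S') (T : ℝ) (u₀ : L2 d) (v : ℝ × E d → ℝ) :
    SteersToZero S T u₀ v ↔ SteersToZero S' T u₀ v :=
  ⟨fun ⟨hv, u, hu, h0⟩ => ⟨hv, u, hu.congr hSS', h0⟩,
    fun ⟨hv, u, hu, h0⟩ => ⟨hv, u, hu.congr hSS'.symm, h0⟩⟩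

theorem nullControllable_congr (hSS' : S =ᵐ[volume] S') (T : ℝ) :
    NullControllable S T ↔ NullControllable S' T :=
  forall_congr' fun u₀ => exists_congr fun v => steersToZero_congr hSS' T u₀ v

theorem controlCost_congr (hSS' : S =ᵐ[volume] S') (T : ℝ) :
    controlCost S T = controlCost S' T := by
  simp only [controlCost, steersToZero_congr hSS', Measure.restrict_congr_set hSS']

theorem one_le_lsFactor {γ : ℝ} (hd : 1 ≤ d) (hγ : 0 < γ) (hγ1 : γ ≤ 1) : 1 ≤ lsFactor d γ := by
  have h := one_le_lsBase hd hγ hγ1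
  rw [lsFactor, one_le_div hγ]
  linarith

theorem lsRate_nonneg {γ : ℝ} {a : Fin d → ℝ} (h : IsThickWith S γ a) : 0 ≤ lsRate γ a := by
  have hγ := h.gamma_pos
  have : 0 ≤ ∑ j, a j := Finset.sum_nonneg fun j _ => (h.a_pos j).le
  rw [lsRate]; positivity

/-- Observability from thick sets with the Logvinenko-Sereda constants. -/
theorem IsThickWith.norm_heatOp_le {γ : ℝ} {a : Fin d → ℝ} (hd : 1 ≤ d) (hS : MeasurableSet S)
    (h : IsThickWith S γ a) {T : ℝ} (hT : 0 < T) (z : CL2 d) :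
    ‖heatOp T z‖ ≤ √(48 * lsFactor d γ ^ 4 * Real.exp ((3 * lsRate γ a ^ 2 + 1) / T)) *
      ‖obsOp hS T 0 T z‖ :=
  norm_heatOp_le_of_spectralInequality hS
    (fun _ hlam _ hFm hF2 hsupp => logvinenko_sereda hd hS h hFm hF2 hlam hsupp)
    (one_le_lsFactor hd h.gamma_pos h.gamma_le_one) (lsRate_nonneg h) hT z

/-- With X = 100^d/γ, the quantities 100, 1/γ and d are all at most X. Thus `lsFactor` and `lsRate`
contribute fixed powers of X, their numerical factors fitting in 100^7, and the exponent of
`costConstant` leaves ample room. -/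
theorem costConstant_bounds {γ : ℝ} {a : Fin d → ℝ} (hd : 1 ≤ d) (h : IsThickWith S γ a) :
    48 * lsFactor d γ ^ 4 ≤ costConstant 100 γ a ∧
      3 * lsRate γ a ^ 2 + 1 ≤ costConstant 100 γ a := by
  have hγ := h.gamma_pos
  have hγ1 := h.gamma_le_one
  set A := ∑ j, a j with hA
  have hA0 : 0 ≤ A := Finset.sum_nonneg fun j _ => (h.a_pos j).le
  set X : ℝ := 100 ^ d / γ with hX
  set g : ℝ := 1 / γ with hg
  have hg0 : 0 < g := by positivity
  have hd1 : (1 : ℝ) ≤ d := by exact_mod_cast hd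
  have hXg : X = 100 ^ d * g := by rw [hX, hg]; ring
  have hg1 : 1 ≤ g := by rw [hg, one_le_div hγ]; exact hγ1
  have hpow : (100 : ℝ) ≤ 100 ^ d := le_self_pow₀ (by norm_num) (by omega)
  have hX100 : 100 ≤ X := by rw [hXg]; nlinarith
  have hgX : g ≤ X := by rw [hXg]; nlinarith
  have hdX : (d : ℝ) ≤ X := by
    have h1 : (d : ℝ) ≤ 100 ^ d := by
      exact_mod_cast (Nat.lt_pow_self (by norm_num : 1 < 100) (n := d)).le
    rw [hXg]; nlinarith
  have hX0 : 0 < X := by linarith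
  -- The exponent part 100 d supplies X^100 since d ≥ 1; the part 100 A supplies (1 + A)² through 1
  -- + A ≤ e^A ≤ X^A.
  have hC : X ^ 100 * (1 + A) ^ 2 ≤ costConstant 100 γ a := by
    have h1 : X ^ 100 ≤ X ^ (100 * (d : ℝ)) := by
      rw [← Real.rpow_natCast]
      exact Real.rpow_le_rpow_of_exponent_le (by linarith) (by push_cast; linarith)
    have h2 : (1 + A) ^ 2 ≤ X ^ (100 * A) := by
      have e1 : 1 + A ≤ X ^ A := by
        calc 1 + A ≤ Real.exp A := by linarith [Real.add_one_le_exp A]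
          _ = Real.exp 1 ^ A := by rw [← Real.exp_mul, one_mul]
          _ ≤ X ^ A := Real.rpow_le_rpow (Real.exp_pos 1).le
              (by linarith [Real.exp_one_lt_d9]) hA0
      calc (1 + A) ^ 2 ≤ (X ^ A) ^ 2 := by gcongr
        _ = X ^ (A * 2) := by rw [← Real.rpow_natCast, ← Real.rpow_mul hX0.le]; norm_num
        _ ≤ _ := Real.rpow_le_rpow_of_exponent_le (by linarith) (by linarith)
    rw [costConstant, ← hX, ← hA, mul_add, Real.rpow_add hX0]
    exact mul_le_mul h1 h2 (by positivity) (by positivity)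
  have hA1 : 1 ≤ (1 + A) ^ 2 := one_le_pow₀ (by linarith)
  have hX1 : 1 ≤ X := by linarith
  have hX23 : X ^ 23 ≤ X ^ 100 := pow_le_pow_right₀ hX1 (by norm_num)
  have hX21 : X ^ 21 ≤ X ^ 100 := pow_le_pow_right₀ hX1 (by norm_num)
  have hX7 : (100 : ℝ) ^ 7 ≤ X ^ 7 := by gcongr
  constructor
  · have e : 48 * lsFactor d γ ^ 4 = (48 * 384 ^ 4) * (d : ℝ) ^ 4 * g ^ 12 := by
      rw [lsFactor, lsBase, hg]; field_simp; ring
    rw [e]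
    calc _ ≤ X ^ 7 * X ^ 4 * X ^ 12 := by
          gcongr; exact le_trans (by norm_num) hX7
      _ = X ^ 23 * 1 := by ring
      _ ≤ X ^ 100 * (1 + A) ^ 2 := mul_le_mul hX23 hA1 zero_le_one (by positivity)
      _ ≤ _ := hC
  · have e : 3 * lsRate γ a ^ 2 = (3 * 921600 ^ 2) * (d : ℝ) ^ 4 * g ^ 10 * A ^ 2 := by
      rw [lsRate, lsBase, hg, ← hA]; field_simp; ring
    rw [e]
    have h1 : (3 * 921600 ^ 2) * (d : ℝ) ^ 4 * g ^ 10 ≤ X ^ 21 := by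
      calc _ ≤ X ^ 7 * X ^ 4 * X ^ 10 := by
            gcongr; exact le_trans (by norm_num) hX7
        _ = X ^ 21 := by ring
    have h2 : 1 ≤ X ^ 21 := one_le_pow₀ (by linarith)
    calc _ ≤ X ^ 21 * A ^ 2 + X ^ 21 * 1 := by gcongr; simpa using h2
      _ ≤ X ^ 21 * (1 + A) ^ 2 := by rw [← mul_add]; gcongr; nlinarith
      _ ≤ X ^ 100 * (1 + A) ^ 2 := mul_le_mul_of_nonneg_right hX21 (by positivity)
      _ ≤ _ := hC

theorem IsThickWith.controlCost_le {γ : ℝ} {a : Fin d → ℝ} (hd : 1 ≤ d) (hS : MeasurableSet S)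
    (h : IsThickWith S γ a) {T : ℝ} (hT : 0 < T) :
    controlCost S T ≤ ENNReal.ofReal (costConstant 100 γ a ^ ((1 : ℝ) / 2) *
      Real.exp (costConstant 100 γ a / (2 * T))) := by
  refine (HeatControl.controlCost_le hS hT (Real.sqrt_nonneg _)
    (h.norm_heatOp_le hd hS hT)).trans (ENNReal.ofReal_le_ofReal ?_)
  obtain ⟨h1, h2⟩ := costConstant_bounds hd h
  set C := costConstant 100 γ a
  have hC0 : 0 ≤ C := le_trans (by positivity) h2
  have e : C ^ ((1 : ℝ) / 2) * Real.exp (C / (2 * T)) = √(C * Real.exp (C / T)) := by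
    rw [Real.sqrt_mul hC0, ← Real.sqrt_eq_rpow, ← Real.exp_half]
    congr 2; field_simp
  rw [e]
  gcongr

end

end HeatControl

end


theorem mainTheorem1 :
    (∀ (d : ℕ), 1 ≤ d → ∀ S : Set (HeatControl.E d), NullMeasurableSet S volume →
      ∀ T : ℝ, 0 < T → (HeatControl.IsThick S ↔ HeatControl.NullControllable S T)) ∧
    (∃ K : ℝ, 1 ≤ K ∧ ∀ (d : ℕ), 1 ≤ d → ∀ (S : Set (HeatControl.E d)) (γ : ℝ) (a : Fin d → ℝ),
      HeatControl.IsThickWith S γ a → ∀ T : ℝ, 0 < T →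
        HeatControl.controlCost S T ≤
          ENNReal.ofReal
            (HeatControl.costConstant K γ a ^ ((1 : ℝ) / 2) *
              Real.exp (HeatControl.costConstant K γ a / (2 * T)))) := by
  refine ⟨fun d hd S hS T hT => ?_, 100, by norm_num, fun d hd S γ a h T hT => ?_⟩
  -- Lebesgue measurability is traded for Borel measurability by changing `S` on a null set, which
  -- affects neither thickness nor solutions.
  · obtain ⟨S', -, hS', hSS'⟩ := hS.exists_measurable_superset_ae_eq
    rw [← HeatControl.nullControllable_congr hSS' T]
    constructor
    · rintro ⟨γ, a, h⟩ u₀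
      obtain ⟨v, hv, -⟩ := HeatControl.exists_steersToZero hS' hT (Real.sqrt_nonneg _)
        ((h.congr hSS'.symm).norm_heatOp_le hd hS' hT) u₀
      exact ⟨v, hv⟩
    · intro h
      obtain ⟨C, hC⟩ := HeatControl.observability_of_nullControllable hS' hT h
      obtain ⟨γ, a, hthick⟩ := HeatControl.isThick_of_observability hS' hT hC
      exact ⟨γ, a, hthick.congr hSS'⟩
  · obtain ⟨S', -, hS', hSS'⟩ := h.measurable.exists_measurable_superset_ae_eq
    rw [← HeatControl.controlCost_congr hSS' T]
    exact (h.congr hSS'.symm).controlCost_le hd hS' hT
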